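/- Let $N\ge 1$ be an integer, $\alpha>0$ and $U>2\alpha$. For $\psi\in H^1(\mathbb{R}^{3N};\mathbb{C})$ (no symmetry is imposed), with variables $X=(x_1,\dots,x_N)$, $x_i\in\mathbb{R}^3$, let $$\rho_\psi(x)=\sum_{i=1}^N\int_{\mathbb{R}^{3(N-1)}}|\psi(x_1,\dots,x,\dots,x_N)|^2\,dx_1\cdots\widehat{dx_i}\cdots dx_N ,$$ where $x$ stands at the $i$-th position and $\widehat{dx_i}$ means that $dx_i$ is omitted, and let $$\mathcal P^{(N)}_U[\psi]=\sum_{i=1}^N\int_{\mathbb{R}^{3N}}|\nabla_i\psi|^2\,dX+U\sum_{i<j}\int_{\mathbb{R}^{3N}}\frac{|\psi(X)|^2}{|x_i-x_j|}\,dX-\alpha\iint_{\mathbb{R}^3\times\mathbb{R}^3}\frac{\rho_\psi(x)\,\rho_\psi(y)}{|x-y|}\,dx\,dy$$ be the Pekar–Tomasevich (PT) functional. Let $$\mathcal E^{(N)}_U(\alpha)=\inf\Bigl\{\mathcal P^{(N)}_U[\psi]:\ \psi\in H^1(\mathbb{R}^{3N};\mathbb{C}),\ \int_{\mathbb{R}^{3N}}|\psi|^2\,dX=1\Bigr\}$$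 be the PT ground state energy. Then $$\mathcal E^{(N)}_U(\alpha)\ \ge\ \begin{cases}-0.0280\,N\,\dfrac{U^3}{U-2\alpha} & \text{if } 2\alpha<U<3\alpha,\\[2mm] -0.755\,N\,\alpha^2 & \text{if } U\ge 3\alpha.\end{cases}$$ -/

import Mathlib

open MeasureTheory
open scoped ENNReal ContDiff

namespace Pekar

noncomputable section

/-- Physical space `ℝ³` with the Euclidean norm. -/
abbrev Space : Type := EuclideanSpace ℝ (Fin 3)

/-- The configuration space `ℝ^{3N}` of `N` particles, `X = (x₁, …, x_N)`. Its measure `volume` is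
the product of the Lebesgue measures, i.e. `3N`-dimensional Lebesgue measure. -/
abbrev Config (N : ℕ) : Type := Fin N → Space

/-- The Hilbert space `L²(ℝ^{3N}; ℂ)`, without any symmetry restriction. -/
abbrev WaveFun (N : ℕ) : Type := Lp ℂ 2 (volume : Measure (Config N))

/-- The unit vector of `ℝ^{3N}` in the direction of the `k`-th coordinate of the `i`-th particle. -/
def dir {N : ℕ} (i : Fin N) (k : Fin 3) : Config N :=
  Pi.single i (EuclideanSpace.single k (1 : ℝ))

/-- `g ∈ L²` is the weak partial derivative of `ψ ∈ L²` in the direction `dir i k`: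
`∫ (∂_{i,k} φ) ψ = - ∫ φ g` for all test functions `φ ∈ C_c^∞(ℝ^{3N})`. -/
def IsWeakPartial {N : ℕ} (ψ : WaveFun N) (i : Fin N) (k : Fin 3) (g : WaveFun N) : Prop :=
  ∀ φ : Config N → ℝ, ContDiff ℝ ∞ φ → HasCompactSupport φ →
    ∫ X, (fderiv ℝ φ X (dir i k)) • ψ X = - ∫ X, φ X • g X

/-- Weak partial derivatives are unique. -/
theorem IsWeakPartial.unique {N : ℕ} {ψ g h : WaveFun N} {i : Fin N} {k : Fin 3}
    (hg : IsWeakPartial ψ i k g) (hh : IsWeakPartial ψ i k h) : g = h := by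
  apply Lp.ext
  refine ae_eq_of_integral_contDiff_smul_eq
    ((Lp.memLp g).locallyIntegrable (by norm_num))
    ((Lp.memLp h).locallyIntegrable (by norm_num)) ?_
  intro φ h1 h2
  have e1 := hg φ h1 h2
  have e2 := hh φ h1 h2
  rw [e1] at e2
  exact neg_injective e2

/-- Membership in the Sobolev space `H¹(ℝ^{3N})`: all weak first partial derivatives of `ψ ∈ L²`
exist in `L²`. -/
def MemH1 {N : ℕ} (ψ : WaveFun N) : Prop :=
  ∀ (i : Fin N) (k : Fin 3), ∃ g : WaveFun N, IsWeakPartial ψ i k g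

open Classical in
/-- The weak partial derivative `∂_{i,k} ψ` (set to `0` if there is none). -/
def weakPartial {N : ℕ} (ψ : WaveFun N) (i : Fin N) (k : Fin 3) : WaveFun N :=
  if h : ∃ g : WaveFun N, IsWeakPartial ψ i k g then h.choose else 0

/-- The kinetic energy `∑ᵢ ∫ |∇ᵢψ|² dX`. -/
def kinetic {N : ℕ} (ψ : WaveFun N) : ℝ≥0∞ :=
  ∑ i : Fin N, ∑ k : Fin 3, ∫⁻ X, ‖weakPartial ψ i k X‖ₑ ^ 2

/-- The Coulomb repulsion `∑_{i<j} ∫ |ψ(X)|² / |xᵢ - xⱼ| dX`. -/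
def repulsion {N : ℕ} (ψ : WaveFun N) : ℝ≥0∞ :=
  ∑ i : Fin N, ∑ j ∈ Finset.Ioi i, ∫⁻ X, ‖ψ X‖ₑ ^ 2 / ‖X i - X j‖ₑ

/-- The particle density `ρ_ψ(x) = ∑ᵢ ∫ |ψ(x₁, …, x, …, x_N)|² dx₁ ⋯ d̂xᵢ ⋯ dx_N`, with `x` at the
`i`-th position: the function `|ψ|²` is integrated over all the variables except the `i`-th. -/
def density {N : ℕ} (ψ : WaveFun N) (x : Space) : ℝ≥0∞ :=
  ∑ i : Fin N, lmarginal (fun _ => volume) ({i}ᶜ : Finset (Fin N)) (fun X => ‖ψ X‖ₑ ^ 2)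
    (fun _ => x)

/-- The Coulomb self-interaction `∬ ρ(x) ρ(y) / |x - y| dx dy` of a density. -/
def coulomb (ρ : Space → ℝ≥0∞) : ℝ≥0∞ :=
  ∫⁻ x, ∫⁻ y, ρ x * ρ y / ‖x - y‖ₑ

/-- The Pekar–Tomasevich functional
`∑ᵢ ∫ |∇ᵢψ|² + U ∑_{i<j} ∫ |ψ|² / |xᵢ - xⱼ| - α ∬ ρ_ψ(x) ρ_ψ(y) / |x - y| dx dy`.
For `ψ ∈ H¹` the three integrals are finite, so that the value is a real number. -/
def functional {N : ℕ} (U α : ℝ) (ψ : WaveFun N) : EReal :=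
  (kinetic ψ : EReal) + (U : EReal) * (repulsion ψ : EReal)
    - (α : EReal) * (coulomb (density ψ) : EReal)

/-- The Pekar–Tomasevich energy: the infimum of the functional over all `ψ ∈ H¹(ℝ^{3N})` with
`∫ |ψ|² = 1` (the infimum is taken in `[-∞, ∞]`). -/
def energy (N : ℕ) (U α : ℝ) : EReal :=
  ⨅ (ψ : WaveFun N) (_ : MemH1 ψ) (_ : ‖ψ‖ = 1), functional U α ψ

end

end Pekar

/-! Write `T`, `R`, `D` for the kinetic energy, the repulsion (without the factor `U`) and the
Coulomb self-interaction of `ρ`. Two inequalities carry the proof.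

The Lieb–Oxford inequality `coulomb_le_two_mul_repulsion_add`, `D ≤ 2 R + 2 · 1.68 ∫ ρ^{4/3}`,
trades the attraction for the repulsion. Replace each particle by a Gaussian charge whose width is
proportional to `ρ^{-1/3}` at its position. Positive definiteness of the Coulomb kernel, applied to
`ρ` minus these charges and averaged over `|ψ|²`, bounds `D` by `2 R`, up to the self-energies of
the charges and the error made by smearing. Both corrections are multiples of `∫ ρ^{4/3}`.

The second inequality, `lintegral_sqrtDensity_pow_three_le`, is `c ∫ ρ^{3/2} ≤ c² D / (16π) + T`.
Formally, the potential `Φ = ρ * 1/|x|` satisfies `-ΔΦ = 4πρ`, so `4π ∫ ρ √ρ = ∫ ∇Φ · ∇√ρ`, where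
`‖∇Φ‖² = 4πD` and `‖∇√ρ‖² ≤ T`; Cauchy–Schwarz and the arithmetic–geometric mean inequality finish.
The rigorous version uses the heat semigroup instead of gradients: `1/|x|` is `4π` times the time
integral of the heat kernel, and `T` enters only through `L²` norms of translation differences.

For `2α < V ≤ U`, lowering `U` to `V` and using Lieb–Oxford leaves at least `T + (V/2 - α) D - 1.68
V ∫ ρ^{4/3}`. The first two terms dominate a multiple of `∫ ρ^{3/2}`, and Young's inequality
interpolates `∫ ρ^{4/3}` between `∫ ρ^{3/2}` and `∫ ρ = N`. What remains is a constant times `N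
V³/(V - 2α)`. Over `V > 2α` this is smallest at `V = 3α`, whence the two regimes: `V = U` below
`3α`, and `V = 3α` from there on. -/

namespace Pekar

noncomputable section

open Real Set Filter Topology

/-! ### The heat kernel on `ℝ³` -/

/-- The heat kernel `(4πt)^{-3/2} exp(-|x|²/4t)` of `ℝ³`. -/
def heatKernel (t : ℝ) (x : Space) : ℝ :=
  (4 * π * t) ^ (-(3 / 2) : ℝ) * exp (-(‖x‖ ^ 2 / (4 * t)))

theorem measurable_heatKernel : Measurable (fun q : ℝ × Space => heatKernel q.1 q.2) := by
  unfold heatKernel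
  fun_prop

@[fun_prop]
theorem _root_.Measurable.heatKernel {β : Type*} [MeasurableSpace β] {t : β → ℝ} {x : β → Space}
    (ht : Measurable t) (hx : Measurable x) : Measurable fun b => heatKernel (t b) (x b) :=
  measurable_heatKernel.comp (ht.prodMk hx)

theorem heatKernel_nonneg {t : ℝ} (ht : 0 ≤ t) (x : Space) : 0 ≤ heatKernel t x := by
  unfold heatKernel
  positivity

theorem heatKernel_neg (t : ℝ) (x : Space) : heatKernel t (-x) = heatKernel t x := by
  simp [heatKernel]

theorem heatKernel_sub_comm (t : ℝ) (x y : Space) : heatKernel t (x - y) = heatKernel t (y - x) := by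
  rw [← heatKernel_neg, neg_sub]

theorem heatKernel_le {t : ℝ} (ht : 0 ≤ t) (x : Space) :
    heatKernel t x ≤ (4 * π * t) ^ (-(3 / 2) : ℝ) := by
  unfold heatKernel
  refine mul_le_of_le_one_right (by positivity) (exp_le_one_iff.2 ?_)
  have : 0 ≤ ‖x‖ ^ 2 / (4 * t) := by positivity
  linarith

open scoped RealInnerProductSpace in
theorem integral_exp_neg_mul_sq_norm_add_inner {b : ℝ} (hb : 0 < b) (w : Space) :
    ∫ v : Space, exp (-b * ‖v‖ ^ 2 + ⟪w, v⟫) =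
      (π / b) ^ (3 / 2 : ℝ) * exp (‖w‖ ^ 2 / (4 * b)) := by
  have h := GaussianFourier.integral_cexp_neg_mul_sq_norm_add (V := Space) (b := (b : ℂ))
    (by simpa using hb) 1 w
  have e1 : (fun v : Space => Complex.exp (-(b : ℂ) * (‖v‖ : ℂ) ^ 2 + 1 * ((⟪w, v⟫ : ℝ) : ℂ)))
      = fun v => ((exp (-b * ‖v‖ ^ 2 + ⟪w, v⟫) : ℝ) : ℂ) := by
    ext v
    push_cast
    simp
  rw [e1, integral_complex_ofReal] at h
  have e2 : ((π : ℂ) / b) ^ (((Module.finrank ℝ Space : ℕ) : ℂ) / 2) * Complex.exp (1 ^ 2 * (‖w‖ : ℂ) ^ 2 / (4 * b))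
      = (((π / b) ^ (3 / 2 : ℝ) * exp (‖w‖ ^ 2 / (4 * b)) : ℝ) : ℂ) := by
    rw [Complex.ofReal_mul, Complex.ofReal_cpow (by positivity)]
    push_cast
    simp
  rw [e2] at h
  exact_mod_cast h

theorem integrable_exp_neg_mul_sq_norm_add_inner {b : ℝ} (hb : 0 < b) (w : Space) :
    Integrable (fun v : Space => exp (-b * ‖v‖ ^ 2 + inner ℝ w v)) := by
  -- A non-integrable function has Bochner integral `0`, but the value just computed is positive.
  by_contra h
  have h1 := integral_exp_neg_mul_sq_norm_add_inner hb w
  rw [integral_undef h] at h1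
  have : 0 < (π / b) ^ (3 / 2 : ℝ) * exp (‖w‖ ^ 2 / (4 * b)) := by positivity
  linarith

theorem heatKernel_mul_exp_inner (t : ℝ) (w v : Space) :
    heatKernel t v * exp (inner ℝ w v) =
      (4 * π * t) ^ (-(3 / 2) : ℝ) * exp (-(1 / (4 * t)) * ‖v‖ ^ 2 + inner ℝ w v) := by
  rw [heatKernel, mul_assoc, ← exp_add]
  ring_nf

theorem integrable_heatKernel_mul_exp_inner {t : ℝ} (ht : 0 < t) (w : Space) :
    Integrable (fun v => heatKernel t v * exp (inner ℝ w v)) := by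
  simp_rw [heatKernel_mul_exp_inner]
  exact (integrable_exp_neg_mul_sq_norm_add_inner (by positivity) w).const_mul _

theorem integral_heatKernel_mul_exp_inner {t : ℝ} (ht : 0 < t) (w : Space) :
    ∫ v, heatKernel t v * exp (inner ℝ w v) = exp (t * ‖w‖ ^ 2) := by
  simp_rw [heatKernel_mul_exp_inner]
  rw [integral_const_mul, integral_exp_neg_mul_sq_norm_add_inner (by positivity), ← mul_assoc]
  have e1 : π / (1 / (4 * t)) = 4 * π * t := by field_simp
  have e2 : ‖w‖ ^ 2 / (4 * (1 / (4 * t))) = t * ‖w‖ ^ 2 := by field_simp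
  rw [e1, e2, ← rpow_add (by positivity)]
  norm_num

theorem integrable_heatKernel {t : ℝ} (ht : 0 < t) : Integrable (heatKernel t) := by
  simpa using integrable_heatKernel_mul_exp_inner ht 0

theorem integral_heatKernel {t : ℝ} (ht : 0 < t) : ∫ v, heatKernel t v = 1 := by
  simpa using integral_heatKernel_mul_exp_inner ht 0

/-- The second moments of the heat kernel. -/
theorem lintegral_heatKernel_mul_inner_sq_le {t : ℝ} (ht : 0 < t) (a : Space) :
    ∫⁻ v, ENNReal.ofReal (heatKernel t v * (inner ℝ a v) ^ 2) ≤
      ENNReal.ofReal (2 * t * ‖a‖ ^ 2) := by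
  -- Exponential moments are explicit, so they serve to bound the second moment: `u² ≤ (e^{su} +
  -- e^{-su} - 2)/s²` with `s = √c`, which is `|x| ≤ |sinh x|` squared. As `c → 0` the bound becomes
  -- a derivative of `exp` at `0`.
  have key : ∀ c : ℝ, 0 < c → ∫⁻ v, ENNReal.ofReal (heatKernel t v * (inner ℝ a v) ^ 2) ≤
      ENNReal.ofReal (2 * ((exp (c * (t * ‖a‖ ^ 2)) - 1) / c)) := by
    intro c hc
    set s := √c
    have hs : s ^ 2 = c := sq_sqrt hc.le
    have hspos : 0 < s := sqrt_pos.2 hc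
    have hi : Integrable (fun v => (1 / c) * (heatKernel t v * exp (inner ℝ (s • a) v)
        + heatKernel t v * exp (inner ℝ (-(s • a)) v) - 2 * heatKernel t v)) :=
      (((integrable_heatKernel_mul_exp_inner ht _).add
        (integrable_heatKernel_mul_exp_inner ht _)).sub
          ((integrable_heatKernel ht).const_mul 2)).const_mul _
    have hle : ∀ v, heatKernel t v * (inner ℝ a v) ^ 2 ≤
        (1 / c) * (heatKernel t v * exp (inner ℝ (s • a) v)
        + heatKernel t v * exp (inner ℝ (-(s • a)) v) - 2 * heatKernel t v) := by
      intro v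
      rw [inner_neg_left, inner_smul_left]
      simp only [conj_trivial]
      set u := inner ℝ a v
      have h1 : (s * u) ^ 2 ≤ exp (s * u) + exp (-(s * u)) - 2 := by
        have h2 : exp (s * u) + exp (-(s * u)) - 2 = (2 * sinh (s * u / 2)) ^ 2 := by
          have h3 : exp (s * u) = exp (s * u / 2) ^ 2 := by rw [← exp_nat_mul]; ring_nf
          have h4 : exp (-(s * u)) = exp (-(s * u / 2)) ^ 2 := by rw [← exp_nat_mul]; ring_nf
          have h5 : exp (s * u / 2) * exp (-(s * u / 2)) = 1 := by rw [← exp_add]; simp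
          rw [h3, h4, sinh_eq]
          linear_combination 2 * h5
        rw [h2, sq_le_sq, abs_mul 2, abs_sinh, abs_two]
        have h3 := self_le_sinh_iff.2 (abs_nonneg (s * u / 2))
        rw [abs_div, abs_two] at h3 ⊢
        linarith
      rw [mul_pow, hs] at h1
      have h3 := mul_le_mul_of_nonneg_left h1 (heatKernel_nonneg ht.le v)
      rw [one_div, ← div_eq_inv_mul, le_div_iff₀ hc]
      linarith
    calc _ ≤ ∫⁻ v, ENNReal.ofReal ((1 / c) * (heatKernel t v * exp (inner ℝ (s • a) v)
        + heatKernel t v * exp (inner ℝ (-(s • a)) v) - 2 * heatKernel t v)) :=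
          lintegral_mono fun v => ENNReal.ofReal_le_ofReal (hle v)
      _ = ENNReal.ofReal (∫ v, (1 / c) * (heatKernel t v * exp (inner ℝ (s • a) v)
        + heatKernel t v * exp (inner ℝ (-(s • a)) v) - 2 * heatKernel t v)) := by
          rw [ofReal_integral_eq_lintegral_ofReal hi]
          refine Eventually.of_forall fun v => le_trans ?_ (hle v)
          exact mul_nonneg (heatKernel_nonneg ht.le v) (sq_nonneg _)
      _ ≤ _ := by
          apply ENNReal.ofReal_le_ofReal
          have hi2 : Integrable (fun v => heatKernel t v * exp (inner ℝ (s • a) v)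
              + heatKernel t v * exp (inner ℝ (-(s • a)) v)) :=
            (integrable_heatKernel_mul_exp_inner ht _).add
              (integrable_heatKernel_mul_exp_inner ht _)
          rw [integral_const_mul, integral_sub hi2 ((integrable_heatKernel ht).const_mul 2),
            integral_add (integrable_heatKernel_mul_exp_inner ht _)
            (integrable_heatKernel_mul_exp_inner ht _), integral_const_mul,
            integral_heatKernel_mul_exp_inner ht, integral_heatKernel_mul_exp_inner ht,
            integral_heatKernel ht, norm_neg, norm_smul, mul_pow, norm_eq_abs, sq_abs, hs]
          apply le_of_eq
          ring_nf
  have hlim : Tendsto (fun c : ℝ => ENNReal.ofReal (2 * ((exp (c * (t * ‖a‖ ^ 2)) - 1) / c)))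
      (𝓝[>] 0) (𝓝 (ENNReal.ofReal (2 * t * ‖a‖ ^ 2))) := by
    apply ENNReal.tendsto_ofReal
    have hd : HasDerivAt (fun c : ℝ => exp (c * (t * ‖a‖ ^ 2))) (t * ‖a‖ ^ 2) 0 := by
      have := ((hasDerivAt_id (0 : ℝ)).mul_const (t * ‖a‖ ^ 2)).exp
      simpa using this
    have h1 := (hasDerivAt_iff_tendsto_slope_zero.1 hd).mono_left
      (nhdsWithin_mono (0 : ℝ) (fun x (hx : 0 < x) => hx.ne' : Ioi (0 : ℝ) ⊆ {0}ᶜ))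
    have h2 := h1.const_mul 2
    rw [mul_assoc]
    refine h2.congr fun c => ?_
    simp [div_eq_inv_mul]
  exact ge_of_tendsto hlim (eventually_mem_nhdsWithin.mono fun c hc => key c hc)

/-- The semigroup property of the heat kernel. -/
theorem integral_heatKernel_mul_heatKernel {s t : ℝ} (hs : 0 < s) (ht : 0 < t) (x y : Space) :
    Integrable (fun z => heatKernel s (x - z) * heatKernel t (z - y)) ∧
    ∫ z, heatKernel s (x - z) * heatKernel t (z - y) = heatKernel (s + t) (x - y) := by
  have e : ∀ z, heatKernel s (x - z) * heatKernel t (z - y) =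
      (fun v => (4 * π * s) ^ (-(3 / 2) : ℝ) * (4 * π * t) ^ (-(3 / 2) : ℝ) *
        exp (-(‖x - y‖ ^ 2 / (4 * s))) * exp (-(1 / (4 * s) + 1 / (4 * t)) * ‖v‖ ^ 2 +
          inner ℝ ((1 / (2 * s)) • (x - y)) v)) (z - y) := by
    intro z
    have h1 : ‖x - z‖ ^ 2 = ‖x - y‖ ^ 2 - 2 * inner ℝ (x - y) (z - y) + ‖z - y‖ ^ 2 := by
      rw [← norm_sub_sq_real]
      congr 2
      abel
    simp only [heatKernel, h1, inner_smul_left, conj_trivial]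
    rw [mul_mul_mul_comm, ← exp_add, mul_assoc (_ * _), ← exp_add]
    congr 2
    field_simp
    ring
  simp_rw [e]
  have hb : 0 < 1 / (4 * s) + 1 / (4 * t) := by positivity
  refine ⟨((integrable_exp_neg_mul_sq_norm_add_inner hb _).const_mul _).comp_sub_right y, ?_⟩
  rw [integral_sub_right_eq_self (fun v => (4 * π * s) ^ (-(3 / 2) : ℝ) * (4 * π * t) ^ (-(3 / 2) : ℝ) *
        exp (-(‖x - y‖ ^ 2 / (4 * s))) * exp (-(1 / (4 * s) + 1 / (4 * t)) * ‖v‖ ^ 2 +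
          inner ℝ ((1 / (2 * s)) • (x - y)) v)) y, integral_const_mul,
          integral_exp_neg_mul_sq_norm_add_inner hb, norm_smul, heatKernel]
  have e1 : (4 * π * s) ^ (-(3 / 2) : ℝ) * (4 * π * t) ^ (-(3 / 2) : ℝ) *
      (π / (1 / (4 * s) + 1 / (4 * t))) ^ (3 / 2 : ℝ) = (4 * π * (s + t)) ^ (-(3 / 2) : ℝ) := by
    rw [← mul_rpow (by positivity) (by positivity), rpow_neg (by positivity),
      rpow_neg (by positivity), ← inv_rpow (by positivity), ← inv_rpow (by positivity),
      ← mul_rpow (by positivity) (by positivity)]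
    congr 1
    field_simp
    ring
  have e2 : exp (-(‖x - y‖ ^ 2 / (4 * s))) * exp ((‖1 / (2 * s)‖ * ‖x - y‖) ^ 2 / (4 * (1 / (4 * s) + 1 / (4 * t))))
      = exp (-(‖x - y‖ ^ 2 / (4 * (s + t)))) := by
    rw [← exp_add, mul_pow, norm_eq_abs, sq_abs]
    congr 1
    field_simp
    ring
  rw [← e1, ← e2]
  ring

/-! ### The heat kernel with values in `[0, ∞]` -/

/-- The heat kernel with values in `[0, ∞]`. -/
def heatKernelE (t : ℝ) (x : Space) : ℝ≥0∞ := ENNReal.ofReal (heatKernel t x)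

@[fun_prop]
theorem _root_.Measurable.heatKernelE {β : Type*} [MeasurableSpace β] {t : β → ℝ} {x : β → Space}
    (ht : Measurable t) (hx : Measurable x) : Measurable fun b => heatKernelE (t b) (x b) :=
  (ht.heatKernel hx).ennreal_ofReal

theorem heatKernelE_sub_comm (t : ℝ) (x y : Space) :
    heatKernelE t (x - y) = heatKernelE t (y - x) := by
  rw [heatKernelE, heatKernel_sub_comm, heatKernelE]

theorem lintegral_heatKernelE_mul_heatKernelE {s t : ℝ} (hs : 0 < s) (ht : 0 < t) (x y : Space) :
    ∫⁻ z, heatKernelE s (x - z) * heatKernelE t (y - z) = heatKernelE (s + t) (x - y) := by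
  obtain ⟨h1, h2⟩ := integral_heatKernel_mul_heatKernel hs ht x y
  rw [heatKernelE, ← h2, ofReal_integral_eq_lintegral_ofReal h1 (Eventually.of_forall fun z =>
    mul_nonneg (heatKernel_nonneg hs.le _) (heatKernel_nonneg ht.le _))]
  refine lintegral_congr fun z => ?_
  rw [heatKernelE_sub_comm t, heatKernelE, heatKernelE, ENNReal.ofReal_mul (heatKernel_nonneg hs.le _)]

/-- Time integrals of the heat kernel are integrals of the Gaussian. -/
theorem setLIntegral_heatKernelE {x : Space} (hx : x ≠ 0) {S : Set ℝ} (hS : MeasurableSet S)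
    (hpos : S ⊆ Ioi 0) :
    ENNReal.ofReal (4 * π) * ∫⁻ τ in S, heatKernelE τ x =
      ENNReal.ofReal (2 / √π) * (∫⁻ u in (fun τ => ‖x‖ / (2 * √τ)) '' S,
        ENNReal.ofReal (exp (-u ^ 2))) / ‖x‖ₑ := by
  have hr : 0 < ‖x‖ := norm_pos_iff.2 hx
  have hd : ∀ τ ∈ S, HasDerivWithinAt (fun τ => ‖x‖ / (2 * √τ)) (-(‖x‖ / (4 * (τ * √τ)))) S τ := by
    intro τ hτ
    have hτ0 : 0 < τ := hpos hτ
    have h1 := ((hasDerivAt_sqrt hτ0.ne').const_mul 2)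
    have h2 := (h1.inv (by positivity)).const_mul ‖x‖
    refine (h2.congr_deriv ?_).hasDerivWithinAt
    have : √τ ^ 2 = τ := sq_sqrt hτ0.le
    field_simp
    rw [this]
    ring
  have hinj : InjOn (fun τ => ‖x‖ / (2 * √τ)) S := by
    intro a ha b hb hab
    have ha0 : 0 < a := hpos ha
    have hb0 : 0 < b := hpos hb
    simp only at hab
    have h1 : 0 < √a := sqrt_pos.2 ha0
    have h2 : 0 < √b := sqrt_pos.2 hb0
    field_simp at hab
    exact ((sqrt_inj hb0.le ha0.le).1 hab).symm
  rw [lintegral_image_eq_lintegral_abs_deriv_mul hS hd hinj,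
    ← lintegral_const_mul' _ _ ENNReal.ofReal_ne_top, ← lintegral_const_mul' _ _ ENNReal.ofReal_ne_top,
    div_eq_mul_inv, ← lintegral_mul_const' _ _ (by simp [hx])]
  refine setLIntegral_congr_fun hS fun τ hτ => ?_
  have hτ0 : 0 < τ := hpos hτ
  have hsq : 0 < √τ := sqrt_pos.2 hτ0
  rw [← ofReal_norm, ← ENNReal.ofReal_inv_of_pos hr, heatKernelE,
    ← ENNReal.ofReal_mul (by positivity), ← ENNReal.ofReal_mul (by positivity),
    ← ENNReal.ofReal_mul (by positivity), ← ENNReal.ofReal_mul (by positivity)]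
  congr 1
  have e1 : (4 * π * τ) ^ (-(3 / 2) : ℝ) = 1 / (8 * π * √π * τ * √τ) := by
    rw [rpow_neg (by positivity), show (3 / 2 : ℝ) = 1 + 1 / 2 by norm_num,
      rpow_add (by positivity), ← sqrt_eq_rpow, rpow_one, sqrt_mul (by positivity),
      sqrt_mul (by positivity), show (4 : ℝ) = 2 ^ 2 by norm_num, sqrt_sq (by norm_num)]
    field_simp
    ring
  have e2 : -(‖x‖ / (2 * √τ)) ^ 2 = -(‖x‖ ^ 2 / (4 * τ)) := by
    rw [div_pow, mul_pow, sq_sqrt hτ0.le]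
    norm_num
  rw [heatKernel, e1, e2, abs_neg, abs_of_pos (by positivity)]
  field_simp
  ring

theorem lintegral_exp_neg_sq_Ioi_zero :
    ∫⁻ u in Ioi (0 : ℝ), ENNReal.ofReal (exp (-u ^ 2)) = ENNReal.ofReal (√π / 2) := by
  have h := integral_gaussian_Ioi 1
  have hi : IntegrableOn (fun u : ℝ => exp (-1 * u ^ 2)) (Ioi 0) :=
    (integrable_exp_neg_mul_sq one_pos).integrableOn
  have e : (fun u : ℝ => exp (-1 * u ^ 2)) = fun u => exp (-u ^ 2) := by
    ext u
    rw [neg_one_mul]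
  rw [div_one, e] at h
  rw [e] at hi
  rw [← ofReal_integral_eq_lintegral_ofReal hi (Eventually.of_forall fun u => (exp_pos _).le), h]

theorem image_div_sqrt_Ioi {r : ℝ} (hr : 0 < r) :
    (fun τ => r / (2 * √τ)) '' Ioi 0 = Ioi 0 := by
  ext u
  simp only [mem_image, mem_Ioi]
  constructor
  · rintro ⟨τ, hτ, rfl⟩
    have := sqrt_pos.2 hτ
    positivity
  · intro hu
    refine ⟨(r / (2 * u)) ^ 2, by positivity, ?_⟩
    rw [sqrt_sq (by positivity)]
    field_simp

theorem image_div_sqrt_Ioo {r s : ℝ} (hr : 0 < r) (hs : 0 < s) :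
    (fun τ => r / (2 * √τ)) '' Ioo 0 s = Ioi (r / (2 * √s)) := by
  have hs' := sqrt_pos.2 hs
  ext u
  simp only [mem_image, mem_Ioi, mem_Ioo]
  constructor
  · rintro ⟨τ, ⟨hτ, hτs⟩, rfl⟩
    have := sqrt_pos.2 hτ
    have := sqrt_lt_sqrt hτ.le hτs
    gcongr
  · intro hu
    have hu0 : 0 < u := lt_trans (by positivity) hu
    refine ⟨(r / (2 * u)) ^ 2, ⟨by positivity, ?_⟩, ?_⟩
    · rw [div_lt_iff₀ (by positivity)] at hu
      rw [← lt_sqrt (by positivity), div_lt_iff₀ (by positivity)]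
      linarith
    · rw [sqrt_sq (by positivity)]
      field_simp

/-- The Coulomb potential is the time integral of the heat kernel. -/
theorem lintegral_heatKernelE_time {x : Space} (hx : x ≠ 0) :
    ENNReal.ofReal (4 * π) * ∫⁻ τ in Ioi 0, heatKernelE τ x = 1 / ‖x‖ₑ := by
  rw [setLIntegral_heatKernelE hx measurableSet_Ioi subset_rfl, image_div_sqrt_Ioi (norm_pos_iff.2 hx),
    lintegral_exp_neg_sq_Ioi_zero, ← ENNReal.ofReal_mul (by positivity)]
  congr 1
  have : 0 < √π := sqrt_pos.2 pi_pos
  rw [show 2 / √π * (√π / 2) = 1 by field_simp]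
  simp

theorem lintegral_heatKernelE_time_le (x : Space) :
    ENNReal.ofReal (4 * π) * ∫⁻ τ in Ioi 0, heatKernelE τ x ≤ 1 / ‖x‖ₑ := by
  by_cases hx : x = 0
  · simp [hx]
  · exact (lintegral_heatKernelE_time hx).le

/-! ### The complementary error function -/

theorem integrable_exp_neg_sq : Integrable (fun u : ℝ => exp (-u ^ 2)) := by
  simpa using integrable_exp_neg_mul_sq one_pos

/-- The complementary error function. -/
def erfc (t : ℝ) : ℝ := 2 / √π * ∫ u in Ioi t, exp (-u ^ 2)

theorem erfc_nonneg (t : ℝ) : 0 ≤ erfc t :=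
  mul_nonneg (by positivity) (integral_nonneg fun u => (exp_pos _).le)

theorem ofReal_erfc (t : ℝ) : ENNReal.ofReal (erfc t) =
    ENNReal.ofReal (2 / √π) * ∫⁻ u in Ioi t, ENNReal.ofReal (exp (-u ^ 2)) := by
  rw [erfc, ENNReal.ofReal_mul (by positivity), ofReal_integral_eq_lintegral_ofReal
    integrable_exp_neg_sq.integrableOn (Eventually.of_forall fun u => (exp_pos _).le)]

theorem erfc_eq (t : ℝ) : erfc t = erfc 0 - 2 / √π * ∫ u in (0 : ℝ)..t, exp (-u ^ 2) := by
  rw [erfc, erfc, ← mul_sub, intervalIntegral.integral_Ioi_sub_Ioi' (f := fun u => exp (-u ^ 2))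
    integrable_exp_neg_sq.integrableOn integrable_exp_neg_sq.integrableOn |>.symm]
  ring

theorem erfc_zero : erfc 0 = 1 := by
  have h := integral_gaussian_Ioi 1
  have e : (fun u : ℝ => exp (-1 * u ^ 2)) = fun u => exp (-u ^ 2) := by
    ext u
    rw [neg_one_mul]
  rw [div_one, e] at h
  rw [erfc, h]
  have : 0 < √π := sqrt_pos.2 pi_pos
  field_simp

theorem hasDerivAt_erfc (t : ℝ) : HasDerivAt erfc (-(2 / √π * exp (-t ^ 2))) t := by
  have hc : Continuous fun u : ℝ => exp (-u ^ 2) := by fun_prop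
  have h := ((hc.integral_hasStrictDerivAt 0 t).hasDerivAt.const_mul (2 / √π)).const_sub (erfc 0)
  exact h.congr_of_eventuallyEq (Eventually.of_forall erfc_eq)

theorem continuous_erfc : Continuous erfc :=
  continuous_iff_continuousAt.2 fun t => (hasDerivAt_erfc t).continuousAt

theorem two_div_sqrt_pi_gt : 1.1283 < 2 / √π := by
  have h : √π < 1.7725 := by
    rw [sqrt_lt' (by norm_num)]
    have := pi_lt_d4
    norm_num at this ⊢
    linarith
  have h0 : 0 < √π := sqrt_pos.2 pi_pos
  rw [lt_div_iff₀ h0]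
  nlinarith

/-- `erfc` is at most a truncated Taylor polynomial. -/
theorem erfc_le_taylor {t : ℝ} (h0 : 0 ≤ t) (h1 : t ≤ 1) :
    erfc t ≤ 1 - 1.1283 *
      (t - t ^ 3 / 3 + t ^ 5 / 10 - t ^ 7 / 42 + t ^ 9 / 216 - t ^ 11 / 1100) := by
  -- The terms up to `t ^ 9` are those of the Taylor series. The last one has `1100` where the
  -- series has `1320`: its derivative `t ^ 10 / 100` is the remainder bound of `Real.exp_bound` for
  -- five terms, `6 / (5! · 5)`. The factor `1.1283` lies below `2/√π`.
  let F : ℝ → ℝ := fun t => 1 - 1.1283 *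
      (t - t ^ 3 / 3 + t ^ 5 / 10 - t ^ 7 / 42 + t ^ 9 / 216 - t ^ 11 / 1100) - erfc t
  have hF : ∀ t, HasDerivAt F (2 / √π * exp (-t ^ 2) - 1.1283 *
      (1 - t ^ 2 + t ^ 4 / 2 - t ^ 6 / 6 + t ^ 8 / 24 - t ^ 10 / 100)) t := by
    intro t
    have h := (((((((hasDerivAt_id t).sub ((hasDerivAt_pow 3 t).div_const 3)).add
      ((hasDerivAt_pow 5 t).div_const 10)).sub ((hasDerivAt_pow 7 t).div_const 42)).add
      ((hasDerivAt_pow 9 t).div_const 216)).sub ((hasDerivAt_pow 11 t).div_const 1100)).const_mul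
      1.1283).const_sub 1 |>.sub (hasDerivAt_erfc t)
    refine h.congr_deriv ?_
    norm_num
    ring
  have hmono : MonotoneOn F (Icc 0 1) := by
    refine monotoneOn_of_deriv_nonneg (convex_Icc 0 1)
      (fun x _ => (hF x).continuousAt.continuousWithinAt)
      (fun x _ => (hF x).differentiableAt.differentiableWithinAt) fun x hx => ?_
    rw [interior_Icc] at hx
    rw [(hF x).deriv]
    have hx2 : x ^ 2 ≤ 1 := by nlinarith [hx.1, hx.2]
    have hb := Real.exp_bound (x := -x ^ 2) (by rw [abs_neg, abs_of_nonneg (sq_nonneg x)]; exact hx2)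
      (n := 5) (by norm_num)
    have hb' := (abs_le.1 hb).1
    simp only [Finset.sum_range_succ, Finset.sum_range_zero, abs_neg, abs_of_nonneg (sq_nonneg x)] at hb'
    norm_num [Nat.factorial] at hb'
    have hP : 1 - x ^ 2 + x ^ 4 / 2 - x ^ 6 / 6 + x ^ 8 / 24 - x ^ 10 / 100 ≤ exp (-x ^ 2) := by
      ring_nf at hb' ⊢
      linarith
    have := two_div_sqrt_pi_gt
    have := exp_pos (-x ^ 2)
    nlinarith
  have h := hmono (left_mem_Icc.2 zero_le_one) ⟨h0, h1⟩ h0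
  simp only [F, erfc_zero] at h
  norm_num at h
  norm_num
  linarith

/-- Expansion at `1`: with `w = t - 1`, `e^{-t²} = e^{-1} e^{-(2w + w²)} ≥ e^{-1}(1 - 2w - w²)`, and
the right side integrates to the cubic. The constant `0.1577` exceeds the Taylor bound at `1`, and
`0.415` is below `2/(e√π)`. -/
theorem erfc_le_of_one_le {t : ℝ} (h1 : 1 ≤ t) :
    erfc t ≤ 0.1577 - 0.415 * ((t - 1) - (t - 1) ^ 2 - (t - 1) ^ 3 / 3) := by
  let F : ℝ → ℝ := fun t => 0.1577 - 0.415 * ((t - 1) - (t - 1) ^ 2 - (t - 1) ^ 3 / 3) - erfc t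
  have hF : ∀ t, HasDerivAt F
      (2 / √π * exp (-t ^ 2) - 0.415 * (1 - 2 * (t - 1) - (t - 1) ^ 2)) t := by
    intro t
    have hw : HasDerivAt (fun t : ℝ => t - 1) 1 t := (hasDerivAt_id t).sub_const 1
    have h := (((hw.sub (hw.pow 2)).sub ((hw.pow 3).div_const 3)).const_mul 0.415).const_sub
      0.1577 |>.sub (hasDerivAt_erfc t)
    refine h.congr_deriv ?_
    norm_num
    ring
  have hmono : MonotoneOn F (Ici 1) := by
    refine monotoneOn_of_deriv_nonneg (convex_Ici 1)
      (fun x _ => (hF x).continuousAt.continuousWithinAt)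
      (fun x _ => (hF x).differentiableAt.differentiableWithinAt) fun x hx => ?_
    rw [(hF x).deriv]
    have e : exp (-x ^ 2) = exp (-1) * exp (-(2 * (x - 1) + (x - 1) ^ 2)) := by
      rw [← exp_add]
      ring_nf
    have h1 : 1 - 2 * (x - 1) - (x - 1) ^ 2 ≤ exp (-(2 * (x - 1) + (x - 1) ^ 2)) := by
      have := add_one_le_exp (-(2 * (x - 1) + (x - 1) ^ 2))
      linarith
    have h2 : 0.415 ≤ 2 / √π * exp (-1) := by
      have := two_div_sqrt_pi_gt
      have := exp_neg_one_gt_d9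
      nlinarith
    rw [e, ← mul_assoc]
    have := exp_pos (-(2 * (x - 1) + (x - 1) ^ 2))
    nlinarith
  have h := hmono (mem_Ici.2 le_rfl) (mem_Ici.2 h1) h1
  have h' := erfc_le_taylor zero_le_one le_rfl
  simp only [F] at h
  norm_num at h h'
  norm_num
  linarith

/-- Inserting the factor `u/t ≥ 1` makes the integrand an exact derivative. -/
theorem erfc_le_exp_div {t : ℝ} (ht : 0 < t) : erfc t ≤ 2 / √π * (exp (-t ^ 2) / (2 * t)) := by
  refine mul_le_mul_of_nonneg_left ?_ (by positivity)
  have hd : ∀ u ∈ Ici t, HasDerivAt (fun u : ℝ => -(exp (-u ^ 2) / (2 * t))) (u / t * exp (-u ^ 2)) u := by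
    intro u _
    have h := (((hasDerivAt_pow 2 u).neg.exp).div_const (2 * t)).neg
    refine h.congr_deriv ?_
    simp
    field_simp
  have hlim : Tendsto (fun u : ℝ => -(exp (-u ^ 2) / (2 * t))) atTop (𝓝 0) := by
    have h1 : Tendsto (fun u : ℝ => exp (-u ^ 2)) atTop (𝓝 0) :=
      tendsto_exp_atBot.comp (tendsto_neg_atTop_atBot.comp (tendsto_pow_atTop two_ne_zero))
    simpa using (h1.div_const (2 * t)).neg
  have hnn : ∀ u ∈ Ioi t, 0 ≤ u / t * exp (-u ^ 2) := fun u hu => by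
    have : 0 < u := lt_trans ht hu
    positivity
  have hi := integrableOn_Ioi_deriv_of_nonneg' hd hnn hlim
  have hint := integral_Ioi_of_hasDerivAt_of_nonneg' hd hnn hlim
  calc ∫ u in Ioi t, exp (-u ^ 2) ≤ ∫ u in Ioi t, u / t * exp (-u ^ 2) := by
        refine setIntegral_mono_on integrable_exp_neg_sq.integrableOn hi measurableSet_Ioi
          fun u hu => ?_
        refine le_mul_of_one_le_left (exp_pos _).le ?_
        rw [one_le_div ht]
        exact le_of_lt hu
    _ = _ := by rw [hint]; ring

/-- Up to `1.25` the expansion at `1` suffices. Beyond, the function decreases: the tail bound gives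
`3 erfc t ≤ (2/√π) t e^{-t²}` as soon as `t² ≥ 3/2`, and `1.25² > 3/2`. -/
theorem pow_three_mul_erfc_le {t : ℝ} (h1 : 1 ≤ t) : t ^ 3 * erfc t ≤ 0.163 := by
  have hmid : ∀ t : ℝ, 1 ≤ t → t ≤ 1.25 → t ^ 3 * erfc t ≤ 0.163 := by
    intro t h1 h2
    have h := erfc_le_of_one_le h1
    obtain ⟨w, rfl⟩ : ∃ w, t = 1 + w := ⟨t - 1, by ring⟩
    have hw0 : 0 ≤ w := by linarith
    have hw1 : w ≤ 0.25 := by norm_num at h2 ⊢; linarith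
    rw [add_sub_cancel_left] at h
    calc (1 + w) ^ 3 * erfc (1 + w) ≤ (1 + w) ^ 3 * (0.1577 - 0.415 * (w - w ^ 2 - w ^ 3 / 3)) := by
          gcongr
      _ ≤ 0.163 := by
          norm_num at hw1
          have h3 : w ^ 3 ≤ w ^ 2 / 4 := by nlinarith [sq_nonneg w]
          have h4 : w ^ 4 ≤ w ^ 3 / 4 := by nlinarith [pow_nonneg hw0 3]
          have h5 : w ^ 5 ≤ w ^ 4 / 4 := by nlinarith [pow_nonneg hw0 4]
          have h6 : w ^ 6 ≤ w ^ 5 / 4 := by nlinarith [pow_nonneg hw0 5]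
          nlinarith [sq_nonneg (w - 0.1), mul_nonneg hw0 (sq_nonneg (w - 0.1)),
            mul_nonneg (sub_nonneg.2 hw1) (sq_nonneg (w - 0.1))]
  rcases le_total t 1.25 with h2 | h2
  · exact hmid t h1 h2
  have hanti : AntitoneOn (fun t => t ^ 3 * erfc t) (Ici 1.25) := by
    refine antitoneOn_of_deriv_nonpos (convex_Ici _)
      ((continuous_pow 3).mul continuous_erfc).continuousOn
      (fun x _ => ((hasDerivAt_pow 3 x).mul
        (hasDerivAt_erfc x)).differentiableAt.differentiableWithinAt) fun x hx => ?_
    rw [interior_Ici] at hx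
    have hx' : 1.25 < x := hx
    have hx0 : 0 < x := lt_trans (by norm_num) hx'
    have h := ((hasDerivAt_pow 3 x).mul (hasDerivAt_erfc x)).deriv
    have h' : deriv (fun t => t ^ 3 * erfc t) x = _ := h
    rw [h']
    have he := erfc_le_exp_div hx0
    set c := 2 / √π * exp (-x ^ 2) with hc
    have hcpos : 0 < c := by positivity
    have he' : 2 * x * erfc x ≤ c := by
      rw [← mul_div_assoc, le_div_iff₀ (by positivity)] at he
      linarith
    have hx2 : 3 / 2 ≤ x ^ 2 := by norm_num at hx'; nlinarith
    norm_num
    nlinarith [mul_le_mul_of_nonneg_left he' hx0.le, mul_le_mul_of_nonneg_left hx2 (mul_nonneg hx0.le hcpos.le)]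
  exact (hanti (mem_Ici.2 le_rfl) (mem_Ici.2 h2) h2).trans (hmid 1.25 (by norm_num) le_rfl)

/-! ### A monotone majorant of `t³ erfc t` -/

/-- A monotone majorant of `t³ erfc t`. -/
def erfcMajorant (t : ℝ) : ℝ :=
  -- The function `t³ erfc t` rises and then decays. Freezing the bound past `1` restores the
  -- monotonicity that the rearrangement in `lintegral_potentialCore_le` needs. On `[0, 1]` the last
  -- two Taylor terms are dropped, since together they only lower the bound, and `1.1283` is rounded
  -- down to `1.128`.
  if t ≤ 1 then t ^ 3 - 1.128 * (t ^ 4 - t ^ 6 / 3 + t ^ 8 / 10 - t ^ 10 / 42) else 0.163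

theorem measurable_erfcMajorant : Measurable erfcMajorant :=
  Measurable.ite measurableSet_Iic (by fun_prop) measurable_const

theorem erfcMajorant_zero : erfcMajorant 0 = 0 := by simp [erfcMajorant]

theorem pow_three_mul_erfc_le_erfcMajorant {t : ℝ} (ht : 0 ≤ t) :
    t ^ 3 * erfc t ≤ erfcMajorant t := by
  rw [erfcMajorant]
  split_ifs with h
  · have h1 := mul_le_mul_of_nonneg_left (erfc_le_taylor ht h) (pow_nonneg ht 3)
    refine h1.trans ?_
    have e1 : 0 ≤ t ^ 4 - t ^ 6 / 3 := by
      have : t ^ 4 - t ^ 6 / 3 = t ^ 4 * (1 - t ^ 2 / 3) := by ring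
      rw [this]
      exact mul_nonneg (by positivity) (by nlinarith)
    have e2 : 0 ≤ t ^ 8 / 10 - t ^ 10 / 42 := by
      have : t ^ 8 / 10 - t ^ 10 / 42 = t ^ 8 * (1 / 10 - t ^ 2 / 42) := by ring
      rw [this]
      exact mul_nonneg (by positivity) (by nlinarith)
    have e3 : 0 ≤ t ^ 12 / 216 - t ^ 14 / 1100 := by
      have : t ^ 12 / 216 - t ^ 14 / 1100 = t ^ 12 * (1 / 216 - t ^ 2 / 1100) := by ring
      rw [this]
      exact mul_nonneg (by positivity) (by nlinarith)
    norm_num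
    nlinarith
  · exact pow_three_mul_erfc_le (not_le.1 h).le

theorem erfcMajorant_nonneg {t : ℝ} (ht : 0 ≤ t) : 0 ≤ erfcMajorant t :=
  le_trans (mul_nonneg (by positivity) (erfc_nonneg t)) (pow_three_mul_erfc_le_erfcMajorant ht)

theorem monotoneOn_erfcMajorant : MonotoneOn erfcMajorant (Ici 0) := by
  have hmono : MonotoneOn (fun t : ℝ => t ^ 3 - 1.128 * (t ^ 4 - t ^ 6 / 3 + t ^ 8 / 10 - t ^ 10 / 42))
      (Icc 0 1) := by
    have hF : ∀ x : ℝ, HasDerivAt (fun t : ℝ => t ^ 3 - 1.128 * (t ^ 4 - t ^ 6 / 3 + t ^ 8 / 10 - t ^ 10 / 42))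
        (x ^ 2 * (3 - 1.128 * (4 * x - 2 * x ^ 3 + 4 / 5 * x ^ 5 - 5 / 21 * x ^ 7))) x := by
      intro x
      have h := (hasDerivAt_pow 3 x).sub (((((hasDerivAt_pow 4 x).sub
        ((hasDerivAt_pow 6 x).div_const 3)).add ((hasDerivAt_pow 8 x).div_const 10)).sub
        ((hasDerivAt_pow 10 x).div_const 42)).const_mul 1.128)
      refine h.congr_deriv ?_
      norm_num
      ring
    refine monotoneOn_of_deriv_nonneg (convex_Icc 0 1)
      (fun x _ => (hF x).continuousAt.continuousWithinAt)
      (fun x _ => (hF x).differentiableAt.differentiableWithinAt) fun x hx => ?_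
    rw [interior_Icc] at hx
    rw [(hF x).deriv]
    refine mul_nonneg (sq_nonneg x) ?_
    have hx0 : 0 ≤ x := hx.1.le
    have hx1 : 0 ≤ 1 - x := by linarith [hx.2]
    -- The threshold to beat is `3 / 1.128 ≈ 2.6596`.
    have key : 4 * x - 2 * x ^ 3 + 4 / 5 * x ^ 5 - 5 / 21 * x ^ 7 ≤ 2.65 := by
      norm_num
      have h3 : 0 ≤ x ^ 2 * (1 - x) := by positivity
      nlinarith [mul_nonneg hx0 hx1, mul_nonneg h3 (sq_nonneg x), mul_nonneg h3 (sq_nonneg (x - 1)),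
        mul_nonneg h3 (sq_nonneg (x ^ 2 - 1)), mul_nonneg h3 (sq_nonneg (x ^ 2)),
        mul_nonneg hx1 (sq_nonneg (x ^ 3)), mul_nonneg hx1 (sq_nonneg (x - 1)),
        mul_nonneg hx1 (sq_nonneg (x ^ 2 - 1)), mul_nonneg hx1 (sq_nonneg (x ^ 2 - x))]
    norm_num at key ⊢
    linarith
  intro a ha b hb hab
  have ha' : 0 ≤ a := ha
  simp only [erfcMajorant]
  split_ifs with h1 h2 h2
  · exact hmono ⟨ha', h1⟩ ⟨ha'.trans hab, h2⟩ hab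
  · refine (hmono ⟨ha', h1⟩ (right_mem_Icc.2 zero_le_one) h1).trans ?_
    norm_num
  · exact absurd (hab.trans h2) h1
  · exact le_rfl

/-- The weight `1/t²` comes from `r² dr / r⁴` in polar coordinates. The polynomial part contributes
about `0.1861` and the constant part `0.163`; their sum fixes the number `0.35` in the Lieb–Oxford
constant. -/
theorem integrableOn_erfcMajorant_div_sq :
    IntegrableOn (fun t => erfcMajorant t / t ^ 2) (Ioi 0) ∧
    ∫ t in Ioi 0, erfcMajorant t / t ^ 2 ≤ 0.35 := by
  have hpoly : Continuous fun t : ℝ => t - 1.128 * (t ^ 2 - t ^ 4 / 3 + t ^ 6 / 10 - t ^ 8 / 42) := by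
    fun_prop
  have e1 : EqOn (fun t : ℝ => t - 1.128 * (t ^ 2 - t ^ 4 / 3 + t ^ 6 / 10 - t ^ 8 / 42))
      (fun t => erfcMajorant t / t ^ 2) (Ioc 0 1) := by
    intro t ht
    have h0 : t ≠ 0 := ht.1.ne'
    simp only [erfcMajorant, if_pos ht.2]
    field_simp
  have e2 : EqOn (fun t : ℝ => 0.163 * t ^ (-2 : ℝ)) (fun t => erfcMajorant t / t ^ 2) (Ioi 1) := by
    intro t ht
    have h0 : 0 < t := lt_trans one_pos ht
    simp only [erfcMajorant, if_neg (not_le.2 (mem_Ioi.1 ht))]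
    rw [rpow_neg h0.le, div_eq_mul_inv]
    norm_num
  have i1 : IntegrableOn (fun t => erfcMajorant t / t ^ 2) (Ioc 0 1) :=
    ((hpoly.integrableOn_Icc (a := 0) (b := 1)).mono_set Ioc_subset_Icc_self).congr_fun e1 measurableSet_Ioc
  have i2 : IntegrableOn (fun t => erfcMajorant t / t ^ 2) (Ioi 1) :=
    IntegrableOn.congr_fun (Integrable.const_mul (integrableOn_Ioi_rpow_of_lt (by norm_num) one_pos) _)
      e2 measurableSet_Ioi
  rw [← Ioc_union_Ioi_eq_Ioi (zero_le_one' ℝ)]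
  refine ⟨i1.union i2, ?_⟩
  rw [setIntegral_union (Ioc_disjoint_Ioi le_rfl) measurableSet_Ioi i1 i2,
    ← setIntegral_congr_fun measurableSet_Ioc e1, ← setIntegral_congr_fun measurableSet_Ioi e2,
    integral_const_mul, integral_Ioi_rpow_of_lt (by norm_num) one_pos,
    ← intervalIntegral.integral_of_le zero_le_one]
  have h : ∫ t in (0 : ℝ)..1, (t - 1.128 * (t ^ 2 - t ^ 4 / 3 + t ^ 6 / 10 - t ^ 8 / 42)) =
      (1 : ℝ) ^ 2 / 2 - 1.128 * ((1 : ℝ) ^ 3 / 3 - 1 ^ 5 / 15 + 1 ^ 7 / 70 - 1 ^ 9 / 378) := by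
    rw [intervalIntegral.integral_eq_sub_of_hasDerivAt (f := fun t : ℝ => t ^ 2 / 2 - 1.128 *
      (t ^ 3 / 3 - t ^ 5 / 15 + t ^ 7 / 70 - t ^ 9 / 378)) _ (hpoly.intervalIntegrable _ _)]
    · norm_num
    · intro x _
      have h := ((hasDerivAt_pow 2 x).div_const 2).sub ((((((hasDerivAt_pow 3 x).div_const 3).sub
        ((hasDerivAt_pow 5 x).div_const 15)).add ((hasDerivAt_pow 7 x).div_const 70)).sub
        ((hasDerivAt_pow 9 x).div_const 378)).const_mul 1.128)
      refine h.congr_deriv ?_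
      norm_num
      ring
  rw [h]
  norm_num

/-- The integral over `ℝ³` of the rescaled majorant. -/
theorem lintegral_erfcMajorant_le {b : ℝ} (hb : 0 ≤ b) :
    ∫⁻ z : Space, ENNReal.ofReal (erfcMajorant (b * ‖z‖) / ‖z‖ ^ 4) ≤
      ENNReal.ofReal (4 * π * 0.35 * b) := by
  rcases hb.eq_or_lt with rfl | hb
  · simp [erfcMajorant_zero]
  obtain ⟨hi, hle⟩ := integrableOn_erfcMajorant_div_sq
  have e : EqOn (fun y : ℝ => b ^ 2 * (erfcMajorant (b * y) / (b * y) ^ 2))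
      (fun y => y ^ (Module.finrank ℝ Space - 1) • (erfcMajorant (b * y) / y ^ 4)) (Ioi 0) := by
    intro y hy
    have hy0 : y ≠ 0 := (mem_Ioi.1 hy).ne'
    simp only [finrank_euclideanSpace, Fintype.card_fin, smul_eq_mul]
    field_simp
    ring
  have hi2 : IntegrableOn (fun y : ℝ => b ^ 2 * (erfcMajorant (b * y) / (b * y) ^ 2)) (Ioi 0) := by
    refine Integrable.const_mul ?_ _
    have := (integrableOn_Ioi_comp_mul_left_iff (fun t => erfcMajorant t / t ^ 2) 0 hb)
    rw [mul_zero] at this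
    exact this.2 hi
  have hi3 : Integrable (fun z : Space => erfcMajorant (b * ‖z‖) / ‖z‖ ^ 4) :=
    (integrable_fun_norm_addHaar volume (f := fun y => erfcMajorant (b * y) / y ^ 4)).2
      (hi2.congr_fun e measurableSet_Ioi)
  rw [← ofReal_integral_eq_lintegral_ofReal hi3 (Eventually.of_forall fun z =>
    div_nonneg (erfcMajorant_nonneg (by positivity)) (by positivity))]
  refine ENNReal.ofReal_le_ofReal ?_
  rw [integral_fun_norm_addHaar volume (fun y => erfcMajorant (b * y) / y ^ 4),
    ← setIntegral_congr_fun measurableSet_Ioi e, integral_const_mul,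
    integral_comp_mul_left_Ioi (fun t => erfcMajorant t / t ^ 2) 0 hb, mul_zero, smul_eq_mul,
    smul_eq_mul, nsmul_eq_mul, finrank_euclideanSpace, Fintype.card_fin, Measure.real,
    EuclideanSpace.volume_ball_fin_three]
  have hv : (ENNReal.ofReal 1 ^ 3 * ENNReal.ofReal (π * 4 / 3)).toReal = π * 4 / 3 := by
    simp [ENNReal.toReal_ofReal (by positivity : 0 ≤ π * 4 / 3)]
  rw [hv]
  have : b ^ 2 * (b⁻¹ * ∫ x in Ioi 0, erfcMajorant x / x ^ 2) = b * ∫ x in Ioi 0, erfcMajorant x / x ^ 2 := by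
    field_simp
  rw [this]
  have h := mul_le_mul_of_nonneg_left hle (show 0 ≤ 4 * π * b by positivity)
  push_cast
  linarith

/-! ### Smeared Coulomb potentials -/

/-- The Coulomb potential smeared with the heat kernel at time `s`. -/
def smearedPotential (s : ℝ) (x : Space) : ℝ≥0∞ :=
  ENNReal.ofReal (4 * π) * ∫⁻ τ in Ioi 0, heatKernelE (s + τ) x

/-- The difference between the Coulomb potential and the one smeared at time `s`. -/
def potentialCore (s : ℝ) (x : Space) : ℝ≥0∞ :=
  ENNReal.ofReal (4 * π) * ∫⁻ τ in Ioo 0 s, heatKernelE τ x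

@[fun_prop]
theorem _root_.Measurable.smearedPotential {β : Type*} [MeasurableSpace β] {s : β → ℝ}
    {x : β → Space} (hs : Measurable s) (hx : Measurable x) :
    Measurable fun b => smearedPotential (s b) (x b) := by
  unfold Pekar.smearedPotential
  refine Measurable.const_mul (Measurable.lintegral_prod_right'
    (f := fun q : β × ℝ => heatKernelE (s q.1 + q.2) (x q.1)) ?_) _
  fun_prop

@[fun_prop]
theorem _root_.Measurable.potentialCore {β : Type*} [MeasurableSpace β] {s : β → ℝ}
    {x : β → Space} (hs : Measurable s) (hx : Measurable x) :
    Measurable fun b => potentialCore (s b) (x b) := by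
  unfold Pekar.potentialCore
  simp_rw [← lintegral_indicator measurableSet_Ioo]
  refine Measurable.const_mul (Measurable.lintegral_prod_right'
    (f := fun q : β × ℝ => (Ioo 0 (s q.1)).indicator (fun τ => heatKernelE τ (x q.1)) q.2) ?_) _
  have e : (fun q : β × ℝ => (Ioo 0 (s q.1)).indicator (fun τ => heatKernelE τ (x q.1)) q.2) =
      {q : β × ℝ | 0 < q.2 ∧ q.2 < s q.1}.indicator (fun q => heatKernelE q.2 (x q.1)) := by
    ext q
    simp [indicator]
  rw [e]
  refine Measurable.indicator (by fun_prop) ?_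
  exact (measurableSet_lt measurable_const measurable_snd).inter
    (measurableSet_lt measurable_snd (by fun_prop))

theorem smearedPotential_eq (s : ℝ) (x : Space) :
    smearedPotential s x = ENNReal.ofReal (4 * π) * ∫⁻ τ in Ioi s, heatKernelE τ x := by
  rw [smearedPotential, ← lintegral_indicator measurableSet_Ioi, ← lintegral_indicator measurableSet_Ioi,
    ← lintegral_add_left_eq_self ((Ioi s).indicator fun τ => heatKernelE τ x) s]
  congr 2
  ext τ
  simp [indicator]

theorem smearedPotential_le {s : ℝ} (hs : 0 ≤ s) (x : Space) :
    smearedPotential s x ≤ 1 / ‖x‖ₑ := by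
  rw [smearedPotential_eq]
  refine le_trans ?_ (lintegral_heatKernelE_time_le x)
  gcongr

theorem inv_enorm_le_smearedPotential_add {s : ℝ} {x : Space} (hx : x ≠ 0) :
    1 / ‖x‖ₑ ≤ smearedPotential s x + potentialCore s x := by
  rw [← lintegral_heatKernelE_time hx, smearedPotential_eq, potentialCore, ← mul_add]
  gcongr
  rw [setLIntegral_congr (Ioi_ae_eq_Ici (a := s)), add_comm]
  refine le_trans (lintegral_mono_set ?_) (lintegral_union_le _ (Ioo 0 s) (Ici s))
  intro τ hτ
  rcases lt_or_ge τ s with h | h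
  · exact Or.inl ⟨hτ, h⟩
  · exact Or.inr h

theorem potentialCore_eq {s : ℝ} (hs : 0 < s) {x : Space} (hx : x ≠ 0) :
    potentialCore s x = ENNReal.ofReal (erfc (‖x‖ / (2 * √s))) / ‖x‖ₑ := by
  rw [potentialCore, setLIntegral_heatKernelE hx measurableSet_Ioo fun τ hτ => hτ.1,
    image_div_sqrt_Ioo (norm_pos_iff.2 hx) hs, ofReal_erfc]

theorem smearedPotential_zero {s : ℝ} (hs : 0 < s) :
    smearedPotential s 0 = ENNReal.ofReal (1 / √(π * s)) := by
  have e : EqOn (fun τ => heatKernelE τ (0 : Space))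
      (fun τ => ENNReal.ofReal ((4 * π) ^ (-(3 / 2) : ℝ) * τ ^ (-(3 / 2) : ℝ))) (Ioi s) := by
    intro τ hτ
    have : 0 < τ := hs.trans hτ
    simp only [heatKernelE, heatKernel]
    rw [mul_rpow (by positivity) this.le]
    simp
  have hi : IntegrableOn (fun τ : ℝ => (4 * π) ^ (-(3 / 2) : ℝ) * τ ^ (-(3 / 2) : ℝ)) (Ioi s) :=
    Integrable.const_mul (integrableOn_Ioi_rpow_of_lt (by norm_num) hs) _
  rw [smearedPotential_eq, setLIntegral_congr_fun measurableSet_Ioi e,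
    ← ofReal_integral_eq_lintegral_ofReal hi, integral_const_mul,
    integral_Ioi_rpow_of_lt (by norm_num) hs, ← ENNReal.ofReal_mul (by positivity)]
  · congr 1
    have h1 : (4 * π) ^ (-(3 / 2) : ℝ) = 1 / (4 * π * (2 * √π)) := by
      rw [rpow_neg (by positivity), show (3 / 2 : ℝ) = 1 + 1 / 2 by norm_num,
        rpow_add (by positivity), ← sqrt_eq_rpow, rpow_one,
        sqrt_mul (by positivity), show (4 : ℝ) = 2 ^ 2 by norm_num, sqrt_sq (by norm_num), one_div]
    have h2 : s ^ (-(3 / 2) + 1 : ℝ) = 1 / √s := by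
      rw [show (-(3 / 2) + 1 : ℝ) = -(1 / 2) by norm_num, rpow_neg hs.le, ← sqrt_eq_rpow, one_div]
    rw [h1, h2, sqrt_mul pi_pos.le]
    have : 0 < √π := sqrt_pos.2 pi_pos
    have : 0 < √s := sqrt_pos.2 hs
    field_simp
    norm_num
  · filter_upwards [ae_restrict_mem measurableSet_Ioi] with τ hτ
    have : 0 < τ := hs.trans hτ
    positivity

/-- Splitting `τ` in two halves and applying the semigroup property writes the interaction of two
Gaussian charges as an `L²` pairing over time and space. In this form the positive definiteness of
the Coulomb kernel is manifest. -/
theorem smearedPotential_add {s s' : ℝ} (hs : 0 ≤ s) (hs' : 0 ≤ s') (x y : Space) :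
    smearedPotential (s + s') (x - y) = ENNReal.ofReal (4 * π) *
      ∫⁻ w : ℝ × Space, heatKernelE (s + w.1 / 2) (x - w.2) * heatKernelE (s' + w.1 / 2) (y - w.2)
        ∂((volume.restrict (Ioi 0)).prod volume) := by
  rw [lintegral_prod _ (by fun_prop), smearedPotential]
  congr 1
  refine setLIntegral_congr_fun measurableSet_Ioi fun τ hτ => ?_
  have hτ' : 0 < τ := hτ
  simp only
  rw [lintegral_heatKernelE_mul_heatKernelE (by positivity) (by positivity)]
  congr 1
  ring

theorem two_mul_le_add_sq_ennreal (a b : ℝ≥0∞) : 2 * a * b ≤ a ^ 2 + b ^ 2 := by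
  by_cases ha : a = ⊤
  · simp [ha]
  by_cases hb : b = ⊤
  · simp [hb]
  lift a to NNReal using ha
  lift b to NNReal using hb
  exact_mod_cast two_mul_le_add_sq a b

/-- Stated for general measures so that it covers the continuous density (Lebesgue measure) and the
point-indexed charges (counting measure) alike. -/
theorem lintegral_lintegral_mul_lintegral {W Ω Ω' : Type*} [MeasurableSpace W] [MeasurableSpace Ω]
    [MeasurableSpace Ω'] {m : Measure W} {μ : Measure Ω} {ν : Measure Ω'} [SFinite m] [SFinite μ]
    [SFinite ν] {f : W → Ω → ℝ≥0∞} {g : W → Ω' → ℝ≥0∞} (hf : Measurable (Function.uncurry f))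
    (hg : Measurable (Function.uncurry g)) :
    ∫⁻ w, (∫⁻ a, f w a ∂μ) * (∫⁻ b, g w b ∂ν) ∂m = ∫⁻ a, ∫⁻ b, ∫⁻ w, f w a * g w b ∂m ∂ν ∂μ := by
  have h1 : ∀ w, (∫⁻ a, f w a ∂μ) * (∫⁻ b, g w b ∂ν) = ∫⁻ a, ∫⁻ b, f w a * g w b ∂ν ∂μ := by
    intro w
    have hfw : Measurable (f w) := hf.of_uncurry_left
    have hgw : Measurable (g w) := hg.of_uncurry_left
    rw [← lintegral_mul_const _ hfw]
    exact lintegral_congr fun a => (lintegral_const_mul _ hgw).symm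
  simp_rw [h1]
  have hm : Measurable fun q : (W × Ω) × Ω' => f q.1.1 q.1.2 * g q.1.1 q.2 :=
    (hf.comp measurable_fst).mul (hg.comp ((measurable_fst.comp measurable_fst).prodMk measurable_snd))
  rw [lintegral_lintegral_swap]
  · refine lintegral_congr fun a => ?_
    rw [lintegral_lintegral_swap]
    exact (hm.comp ((measurable_fst.prodMk measurable_const).prodMk measurable_snd)).aemeasurable
  · exact (Measurable.lintegral_prod_right hm).aemeasurable

/-- Positive definiteness of the Coulomb kernel, applied to the difference of a density and a sum of
Gaussian charges. -/
theorem two_mul_sum_lintegral_smearedPotential_le {ι : Type*} [Fintype ι] {ρ : Space → ℝ≥0∞}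
    (hρ : Measurable ρ) {s : ι → ℝ} (hs : ∀ i, 0 ≤ s i) (x : ι → Space) :
    2 * ∑ i, ∫⁻ y, ρ y * smearedPotential (s i) (y - x i) ≤
      coulomb ρ + ∑ i, ∑ j, smearedPotential (s i + s j) (x i - x j) := by
  -- `∫ A` and `∫ B` are the half-time heat flows of the density and of the Gaussian charges. The
  -- pointwise bound `2ab ≤ a² + b²` on these, integrated over `m`, replaces `∫ (a - b)² ≥ 0`:
  -- subtraction is not available in `[0, ∞]`, and some of the energies may be infinite.
  let m : Measure (ℝ × Space) := (volume.restrict (Ioi 0)).prod volume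
  let A : ℝ × Space → Space → ℝ≥0∞ := fun w y => ρ y * heatKernelE (0 + w.1 / 2) (y - w.2)
  let B : ℝ × Space → ι → ℝ≥0∞ := fun w i => heatKernelE (s i + w.1 / 2) (x i - w.2)
  let _ : MeasurableSpace ι := ⊤
  have hA : Measurable (Function.uncurry A) := by
    simp only [A, Function.uncurry_def]
    fun_prop
  have hB : Measurable (Function.uncurry B) := by
    refine measurable_from_prod_countable_left fun i => ?_
    simp only [B, Function.uncurry_def]
    fun_prop
  have e1 : ∫⁻ y, ∫⁻ y', ENNReal.ofReal (4 * π) * ∫⁻ w, A w y * A w y' ∂m ≤ coulomb ρ := by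
    refine lintegral_mono fun y => lintegral_mono fun y' => ?_
    simp only
    have : ∫⁻ w, A w y * A w y' ∂m = ρ y * ρ y' * ∫⁻ w, heatKernelE (0 + w.1 / 2) (y - w.2) *
        heatKernelE (0 + w.1 / 2) (y' - w.2) ∂m := by
      rw [← lintegral_const_mul _ (by fun_prop)]
      refine lintegral_congr fun w => ?_
      simp only [A]
      ring
    rw [this, mul_left_comm, ← smearedPotential_add le_rfl le_rfl, div_eq_mul_inv, ← one_div]
    gcongr
    exact smearedPotential_le (by norm_num) _
  have e2 : ∑ i, ∫⁻ y, ρ y * smearedPotential (s i) (y - x i) =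
      ∫⁻ y, ∫⁻ i, ENNReal.ofReal (4 * π) * ∫⁻ w, A w y * B w i ∂m ∂Measure.count := by
    simp_rw [lintegral_count, tsum_fintype]
    rw [lintegral_finsetSum']
    · refine Finset.sum_congr rfl fun i _ => lintegral_congr fun y => ?_
      have : ∫⁻ w, A w y * B w i ∂m = ρ y * ∫⁻ w, heatKernelE (0 + w.1 / 2) (y - w.2) *
          heatKernelE (s i + w.1 / 2) (x i - w.2) ∂m := by
        rw [← lintegral_const_mul _ (by fun_prop)]
        refine lintegral_congr fun w => ?_
        simp only [A, B]
        ring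
      rw [this, mul_left_comm, ← smearedPotential_add le_rfl (hs i), zero_add]
    · intro i _
      refine (Measurable.const_mul (Measurable.lintegral_prod_right ?_) _).aemeasurable
      simp only [A, B]
      fun_prop
  have e3 : ∑ i, ∑ j, smearedPotential (s i + s j) (x i - x j) =
      ∫⁻ i, ∫⁻ j, ENNReal.ofReal (4 * π) * ∫⁻ w, B w i * B w j ∂m ∂Measure.count ∂Measure.count := by
    simp_rw [lintegral_count, tsum_fintype]
    refine Finset.sum_congr rfl fun i _ => Finset.sum_congr rfl fun j _ => ?_
    rw [smearedPotential_add (hs i) (hs j)]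
  rw [e2, e3]
  refine le_trans ?_ (add_le_add_left e1 _)
  simp_rw [lintegral_const_mul' _ _ ENNReal.ofReal_ne_top]
  rw [← lintegral_lintegral_mul_lintegral hA hA, ← lintegral_lintegral_mul_lintegral hA hB,
    ← lintegral_lintegral_mul_lintegral hB hB, mul_left_comm, ← mul_add]
  gcongr
  rw [← lintegral_const_mul' _ _ (by norm_num), ← lintegral_add_left]
  · refine lintegral_mono fun w => ?_
    have := two_mul_le_add_sq_ennreal (∫⁻ y, A w y) (∫⁻ i, B w i ∂Measure.count)
    simpa only [sq, mul_assoc] using this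
  · have := Measurable.lintegral_prod_right (ν := (volume : Measure Space)) hA
    exact this.mul this

/-! ### One-particle densities -/

/-- All entries of the base configuration except the `i`-th are integrated out, so the constant
configuration `fun _ => x` is as good as any other with `x` in place `i`. -/
theorem lintegral_lmarginal_compl {N : ℕ} (i : Fin N) {F : Config N → ℝ≥0∞} (hF : Measurable F) :
    ∫⁻ x : Space, lmarginal (fun _ => volume) ({i}ᶜ : Finset (Fin N)) F (fun _ => x) =
      ∫⁻ X, F X := by
  have h1 : (Finset.univ : Finset (Fin N)) = insert i {i}ᶜ := by
    ext j
    simp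
  rw [volume_pi, lintegral_eq_lmarginal_univ (fun _ => 0), h1, lmarginal_insert _ hF (by simp)]
  refine lintegral_congr fun x => lmarginal_congr _ _ fun j hj => ?_
  have : j = i := by simpa using hj
  simp [this]

theorem lintegral_lmarginal_compl_mul {N : ℕ} (i : Fin N) {F : Config N → ℝ≥0∞} (hF : Measurable F)
    {g : Space → ℝ≥0∞} (hg : Measurable g) :
    ∫⁻ x : Space, lmarginal (fun _ => volume) ({i}ᶜ : Finset (Fin N)) F (fun _ => x) * g x =
      ∫⁻ X, F X * g (X i) := by
  rw [← lintegral_lmarginal_compl i (F := fun X => F X * g (X i))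
    (hF.mul (hg.comp (measurable_pi_apply i)))]
  refine lintegral_congr fun x => ?_
  have hm : Measurable fun y : (({i}ᶜ : Finset (Fin N)) → Space) =>
      F (Function.updateFinset (fun _ => x) {i}ᶜ y) := hF.comp measurable_updateFinset
  rw [lmarginal, lmarginal, ← lintegral_mul_const _ hm]
  refine lintegral_congr fun y => ?_
  simp [Function.updateFinset]

theorem measurable_enorm_sq {N : ℕ} (ψ : WaveFun N) : Measurable fun X => ‖ψ X‖ₑ ^ 2 :=
  (Lp.stronglyMeasurable ψ).measurable.enorm.pow_const 2

theorem measurable_density {N : ℕ} (ψ : WaveFun N) : Measurable (density ψ) := by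
  refine Finset.measurable_fun_sum _ fun i _ => ?_
  exact ((measurable_enorm_sq ψ).lmarginal _).comp (measurable_pi_lambda _ fun _ => measurable_id)

theorem lintegral_density_mul {N : ℕ} (ψ : WaveFun N) {g : Space → ℝ≥0∞} (hg : Measurable g) :
    ∫⁻ x, density ψ x * g x = ∫⁻ X, ‖ψ X‖ₑ ^ 2 * ∑ i, g (X i) := by
  simp_rw [density, Finset.sum_mul, Finset.mul_sum]
  rw [lintegral_finsetSum, lintegral_finsetSum]
  · refine Finset.sum_congr rfl fun i _ => ?_
    exact lintegral_lmarginal_compl_mul i (measurable_enorm_sq ψ) hg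
  · intro i _
    exact (measurable_enorm_sq ψ).mul (hg.comp (measurable_pi_apply i))
  · intro i _
    exact (((measurable_enorm_sq ψ).lmarginal _).comp
      (measurable_pi_lambda _ fun _ => measurable_id)).mul hg

theorem lintegral_enorm_sq {N : ℕ} (ψ : WaveFun N) : ∫⁻ X, ‖ψ X‖ₑ ^ 2 = ‖ψ‖ₑ ^ 2 := by
  rw [Lp.enorm_def, eLpNorm_eq_lintegral_rpow_enorm_toReal (by norm_num) (by norm_num)]
  simp only [ENNReal.toReal_ofNat, one_div]
  rw [← ENNReal.rpow_natCast, ← ENNReal.rpow_mul]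
  norm_num

theorem lintegral_density {N : ℕ} {ψ : WaveFun N} (hψ : ‖ψ‖ = 1) :
    ∫⁻ x, density ψ x = N := by
  have h := lintegral_density_mul ψ (g := fun _ => 1) measurable_const
  simp only [mul_one, Finset.sum_const, Finset.card_univ, Fintype.card_fin, nsmul_eq_mul] at h
  rw [h, lintegral_mul_const _ (measurable_enorm_sq ψ), lintegral_enorm_sq, ← ofReal_norm, hψ]
  simp

theorem density_lt_top_ae {N : ℕ} {ψ : WaveFun N} (hψ : ‖ψ‖ = 1) : ∀ᵐ x, density ψ x < ⊤ :=
  ae_lt_top (measurable_density ψ) (by rw [lintegral_density hψ]; simp)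

/-! ### The Lieb–Oxford inequality -/

/-- The smearing time at a point of density `a`. -/
def smearingTime (a : ℝ) : ℝ := 0.0324 * a ^ (-(2 / 3) : ℝ)

@[fun_prop]
theorem measurable_smearingTime : Measurable smearingTime := by
  unfold smearingTime
  fun_prop

theorem smearingTime_nonneg {a : ℝ} (ha : 0 ≤ a) : 0 ≤ smearingTime a := by
  unfold smearingTime
  positivity

/-- The smearing length is `k ρ^{-1/3}` with `k = 0.18`, and `0.0324 = k²`. For general `k` the
self-energies contribute `1/(2k√(2π))` to the Lieb–Oxford constant and the smearing error
contributes `4π · 0.35 · (2k)²`; the chosen `k` nearly minimizes the sum. -/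
theorem sqrt_smearingTime {a : ℝ} (ha : 0 < a) : √(smearingTime a) = 0.18 / a ^ (1 / 3 : ℝ) := by
  rw [smearingTime, sqrt_eq_iff_mul_self_eq_of_pos (by positivity), div_mul_div_comm,
    ← rpow_add ha, rpow_neg ha.le]
  norm_num
  rw [div_eq_mul_inv]

/-- A majorant of the direct interaction within the smearing distance, monotone in the density. -/
def coreMajorant (a : ℝ) (z : Space) : ℝ :=
  0.046656 * (erfcMajorant (a ^ (1 / 3 : ℝ) / 0.36 * ‖z‖) / ‖z‖ ^ 4)

@[fun_prop]
theorem _root_.Measurable.coreMajorant {β : Type*} [MeasurableSpace β] {a : β → ℝ} {z : β → Space}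
    (ha : Measurable a) (hz : Measurable z) : Measurable fun b => coreMajorant (a b) (z b) := by
  unfold Pekar.coreMajorant
  exact (((measurable_erfcMajorant.comp (by fun_prop)).div (by fun_prop))).const_mul _

theorem coreMajorant_nonneg {a : ℝ} (ha : 0 ≤ a) (z : Space) : 0 ≤ coreMajorant a z :=
  mul_nonneg (by norm_num) (div_nonneg (erfcMajorant_nonneg (by positivity)) (by positivity))

theorem coreMajorant_mono {a b : ℝ} (ha : 0 ≤ a) (hab : a ≤ b) (z : Space) :
    coreMajorant a z ≤ coreMajorant b z := by
  have hb := ha.trans hab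
  refine mul_le_mul_of_nonneg_left (div_le_div_of_nonneg_right ?_ (by positivity)) (by norm_num)
  refine monotoneOn_erfcMajorant (mem_Ici.2 (by positivity)) (mem_Ici.2 (by positivity)) ?_
  gcongr

theorem coreMajorant_sub_comm (a : ℝ) (x y : Space) :
    coreMajorant a (x - y) = coreMajorant a (y - x) := by
  simp [coreMajorant, norm_sub_rev]

/-- With `t = a^{1/3} ‖z‖ / 0.36` one has `a = (0.36 t / ‖z‖)³`, so `a erfc(t) / ‖z‖ = 0.36³ · t³
erfc(t) / ‖z‖⁴`. The density now enters through `t` alone, and `0.36³ = 0.046656`. -/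
theorem ofReal_mul_potentialCore_le {a : ℝ} (ha : 0 ≤ a) {z : Space} (hz : z ≠ 0) :
    ENNReal.ofReal a * potentialCore (smearingTime a) z ≤ ENNReal.ofReal (coreMajorant a z) := by
  rcases ha.eq_or_lt with rfl | ha
  · simp
  have hs : 0 < smearingTime a := by unfold smearingTime; positivity
  have hr : 0 < ‖z‖ := norm_pos_iff.2 hz
  rw [potentialCore_eq hs hz, sqrt_smearingTime ha, ← ofReal_norm, ← ENNReal.ofReal_div_of_pos hr,
    ← ENNReal.ofReal_mul ha.le]
  refine ENNReal.ofReal_le_ofReal ?_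
  have hc : 0 < a ^ (1 / 3 : ℝ) := by positivity
  have hc3 : (a ^ (1 / 3 : ℝ)) ^ 3 = a := by
    rw [← rpow_natCast, ← rpow_mul ha.le]
    norm_num
  have e : ‖z‖ / (2 * (0.18 / a ^ (1 / 3 : ℝ))) = a ^ (1 / 3 : ℝ) / 0.36 * ‖z‖ := by
    field_simp
    norm_num
  rw [e, coreMajorant]
  have h := pow_three_mul_erfc_le_erfcMajorant (t := a ^ (1 / 3 : ℝ) / 0.36 * ‖z‖) (by positivity)
  have h2 : a * (erfc (a ^ (1 / 3 : ℝ) / 0.36 * ‖z‖) / ‖z‖) = 0.046656 *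
      (((a ^ (1 / 3 : ℝ) / 0.36 * ‖z‖) ^ 3 * erfc (a ^ (1 / 3 : ℝ) / 0.36 * ‖z‖)) / ‖z‖ ^ 4) := by
    generalize erfc (a ^ (1 / 3 : ℝ) / 0.36 * ‖z‖) = E
    rw [mul_pow, div_pow, hc3]
    field_simp
    norm_num
  rw [h2]
  gcongr

theorem lintegral_coreMajorant_le {a : ℝ} (ha : 0 ≤ a) :
    ∫⁻ z, ENNReal.ofReal (coreMajorant a z) ≤
      ENNReal.ofReal (4 * π * 0.35 * 0.1296 * a ^ (1 / 3 : ℝ)) := by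
  simp_rw [coreMajorant, ENNReal.ofReal_mul (by norm_num : (0 : ℝ) ≤ 0.046656)]
  rw [lintegral_const_mul' _ _ ENNReal.ofReal_ne_top]
  refine (mul_le_mul_right (lintegral_erfcMajorant_le (by positivity)) _).trans ?_
  rw [← ENNReal.ofReal_mul (by norm_num)]
  apply ENNReal.ofReal_le_ofReal
  apply le_of_eq
  ring

theorem ae_ne (x : Space) : ∀ᵐ y : Space, x - y ≠ 0 := by
  have : ∀ᵐ y : Space, y ≠ x := by
    simp [ae_iff]
  exact this.mono fun y hy => sub_ne_zero.2 hy.symm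

/-- The direct interaction within the smearing distance is controlled by `∫ ρ^{4/3}`. -/
theorem lintegral_potentialCore_le {r : Space → ℝ} (hr : Measurable r) (h0 : ∀ x, 0 ≤ r x) :
    ∫⁻ x, ENNReal.ofReal (r x) * ∫⁻ y, ENNReal.ofReal (r y) *
      potentialCore (smearingTime (r x)) (x - y) ≤
    ENNReal.ofReal (4 * π * 0.35 * 0.1296) * ∫⁻ x, ENNReal.ofReal (r x ^ (4 / 3 : ℝ)) := by
  let M : Space → Space → ℝ≥0∞ := fun x y => ENNReal.ofReal (coreMajorant (r x) (x - y))
  have hM : Measurable fun q : Space × Space => M q.1 q.2 := by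
    simp only [M]
    fun_prop
  have hR : Measurable fun x => ENNReal.ofReal (r x) := hr.ennreal_ofReal
  set R : Space → ℝ≥0∞ := fun x => ENNReal.ofReal (r x) with hRdef
  have hRf : ∀ x, R x ≠ ⊤ := fun x => ENNReal.ofReal_ne_top
  have step1 : ∫⁻ x, R x * ∫⁻ y, R y * potentialCore (smearingTime (r x)) (x - y) ≤
      ∫⁻ x, ∫⁻ y, R y * M x y := by
    refine lintegral_mono fun x => ?_
    simp only
    rw [← lintegral_const_mul' _ _ (hRf x)]
    refine lintegral_mono_ae ((ae_ne x).mono fun y hy => ?_)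
    rw [mul_left_comm]
    gcongr
    exact ofReal_mul_potentialCore_le (h0 x) hy
  have swap : ∫⁻ x, ∫⁻ y, R y * M x y = ∫⁻ x, ∫⁻ y, R x * M y x := by
    rw [lintegral_lintegral_swap]
    fun_prop
  have swap2 : ∫⁻ x, ∫⁻ y, R x * M x y = ∫⁻ x, ∫⁻ y, R y * M y x := by
    rw [lintegral_lintegral_swap]
    fun_prop
  -- Rearrangement: after symmetrizing in `x` and `y`, the claim is `(r x - r y)(K(r x) - K(r y)) ≥
  -- 0` for `K a = coreMajorant a (x - y)`, which is monotone in `a`.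
  have step2 : 2 * ∫⁻ x, ∫⁻ y, R y * M x y ≤ 2 * ∫⁻ x, ∫⁻ y, R x * M x y := by
    have hm1 : Measurable fun q : Space × Space => R q.2 * M q.1 q.2 := by fun_prop
    have hm2 : Measurable fun q : Space × Space => R q.1 * M q.1 q.2 := by fun_prop
    rw [two_mul, two_mul]
    nth_rewrite 2 [swap]
    nth_rewrite 2 [swap2]
    rw [← lintegral_add_left hm1.lintegral_prod_right', ← lintegral_add_left hm2.lintegral_prod_right']
    refine lintegral_mono fun x => ?_
    simp only
    rw [← lintegral_add_left (by fun_prop), ← lintegral_add_left (by fun_prop)]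
    refine lintegral_mono fun y => ?_
    simp only [R, M]
    rw [coreMajorant_sub_comm (r y) y x]
    have a1 := coreMajorant_nonneg (h0 x) (x - y)
    have a2 := coreMajorant_nonneg (h0 y) (x - y)
    have b1 := h0 x
    have b2 := h0 y
    rw [← ENNReal.ofReal_mul b2, ← ENNReal.ofReal_mul b1, ← ENNReal.ofReal_mul b1,
      ← ENNReal.ofReal_mul b2, ← ENNReal.ofReal_add (by positivity) (by positivity),
      ← ENNReal.ofReal_add (by positivity) (by positivity)]
    apply ENNReal.ofReal_le_ofReal
    rcases le_total (r x) (r y) with h | h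
    · nlinarith [coreMajorant_mono b1 h (x - y)]
    · nlinarith [coreMajorant_mono b2 h (x - y)]
  have step3 : ∫⁻ x, ∫⁻ y, R x * M x y ≤
      ENNReal.ofReal (4 * π * 0.35 * 0.1296) * ∫⁻ x, ENNReal.ofReal (r x ^ (4 / 3 : ℝ)) := by
    rw [← lintegral_const_mul' _ _ ENNReal.ofReal_ne_top]
    refine lintegral_mono fun x => ?_
    simp only
    rw [lintegral_const_mul' _ _ (hRf x)]
    have : ∫⁻ y, M x y = ∫⁻ z, ENNReal.ofReal (coreMajorant (r x) z) :=
      lintegral_sub_left_eq_self (fun z => ENNReal.ofReal (coreMajorant (r x) z)) x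
    rw [this]
    refine (mul_le_mul_right (lintegral_coreMajorant_le (h0 x)) _).trans ?_
    simp only [R]
    rw [← ENNReal.ofReal_mul (h0 x), ← ENNReal.ofReal_mul (by positivity)]
    apply ENNReal.ofReal_le_ofReal
    apply le_of_eq
    have : r x ^ (4 / 3 : ℝ) = r x * r x ^ (1 / 3 : ℝ) := by
      rw [show (4 / 3 : ℝ) = 1 + 1 / 3 by norm_num, rpow_add' (h0 x) (by norm_num), rpow_one]
    rw [this]
    ring
  refine step1.trans (le_trans ?_ step3)
  exact (ENNReal.mul_le_mul_iff_right (by norm_num) (by norm_num)).1 step2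

theorem sum_sum_eq_sum_diag_add {n : ℕ} (f : Fin n → Fin n → ℝ≥0∞) (hf : ∀ i j, f i j = f j i) :
    ∑ i, ∑ j, f i j = ∑ i, f i i + 2 * ∑ i, ∑ j ∈ Finset.Ioi i, f i j := by
  have h := Finset.sum_sum_Ioi_add_eq_sum_sum_off_diag f
  have h2 : ∀ i, ∑ j, f i j = f i i + ∑ j ∈ ({i}ᶜ : Finset (Fin n)), f j i := by
    intro i
    rw [Fintype.sum_eq_add_sum_compl i]
    simp_rw [hf i]
  simp_rw [h2, Finset.sum_add_distrib, ← h, Finset.mul_sum]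
  congr 1
  refine Finset.sum_congr rfl fun i _ => Finset.sum_congr rfl fun j _ => ?_
  rw [hf j i, two_mul]

/-- The **Lieb–Oxford inequality** with constant `1.68`. -/
theorem coulomb_le_two_mul_repulsion_add {N : ℕ} {ψ : WaveFun N} (hψ : ‖ψ‖ = 1)
    (hfin : coulomb (density ψ) ≠ ⊤) :
    coulomb (density ψ) ≤ 2 * repulsion ψ + ENNReal.ofReal (2 * 1.68) *
      ∫⁻ x, ENNReal.ofReal ((density ψ x).toReal ^ (4 / 3 : ℝ)) := by
  set ρ := density ψ with hρdef
  have hρm : Measurable ρ := measurable_density ψ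
  let r : Space → ℝ := fun x => (ρ x).toReal
  have hr : Measurable r := hρm.ennreal_toReal
  have h0 : ∀ x, 0 ≤ r x := fun x => ENNReal.toReal_nonneg
  have hae : ∀ᵐ x, ρ x = ENNReal.ofReal (r x) :=
    (density_lt_top_ae hψ).mono fun x hx => (ENNReal.ofReal_toReal hx.ne).symm
  have hs0 : ∀ x, 0 ≤ smearingTime (r x) := fun x => smearingTime_nonneg (h0 x)
  -- Interaction of `ρ` with the Gaussian charge centred at `x`, whose width is dictated by the
  -- density there.
  let Φ : Space → ℝ≥0∞ := fun x => ∫⁻ y, ρ y * smearedPotential (smearingTime (r x)) (y - x)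
  have hΦ : Measurable Φ := by
    refine Measurable.lintegral_prod_right'
      (f := fun q : Space × Space => ρ q.2 * smearedPotential (smearingTime (r q.1)) (q.2 - q.1)) ?_
    fun_prop
  let σ : Space → ℝ≥0∞ := fun x => smearedPotential (smearingTime (r x) + smearingTime (r x)) 0
  have hσ : Measurable σ := by
    simp only [σ]
    fun_prop
  set Z := ∫⁻ x, ENNReal.ofReal (r x ^ (4 / 3 : ℝ)) with hZ
  -- the pointwise inequality, averaged over `|ψ|²`
  have main : 2 * (∫⁻ x, ρ x * Φ x) ≤
      coulomb ρ + ((∫⁻ x, ρ x * σ x) + 2 * repulsion ψ) := by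
    -- In the sum over all pairs of charges the diagonal gives the self-energies `σ`; off the
    -- diagonal, smearing only lowers the Coulomb interaction.
    have hpt : ∀ X : Config N, 2 * ∑ i, Φ (X i) ≤ coulomb ρ + (∑ i, σ (X i) +
        2 * ∑ i, ∑ j ∈ Finset.Ioi i, 1 / ‖X i - X j‖ₑ) := by
      intro X
      refine (two_mul_sum_lintegral_smearedPotential_le hρm
        (s := fun i => smearingTime (r (X i))) (fun i => hs0 _) X).trans ?_
      rw [sum_sum_eq_sum_diag_add]
      · gcongr with i _ i _ j _
        · simp [σ]
        · exact smearedPotential_le (add_nonneg (hs0 _) (hs0 _)) _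
      · intro i j
        rw [add_comm, smearedPotential, smearedPotential]
        simp_rw [heatKernelE_sub_comm _ (X i) (X j)]
    have hψm := measurable_enorm_sq ψ
    have hrep : repulsion ψ = ∫⁻ X, ‖ψ X‖ₑ ^ 2 * ∑ i, ∑ j ∈ Finset.Ioi i, 1 / ‖X i - X j‖ₑ := by
      simp_rw [repulsion, Finset.mul_sum]
      have hmm : ∀ i j : Fin N, Measurable fun X : Config N => ‖ψ X‖ₑ ^ 2 * (1 / ‖X i - X j‖ₑ) := by
        intro i j
        simp_rw [one_div]
        fun_prop
      rw [lintegral_finsetSum _ fun i _ => Finset.measurable_fun_sum _ fun j _ => hmm i j]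
      refine Finset.sum_congr rfl fun i _ => ?_
      rw [lintegral_finsetSum _ fun j _ => hmm i j]
      simp_rw [one_div, div_eq_mul_inv]
    have hone : ∫⁻ X, ‖ψ X‖ₑ ^ 2 = 1 := by
      rw [lintegral_enorm_sq, ← ofReal_norm, hψ]
      simp
    have hσm : Measurable fun X : Config N => ∑ i, σ (X i) :=
      Finset.measurable_fun_sum _ fun i _ => hσ.comp (measurable_pi_apply i)
    calc 2 * (∫⁻ x, ρ x * Φ x) = ∫⁻ X, ‖ψ X‖ₑ ^ 2 * (2 * ∑ i, Φ (X i)) := by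
          rw [lintegral_density_mul ψ hΦ, ← lintegral_const_mul' _ _ (by norm_num)]
          exact lintegral_congr fun X => mul_left_comm _ _ _
      _ ≤ ∫⁻ X, (‖ψ X‖ₑ ^ 2 * coulomb ρ + (‖ψ X‖ₑ ^ 2 * ∑ i, σ (X i) +
          2 * (‖ψ X‖ₑ ^ 2 * ∑ i, ∑ j ∈ Finset.Ioi i, 1 / ‖X i - X j‖ₑ))) := by
          refine lintegral_mono fun X => ?_
          refine (mul_le_mul_right (hpt X) _).trans (le_of_eq ?_)
          ring
      _ = _ := by
          rw [lintegral_add_left (by fun_prop), lintegral_add_left (by fun_prop),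
            lintegral_mul_const' _ _ hfin, hone, one_mul, lintegral_const_mul' _ _ (by norm_num),
            ← hrep, lintegral_density_mul ψ hσ]
  -- the smearing error
  have split : coulomb ρ ≤ (∫⁻ x, ρ x * Φ x) +
      ENNReal.ofReal (4 * π * 0.35 * 0.1296) * Z := by
    refine le_trans ?_ (add_le_add_right (lintegral_potentialCore_le hr h0) _)
    rw [← lintegral_add_left (by fun_prop)]
    refine lintegral_mono_ae (hae.mono fun x hx => ?_)
    have hx' : ρ x ≠ ⊤ := by rw [hx]; exact ENNReal.ofReal_ne_top
    rw [← hx, ← mul_add]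
    simp_rw [mul_div_assoc]
    rw [lintegral_const_mul' _ _ hx']
    gcongr
    simp only [Φ]
    rw [← lintegral_add_left (by fun_prop)]
    refine lintegral_mono_ae ?_
    filter_upwards [hae, ae_ne x] with y hy hxy
    rw [← hy, ← mul_add, div_eq_mul_inv, ← one_div]
    gcongr
    have h := inv_enorm_le_smearedPotential_add (s := smearingTime (r x)) hxy
    refine h.trans (le_of_eq ?_)
    congr 1
    simp_rw [smearedPotential, heatKernelE_sub_comm _ x y]
  -- the self-energies
  have self : (∫⁻ x, ρ x * σ x) ≤ ENNReal.ofReal (2 * (0.39895 / 0.36)) * Z := by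
    rw [hZ, ← lintegral_const_mul' _ _ ENNReal.ofReal_ne_top]
    refine lintegral_mono_ae (hae.mono fun x hx => ?_)
    rw [hx]
    -- Where the density vanishes, `0 ^ (-(2 / 3)) = 0` makes the smearing time `0` and the
    -- self-energy infinite; the convention `0 * ⊤ = 0` removes these points.
    rcases (h0 x).eq_or_lt with h | h
    · simp [← h]
    have hst : 0 < smearingTime (r x) := by unfold smearingTime; positivity
    simp only [σ]
    rw [smearedPotential_zero (by positivity), ← ENNReal.ofReal_mul (h0 x),
      ← ENNReal.ofReal_mul (by norm_num)]
    apply ENNReal.ofReal_le_ofReal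
    have e1 : r x ^ (4 / 3 : ℝ) = r x * r x ^ (1 / 3 : ℝ) := by
      rw [show (4 / 3 : ℝ) = 1 + 1 / 3 by norm_num, rpow_add h, rpow_one]
    have e2 : √(π * (smearingTime (r x) + smearingTime (r x))) = √(2 * π) * (0.18 / r x ^ (1 / 3 : ℝ)) := by
      rw [← sqrt_smearingTime h, ← sqrt_mul (by positivity)]
      ring_nf
    have e3 : 1 / 0.39895 ≤ √(2 * π) := by
      refine le_sqrt_of_sq_le ?_
      have := pi_gt_d6
      norm_num at this ⊢
      linarith
    rw [e1, e2]
    have hc : 0 < r x ^ (1 / 3 : ℝ) := by positivity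
    have h2 : 0 < √(2 * π) := by positivity
    have e4 : 1 / √(2 * π) ≤ 0.39895 := by
      rw [div_le_comm₀ h2 (by norm_num)]
      exact e3
    calc r x * (1 / (√(2 * π) * (0.18 / r x ^ (1 / 3 : ℝ)))) =
        (1 / √(2 * π)) * (r x * r x ^ (1 / 3 : ℝ) / 0.18) := by field_simp
      _ ≤ 0.39895 * (r x * r x ^ (1 / 3 : ℝ) / 0.18) := by gcongr
      _ = _ := by ring
  -- The bound on `2 D` contains `D` on its right side, and finiteness of `D` allows one copy to be
  -- cancelled. Numerically `0.39895 / 0.36 + 4π · 0.35 · 0.1296 ≈ 1.6782`.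
  have fin : coulomb ρ + coulomb ρ ≤ coulomb ρ + (2 * repulsion ψ + ENNReal.ofReal (2 * 1.68) * Z) := by
    calc coulomb ρ + coulomb ρ = 2 * coulomb ρ := (two_mul _).symm
      _ ≤ 2 * ((∫⁻ x, ρ x * Φ x) + ENNReal.ofReal (4 * π * 0.35 * 0.1296) * Z) := by gcongr
      _ = 2 * (∫⁻ x, ρ x * Φ x) + ENNReal.ofReal (2 * (4 * π * 0.35 * 0.1296)) * Z := by
          rw [mul_add, ← mul_assoc, ENNReal.ofReal_mul (by norm_num : (0 : ℝ) ≤ 2)]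
          simp
      _ ≤ coulomb ρ + (ENNReal.ofReal (2 * (0.39895 / 0.36)) * Z + 2 * repulsion ψ) +
          ENNReal.ofReal (2 * (4 * π * 0.35 * 0.1296)) * Z := by
          gcongr
          exact main.trans (by gcongr)
      _ = coulomb ρ + (2 * repulsion ψ + ENNReal.ofReal (2 * (0.39895 / 0.36) +
          2 * (4 * π * 0.35 * 0.1296)) * Z) := by
          rw [ENNReal.ofReal_add (by norm_num) (by positivity)]
          ring
      _ ≤ _ := by
          gcongr
          have := pi_lt_d4
          norm_num at this ⊢
          linarith
  exact (ENNReal.add_le_add_iff_left hfin).1 fin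

/-! ### Translates of Sobolev functions -/

theorem locallyIntegrable_waveFun {N : ℕ} (ψ : WaveFun N) : LocallyIntegrable (fun X => ψ X) :=
  (Lp.memLp ψ).locallyIntegrable (by norm_num)

theorem integrable_smul_waveFun {N : ℕ} (ψ : WaveFun N) {φ : Config N → ℝ} (hc : Continuous φ)
    (hs : HasCompactSupport φ) : Integrable fun X => φ X • ψ X :=
  (locallyIntegrable_waveFun ψ).integrable_smul_left_of_hasCompactSupport hc hs

theorem hasCompactSupport_fderiv_apply {E F : Type*} [NormedAddCommGroup E] [NormedSpace ℝ E]
    [NormedAddCommGroup F] [NormedSpace ℝ F] {φ : E → F} (hs : HasCompactSupport φ) (v : E) :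
    HasCompactSupport fun X => fderiv ℝ φ X v :=
  (hs.fderiv (𝕜 := ℝ)).comp_left (g := fun L : E →L[ℝ] F => L v) (by simp)

/-- The weak derivative in an arbitrary direction of one particle. -/
theorem integral_fderiv_single_smul {N : ℕ} {ψ : WaveFun N} {i : Fin N} {g : Fin 3 → WaveFun N}
    (hg : ∀ k, IsWeakPartial ψ i k (g k)) (h : Space) {φ : Config N → ℝ} (hφ : ContDiff ℝ ∞ φ)
    (hs : HasCompactSupport φ) :
    ∫ X, (fderiv ℝ φ X (Pi.single i h)) • ψ X = - ∫ X, φ X • (∑ k, h k • g k : WaveFun N) X := by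
  have e1 : (Pi.single i h : Config N) = ∑ k, h k • dir i k := by
    have : h = ∑ k, h k • EuclideanSpace.single k (1 : ℝ) := by
      ext j
      simp [Finset.sum_apply, Pi.single_apply]
    ext j : 1
    by_cases hj : j = i
    · subst hj
      simpa [dir] using this
    · simp [dir, hj]
  have e2 : ∀ᵐ X, φ X • (∑ k, h k • g k : WaveFun N) X = ∑ k, h k • (φ X • g k X) := by
    have h1 : ∀ᵐ X, ∀ k, (h k • g k : WaveFun N) X = h k • g k X :=
      ae_all_iff.2 fun k => Lp.coeFn_smul (h k) (g k)
    filter_upwards [h1, Lp.coeFn_finsetSum Finset.univ fun k => h k • g k] with X hX1 hX2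
    rw [hX2, Finset.sum_apply, Finset.smul_sum]
    refine Finset.sum_congr rfl fun k _ => ?_
    rw [hX1 k, smul_comm]
  have hgi : ∀ k, Integrable fun X => h k • (φ X • g k X) := fun k =>
    (integrable_smul_waveFun (g k) hφ.continuous hs).smul (h k)
  rw [integral_congr_ae e2, integral_finsetSum _ fun k _ => hgi k]
  simp_rw [e1, map_sum, map_smul, Finset.sum_smul]
  have hd : ∀ k, Integrable fun X => fderiv ℝ φ X (dir i k) • ψ X := fun k =>
    integrable_smul_waveFun ψ ((hφ.continuous_fderiv (by simp)).clm_apply continuous_const)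
      (hasCompactSupport_fderiv_apply hs _)
  have hd' : ∀ k, Integrable fun X => h k • (fderiv ℝ φ X (dir i k) • ψ X) := fun k =>
    (hd k).smul (h k)
  simp_rw [smul_assoc]
  rw [integral_finsetSum _ fun k _ => hd' k, ← Finset.sum_neg_distrib]
  refine Finset.sum_congr rfl fun k _ => ?_
  rw [integral_smul, integral_smul, hg k φ hφ hs, smul_neg]

/-- Integration by parts extends to complex test functions. -/
theorem integral_fderiv_mul {N : ℕ} {ψ G : WaveFun N} {v : Config N}
    (hG : ∀ φ : Config N → ℝ, ContDiff ℝ ∞ φ → HasCompactSupport φ →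
      ∫ X, (fderiv ℝ φ X v) • ψ X = - ∫ X, φ X • G X)
    {χ : Config N → ℂ} (hχ : ContDiff ℝ ∞ χ) (hs : HasCompactSupport χ) :
    ∫ X, ψ X * fderiv ℝ χ X v = - ∫ X, G X * χ X := by
  let a : Config N → ℝ := fun X => (χ X).re
  let b : Config N → ℝ := fun X => (χ X).im
  have ha : ContDiff ℝ ∞ a := Complex.reCLM.contDiff.comp hχ
  have hb : ContDiff ℝ ∞ b := Complex.imCLM.contDiff.comp hχ
  have has : HasCompactSupport a := hs.comp_left (g := Complex.re) rfl
  have hbs : HasCompactSupport b := hs.comp_left (g := Complex.im) rfl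
  have hda : ∀ X, fderiv ℝ a X v = (fderiv ℝ χ X v).re := fun X => by
    have := (Complex.reCLM.hasFDerivAt.comp X ((hχ.differentiable (by simp)) X).hasFDerivAt).fderiv
    change fderiv ℝ (Complex.reCLM ∘ χ) X v = _
    rw [this]
    rfl
  have hdb : ∀ X, fderiv ℝ b X v = (fderiv ℝ χ X v).im := fun X => by
    have := (Complex.imCLM.hasFDerivAt.comp X ((hχ.differentiable (by simp)) X).hasFDerivAt).fderiv
    change fderiv ℝ (Complex.imCLM ∘ χ) X v = _
    rw [this]
    rfl
  have e1 : ∀ X, ψ X * fderiv ℝ χ X v = fderiv ℝ a X v • ψ X + Complex.I * (fderiv ℝ b X v • ψ X) := by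
    intro X
    rw [hda, hdb, Complex.real_smul, Complex.real_smul]
    conv_lhs => rw [← Complex.re_add_im (fderiv ℝ χ X v)]
    ring
  have e2 : ∀ X, G X * χ X = a X • G X + Complex.I * (b X • G X) := by
    intro X
    rw [Complex.real_smul, Complex.real_smul]
    conv_lhs => rw [← Complex.re_add_im (χ X)]
    ring
  have i1 := integrable_smul_waveFun ψ ((ha.continuous_fderiv (by simp)).clm_apply
    (continuous_const (y := v))) (hasCompactSupport_fderiv_apply has v)
  have i2 := integrable_smul_waveFun ψ ((hb.continuous_fderiv (by simp)).clm_apply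
    (continuous_const (y := v))) (hasCompactSupport_fderiv_apply hbs v)
  have i3 := integrable_smul_waveFun G ha.continuous has
  have i4 := integrable_smul_waveFun G hb.continuous hbs
  simp_rw [e1, e2]
  rw [integral_add i1 (i2.const_mul _), integral_add i3 (i4.const_mul _), integral_const_mul,
    integral_const_mul, hG a ha has, hG b hb hbs]
  ring

theorem norm_star_waveFun {N : ℕ} (G : WaveFun N) : ‖(star G : WaveFun N)‖ = ‖G‖ := by
  have h : ∀ᵐ X, ‖(star G : WaveFun N) X‖ = ‖G X‖ := by
    filter_upwards [Lp.coeFn_star G] with X hX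
    rw [hX]
    simp
  exact le_antisymm (Lp.norm_le_norm_of_ae_le (h.mono fun X hX => hX.le))
    (Lp.norm_le_norm_of_ae_le (h.mono fun X hX => hX.ge))

theorem norm_integral_mul_le {N : ℕ} (G f : WaveFun N) : ‖∫ X, G X * f X‖ ≤ ‖G‖ * ‖f‖ := by
  have h1 : ∫ X, G X * f X = inner ℂ (star G : WaveFun N) f := by
    rw [L2.inner_def]
    refine integral_congr_ae ?_
    filter_upwards [Lp.coeFn_star G] with X hX
    rw [hX]
    simp [mul_comm]
  rw [h1, ← norm_star_waveFun G]
  exact norm_inner_le_norm (𝕜 := ℂ) (star G : WaveFun N) f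

/-- The translate of a wave function. -/
def translate {N : ℕ} (v : Config N) (ψ : WaveFun N) : WaveFun N :=
  Lp.compMeasurePreserving (fun X => X + v) (measurePreserving_add_right volume v) ψ

theorem coeFn_translate {N : ℕ} (v : Config N) (ψ : WaveFun N) :
    ∀ᵐ X, translate v ψ X = ψ (X + v) :=
  Lp.coeFn_compMeasurePreserving ψ (measurePreserving_add_right volume v)

/-- Move the translation onto the test function: `c(s) = ∫ ψ χ(· - s v)` has derivative `∫ G χ(· - s
v)`, bounded by `‖G‖ ‖f‖` uniformly in `s`. The left side is `|c(1) - c(0)|`, so the mean value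
inequality applies. -/
theorem norm_integral_translate_sub_mul_le {N : ℕ} {ψ G : WaveFun N} {v : Config N}
    (hG : ∀ φ : Config N → ℝ, ContDiff ℝ ∞ φ → HasCompactSupport φ →
      ∫ X, (fderiv ℝ φ X v) • ψ X = - ∫ X, φ X • G X)
    {χ : Config N → ℂ} (hχ : ContDiff ℝ ∞ χ) (hs : HasCompactSupport χ) {f : WaveFun N}
    (hf : ∀ᵐ X, f X = χ X) :
    ‖∫ X, (translate v ψ - ψ : WaveFun N) X * f X‖ ≤ ‖G‖ * ‖f‖ := by
  -- translates of the test function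
  have hcont : ∀ s : ℝ, ContDiff ℝ ∞ fun X => χ (X - s • v) := fun s =>
    hχ.comp (contDiff_id.sub contDiff_const)
  have hcomp : ∀ s : ℝ, HasCompactSupport fun X => χ (X - s • v) := fun s =>
    hs.comp_homeomorph (Homeomorph.subRight (s • v))
  -- Reflecting the test function turns `c` into a convolution along the line `s • v`, which can be
  -- differentiated.
  let χ' : Config N → ℂ := fun X => χ (-X)
  have hχ' : ContDiff ℝ 1 χ' := (hχ.comp contDiff_neg).of_le (by exact_mod_cast le_top)
  have hs' : HasCompactSupport χ' := hs.comp_homeomorph (Homeomorph.neg _)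
  let L := ContinuousLinearMap.mul ℝ ℂ
  let c : ℝ → ℂ := fun s => ∫ X, ψ X * χ (X - s • v)
  have hc : ∀ s, HasDerivAt c (∫ X, G X * χ (X - s • v)) s := by
    intro s
    have h1 := hs'.hasFDerivAt_convolution_right L (locallyIntegrable_waveFun ψ) hχ' (s • v)
    have h2 : HasDerivAt (fun s : ℝ => s • v) v s := by
      simpa using (hasDerivAt_id s).smul_const v
    have h3 := h1.comp_hasDerivAt s h2
    have e1 : (convolution (fun X => ψ X) χ' L volume ∘ fun s : ℝ => s • v) = c := by
      ext s
      simp only [Function.comp, convolution_def, c, L, χ', ContinuousLinearMap.mul_apply', neg_sub]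
    rw [e1] at h3
    refine h3.congr_deriv ?_
    rw [convolution_precompR_apply L (locallyIntegrable_waveFun ψ) (hs'.fderiv (𝕜 := ℝ))
      (hχ'.continuous_fderiv (by simp)), convolution_def]
    have h4 := integral_fderiv_mul hG (hcont s) (hcomp s)
    rw [← neg_eq_iff_eq_neg] at h4
    rw [← h4, ← integral_neg]
    refine integral_congr_ae (Eventually.of_forall fun X => ?_)
    have e2 : fderiv ℝ (fun X => χ (X - s • v)) X = fderiv ℝ χ (X - s • v) := by
      rw [fderiv_comp_sub]
    have e3 : fderiv ℝ χ' (s • v - X) v = - fderiv ℝ χ (X - s • v) v := by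
      have h5 := ((hχ.differentiable (by simp)) (-(s • v - X))).hasFDerivAt.comp (s • v - X)
        (hasFDerivAt_id (s • v - X)).neg
      have h6 : fderiv ℝ χ' (s • v - X) = _ := h5.fderiv
      rw [h6, neg_sub]
      simp
    simp only [L, ContinuousLinearMap.mul_apply']
    rw [e3, e2, mul_neg]
  have hbound : ∀ s : ℝ, ‖∫ X, G X * χ (X - s • v)‖ ≤ ‖G‖ * ‖f‖ := by
    intro s
    have e : ∫ X, G X * χ (X - s • v) = ∫ X, G X * (translate (-(s • v)) f) X := by
      refine integral_congr_ae ?_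
      have h1 : ∀ᵐ X, f (X + -(s • v)) = χ (X + -(s • v)) :=
        (measurePreserving_add_right volume (-(s • v))).quasiMeasurePreserving.ae hf
      filter_upwards [coeFn_translate (-(s • v)) f, h1] with X hX1 hX2
      rw [hX1, hX2, sub_eq_add_neg]
    rw [e]
    refine (norm_integral_mul_le _ _).trans (le_of_eq ?_)
    rw [translate, Lp.norm_compMeasurePreserving]
  have hmvt : ‖c 1 - c 0‖ ≤ ‖G‖ * ‖f‖ := by
    have := Convex.norm_image_sub_le_of_norm_hasDerivWithin_le (s := univ) (x := (0 : ℝ)) (y := 1)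
      (fun s _ => (hc s).hasDerivWithinAt) (fun s _ => hbound s) convex_univ trivial trivial
    simpa using this
  refine le_trans (le_of_eq ?_) hmvt
  congr 1
  have i1 : ∀ s : ℝ, Integrable fun X => ψ X * χ (X - s • v) := by
    intro s
    have h := (locallyIntegrable_waveFun ψ).integrable_smul_left_of_hasCompactSupport (𝕜 := ℂ)
      (hcont s).continuous (hcomp s)
    simpa only [smul_eq_mul, mul_comm] using h
  have i2 : Integrable fun X => ψ (X + v) * χ X := by
    have := (i1 1).comp_add_right v
    simpa using this
  have e1 : c 1 = ∫ X, ψ (X + v) * χ X := by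
    have := integral_add_right_eq_self (μ := volume) (fun X => ψ X * χ (X - (1 : ℝ) • v)) v
    simp only [one_smul, add_sub_cancel_right] at this
    simp only [c, one_smul]
    exact this.symm
  have e0 : c 0 = ∫ X, ψ X * χ X := by simp [c]
  have i0 : Integrable fun X => ψ X * χ X := by simpa using i1 0
  rw [e1, e0, ← integral_sub i2 i0]
  refine integral_congr_ae ?_
  filter_upwards [coeFn_translate v ψ, hf, Lp.coeFn_sub (translate v ψ) ψ] with X h1 h2 h3
  rw [h3, Pi.sub_apply, h1, h2, sub_mul]

/-- Duality: the bound against smooth compactly supported functions extends to all of `L²` by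
density, and is then tested on the difference itself. The `star` compensates for the conjugation in
the inner product, as the pairing with test functions is bilinear. -/
theorem norm_translate_sub_le {N : ℕ} {ψ G : WaveFun N} {v : Config N}
    (hG : ∀ φ : Config N → ℝ, ContDiff ℝ ∞ φ → HasCompactSupport φ →
      ∫ X, (fderiv ℝ φ X v) • ψ X = - ∫ X, φ X • G X) :
    ‖translate v ψ - ψ‖ ≤ ‖G‖ := by
  set w := translate v ψ - ψ with hw
  have hall : ∀ f : WaveFun N, ‖inner ℂ (star w : WaveFun N) f‖ ≤ ‖G‖ * ‖f‖ := by
    intro f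
    have hd := Lp.dense_hasCompactSupport_contDiff (E := Config N) (F := ℂ) (p := 2)
      (μ := volume) (by norm_num)
    refine hd.induction (P := fun f : WaveFun N => ‖inner ℂ (star w : WaveFun N) f‖ ≤ ‖G‖ * ‖f‖) ?_ ?_ f
    · rintro f ⟨χ, h1, h2, h3⟩
      have := norm_integral_translate_sub_mul_le hG h3 h2 h1
      refine le_trans (le_of_eq ?_) this
      rw [L2.inner_def]
      congr 1
      refine integral_congr_ae ?_
      filter_upwards [Lp.coeFn_star w] with X hX
      rw [hX]
      simp [mul_comm, hw]
    · exact isClosed_le (by fun_prop) (by fun_prop)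
  have h := hall (star w)
  rw [inner_self_eq_norm_sq_to_K] at h
  simp only [norm_pow] at h
  rcases (norm_nonneg w).eq_or_lt with h0 | h0
  · rw [← h0]
    exact norm_nonneg _
  · simp only [RCLike.norm_ofReal, abs_norm, norm_star_waveFun] at h
    nlinarith

theorem lintegral_translate_sub_le {N : ℕ} {ψ : WaveFun N} {i : Fin N} {g : Fin 3 → WaveFun N}
    (hg : ∀ k, IsWeakPartial ψ i k (g k)) (h : Space) :
    ∫⁻ X, ‖ψ (X + Pi.single i h) - ψ X‖ₑ ^ 2 ≤ ∫⁻ X, ‖∑ k, h k • g k X‖ₑ ^ 2 := by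
  have h1 := norm_translate_sub_le (ψ := ψ) (G := ∑ k, h k • g k) (v := Pi.single i h)
    fun φ hφ hs => integral_fderiv_single_smul hg h hφ hs
  have h2 : ‖translate (Pi.single i h) ψ - ψ‖ₑ ^ 2 ≤ ‖∑ k, h k • g k‖ₑ ^ 2 := by
    gcongr
    rw [← ofReal_norm, ← ofReal_norm]
    exact ENNReal.ofReal_le_ofReal h1
  rw [← lintegral_enorm_sq, ← lintegral_enorm_sq] at h2
  refine (le_of_eq ?_).trans (h2.trans (le_of_eq ?_))
  · refine lintegral_congr_ae ?_
    filter_upwards [coeFn_translate (Pi.single i h) ψ, Lp.coeFn_sub (translate (Pi.single i h) ψ) ψ]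
      with X h1 h3
    rw [h3, Pi.sub_apply, h1]
  · refine lintegral_congr_ae ?_
    have h1 : ∀ᵐ X, ∀ k, (h k • g k : WaveFun N) X = h k • g k X :=
      ae_all_iff.2 fun k => Lp.coeFn_smul (h k) (g k)
    filter_upwards [h1, Lp.coeFn_finsetSum Finset.univ fun k => h k • g k] with X hX1 hX2
    rw [hX2, Finset.sum_apply]
    simp_rw [hX1]

/-! ### The square root of the density -/

theorem rpow_half_sum_le {ι : Type*} [Fintype ι] {A B D : ι → ℝ≥0∞}
    (h : ∀ i, A i ^ (1 / 2 : ℝ) ≤ B i ^ (1 / 2 : ℝ) + D i ^ (1 / 2 : ℝ)) :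
    (∑ i, A i) ^ (1 / 2 : ℝ) ≤ (∑ i, B i) ^ (1 / 2 : ℝ) + (∑ i, D i) ^ (1 / 2 : ℝ) := by
  have e : ∀ a : ℝ≥0∞, (a ^ (1 / 2 : ℝ)) ^ (2 : ℝ) = a := fun a => by
    rw [← ENNReal.rpow_mul]
    norm_num
  have h1 := ENNReal.Lp_add_le Finset.univ (fun i => B i ^ (1 / 2 : ℝ)) (fun i => D i ^ (1 / 2 : ℝ))
    (p := 2) (by norm_num)
  simp only [e] at h1
  refine le_trans ?_ h1
  gcongr with i
  conv_lhs => rw [← e (A i)]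
  gcongr
  exact h i

theorem rpow_half_lintegral_le {Ω : Type*} [MeasurableSpace Ω] {μ : Measure Ω} {a b d : Ω → ℝ≥0∞}
    (hb : Measurable b) (hd : Measurable d) (h : ∀ y, a y ≤ b y + d y) :
    (∫⁻ y, a y ^ 2 ∂μ) ^ (1 / 2 : ℝ) ≤
      (∫⁻ y, b y ^ 2 ∂μ) ^ (1 / 2 : ℝ) + (∫⁻ y, d y ^ 2 ∂μ) ^ (1 / 2 : ℝ) := by
  have h1 := ENNReal.lintegral_Lp_add_le (μ := μ) hb.aemeasurable hd.aemeasurable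
    (p := 2) (by norm_num)
  simp only [Pi.add_apply, ENNReal.rpow_two] at h1
  refine le_trans ?_ h1
  gcongr with y
  exact h y

/-- The squared distance between the conditional wave functions at `x` and at `x + h`. -/
def translationDefect {N : ℕ} (ψ : WaveFun N) (h x : Space) : ℝ≥0∞ :=
  ∑ i : Fin N, lmarginal (fun _ => volume) ({i}ᶜ : Finset (Fin N))
    (fun X => ‖ψ (X + Pi.single i h) - ψ X‖ₑ ^ 2) (fun _ => x)

theorem measurable_translate_sub {N : ℕ} (ψ : WaveFun N) (v : Config N) :
    Measurable fun X => ‖ψ (X + v) - ψ X‖ₑ := by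
  have := (Lp.stronglyMeasurable ψ).measurable
  fun_prop

theorem lintegral_translationDefect {N : ℕ} (ψ : WaveFun N) (h : Space) :
    ∫⁻ x, translationDefect ψ h x = ∑ i : Fin N, ∫⁻ X, ‖ψ (X + Pi.single i h) - ψ X‖ₑ ^ 2 := by
  have hm : ∀ i : Fin N, Measurable fun X => ‖ψ (X + Pi.single i h) - ψ X‖ₑ ^ 2 :=
    fun i => (measurable_translate_sub ψ _).pow_const 2
  simp_rw [translationDefect]
  rw [lintegral_finsetSum]
  · exact Finset.sum_congr rfl fun i _ => lintegral_lmarginal_compl i (hm i)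
  · intro i _
    exact ((hm i).lmarginal _).comp (measurable_pi_lambda _ fun _ => measurable_id)

theorem density_add {N : ℕ} (ψ : WaveFun N) (x h : Space) :
    density ψ (x + h) = ∑ i : Fin N, lmarginal (fun _ => volume) ({i}ᶜ : Finset (Fin N))
      (fun X => ‖ψ (X + Pi.single i h)‖ₑ ^ 2) (fun _ => x) := by
  refine Finset.sum_congr rfl fun i _ => ?_
  rw [lmarginal, lmarginal]
  refine lintegral_congr fun y => ?_
  have : Function.updateFinset (fun _ => x + h) {i}ᶜ y =
      Function.updateFinset (fun _ => x) {i}ᶜ y + (Pi.single i h : Config N) := by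
    ext j : 1
    by_cases hj : j = i
    · subst hj
      simp [Function.updateFinset]
    · simp [Function.updateFinset, hj]
  rw [this]

theorem enorm_le_add_enorm_sub (u v : ℂ) : ‖u‖ₑ ≤ ‖v‖ₑ + ‖u - v‖ₑ ∧ ‖v‖ₑ ≤ ‖u‖ₑ + ‖u - v‖ₑ :=
  ⟨by simpa using enorm_add_le v (u - v), by simpa using enorm_sub_le (a := u) (b := u - v)⟩

/-- `√ρ(x)` is the norm, in the direct sum over `i` of `L²` of the other variables, of the slices of
`ψ` with `x` in place `i`. Both bounds are the triangle inequality there: Minkowski in `L²` for each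
`i`, then in the finite sum. -/
theorem rpow_half_density_le {N : ℕ} (ψ : WaveFun N) (x h : Space) :
    density ψ (x + h) ^ (1 / 2 : ℝ) ≤
        density ψ x ^ (1 / 2 : ℝ) + translationDefect ψ h x ^ (1 / 2 : ℝ) ∧
      density ψ x ^ (1 / 2 : ℝ) ≤
        density ψ (x + h) ^ (1 / 2 : ℝ) + translationDefect ψ h x ^ (1 / 2 : ℝ) := by
  have hψ := (Lp.stronglyMeasurable ψ).measurable
  rw [density_add]
  have hu : ∀ i : Fin N, Measurable fun y : (({i}ᶜ : Finset (Fin N)) → Space) =>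
      Function.updateFinset (fun _ => x) {i}ᶜ y := fun i => measurable_updateFinset
  have m1 : ∀ i : Fin N, Measurable fun y : (({i}ᶜ : Finset (Fin N)) → Space) =>
      ‖ψ (Function.updateFinset (fun _ => x) {i}ᶜ y)‖ₑ := fun i => hψ.enorm.comp (hu i)
  have m2 : ∀ i : Fin N, Measurable fun y : (({i}ᶜ : Finset (Fin N)) → Space) =>
      ‖ψ (Function.updateFinset (fun _ => x) {i}ᶜ y + Pi.single i h)‖ₑ := fun i =>
    (hψ.comp (measurable_add_const _)).enorm.comp (hu i)
  have m3 : ∀ i : Fin N, Measurable fun y : (({i}ᶜ : Finset (Fin N)) → Space) =>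
      ‖ψ (Function.updateFinset (fun _ => x) {i}ᶜ y + Pi.single i h) -
        ψ (Function.updateFinset (fun _ => x) {i}ᶜ y)‖ₑ := fun i =>
    (measurable_translate_sub ψ _).comp (hu i)
  constructor
  · refine rpow_half_sum_le fun i => ?_
    simp only [lmarginal]
    refine rpow_half_lintegral_le (m1 i) (m3 i) fun y => ?_
    exact (enorm_le_add_enorm_sub _ _).1
  · refine rpow_half_sum_le fun i => ?_
    simp only [lmarginal]
    refine rpow_half_lintegral_le (m2 i) (m3 i) fun y => ?_
    exact (enorm_le_add_enorm_sub _ _).2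

/-- The square root of the density. -/
def sqrtDensity {N : ℕ} (ψ : WaveFun N) (x : Space) : ℝ := √(density ψ x).toReal

theorem measurable_sqrtDensity {N : ℕ} (ψ : WaveFun N) : Measurable (sqrtDensity ψ) :=
  (measurable_density ψ).ennreal_toReal.sqrt

theorem sqrtDensity_nonneg {N : ℕ} (ψ : WaveFun N) (x : Space) : 0 ≤ sqrtDensity ψ x :=
  sqrt_nonneg _

theorem ofReal_sqrtDensity_sq {N : ℕ} {ψ : WaveFun N} {x : Space} (hx : density ψ x < ⊤) :
    ENNReal.ofReal (sqrtDensity ψ x ^ 2) = density ψ x := by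
  rw [sqrtDensity, sq_sqrt ENNReal.toReal_nonneg, ENNReal.ofReal_toReal hx.ne]

theorem sqrtDensity_eq {N : ℕ} (ψ : WaveFun N) (x : Space) :
    sqrtDensity ψ x = (density ψ x ^ (1 / 2 : ℝ)).toReal := by
  rw [sqrtDensity, ← ENNReal.toReal_rpow, sqrt_eq_rpow]

theorem sqrtDensity_sub_sq_le {N : ℕ} {ψ : WaveFun N} {x h : Space} (hx : density ψ x < ⊤)
    (hxh : density ψ (x + h) < ⊤) :
    ENNReal.ofReal ((sqrtDensity ψ (x + h) - sqrtDensity ψ x) ^ 2) ≤ translationDefect ψ h x := by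
  by_cases hD : translationDefect ψ h x = ⊤
  · rw [hD]
    exact le_top
  obtain ⟨h1, h2⟩ := rpow_half_density_le ψ x h
  have f1 : density ψ x ^ (1 / 2 : ℝ) ≠ ⊤ := ENNReal.rpow_ne_top_of_nonneg (by norm_num) hx.ne
  have f2 : density ψ (x + h) ^ (1 / 2 : ℝ) ≠ ⊤ := ENNReal.rpow_ne_top_of_nonneg (by norm_num) hxh.ne
  have f3 : translationDefect ψ h x ^ (1 / 2 : ℝ) ≠ ⊤ :=
    ENNReal.rpow_ne_top_of_nonneg (by norm_num) hD
  have g1 := ENNReal.toReal_mono (ENNReal.add_ne_top.2 ⟨f1, f3⟩) h1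
  have g2 := ENNReal.toReal_mono (ENNReal.add_ne_top.2 ⟨f2, f3⟩) h2
  rw [ENNReal.toReal_add f1 f3] at g1
  rw [ENNReal.toReal_add f2 f3] at g2
  rw [← sqrtDensity_eq, ← sqrtDensity_eq, ← ENNReal.toReal_rpow, ← sqrt_eq_rpow] at g1 g2
  rw [← ENNReal.ofReal_toReal hD]
  apply ENNReal.ofReal_le_ofReal
  rw [← sq_sqrt (ENNReal.toReal_nonneg (a := translationDefect ψ h x))]
  exact sq_le_sq' (by linarith) (by linarith)

/-- A finite-difference form of `∫ |∇√ρ|² ≤ ∑ᵢ ∫ |∇ᵢψ|²`, which requires no weak derivative of `√ρ`.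
-/
theorem lintegral_sqrtDensity_sub_sq_le {N : ℕ} {ψ : WaveFun N} (hψ : ‖ψ‖ = 1) (hH1 : MemH1 ψ)
    (h : Space) :
    ∫⁻ x, ENNReal.ofReal ((sqrtDensity ψ (x + h) - sqrtDensity ψ x) ^ 2) ≤
      ∑ i : Fin N, ∫⁻ X, ‖∑ k, h k • weakPartial ψ i k X‖ₑ ^ 2 := by
  have hw : ∀ i k, IsWeakPartial ψ i k (weakPartial ψ i k) := by
    intro i k
    rw [weakPartial, dif_pos (hH1 i k)]
    exact (hH1 i k).choose_spec
  calc _ ≤ ∫⁻ x, translationDefect ψ h x := by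
        refine lintegral_mono_ae ?_
        have h1 := density_lt_top_ae hψ
        have h2 := (measurePreserving_add_right volume h).quasiMeasurePreserving.ae h1
        filter_upwards [h1, h2] with x hx hxh using sqrtDensity_sub_sq_le hx hxh
    _ ≤ _ := by
        rw [lintegral_translationDefect]
        exact Finset.sum_le_sum fun i _ => lintegral_translate_sub_le (hw i) h

/-- Real and imaginary parts of `z` are two real vectors; each contributes a second moment of the
heat kernel. -/
theorem lintegral_heatKernelE_mul_norm_sum_sq_le {t : ℝ} (ht : 0 < t) (z : Fin 3 → ℂ) :
    ∫⁻ h : Space, heatKernelE t h * ‖∑ k, h k • z k‖ₑ ^ 2 ≤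
      ENNReal.ofReal (2 * t) * ∑ k, ‖z k‖ₑ ^ 2 := by
  let a : Space := WithLp.toLp 2 fun k => (z k).re
  let b : Space := WithLp.toLp 2 fun k => (z k).im
  have e1 : ∀ h : Space, heatKernelE t h * ‖∑ k, h k • z k‖ₑ ^ 2 =
      ENNReal.ofReal (heatKernel t h * (inner ℝ a h) ^ 2) +
        ENNReal.ofReal (heatKernel t h * (inner ℝ b h) ^ 2) := by
    intro h
    have hk := heatKernel_nonneg ht.le h
    rw [heatKernelE, ← ofReal_norm, ← ENNReal.ofReal_pow (norm_nonneg _), ← ENNReal.ofReal_mul hk,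
      ← ENNReal.ofReal_add (by positivity) (by positivity), ← mul_add, ← Complex.normSq_eq_norm_sq,
      Complex.normSq_apply]
    simp only [PiLp.inner_apply, a, b, Complex.re_sum, Complex.im_sum, Complex.real_smul]
    simp [sq]
  have e2 : ∑ k, ‖z k‖ₑ ^ 2 = ENNReal.ofReal (‖a‖ ^ 2 + ‖b‖ ^ 2) := by
    rw [EuclideanSpace.norm_sq_eq, EuclideanSpace.norm_sq_eq, ← Finset.sum_add_distrib,
      ENNReal.ofReal_sum_of_nonneg fun k _ => by positivity]
    refine Finset.sum_congr rfl fun k _ => ?_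
    rw [← ofReal_norm, ← ENNReal.ofReal_pow (norm_nonneg _), ← Complex.normSq_eq_norm_sq,
      Complex.normSq_apply]
    simp [a, b, sq]
  simp_rw [e1]
  rw [lintegral_add_left, e2, ← ENNReal.ofReal_mul (by positivity), mul_add,
    ENNReal.ofReal_add (by positivity) (by positivity)]
  · exact add_le_add (lintegral_heatKernel_mul_inner_sq_le ht a)
      (lintegral_heatKernel_mul_inner_sq_le ht b)
  · refine Measurable.ennreal_ofReal ?_
    fun_prop

/-- The kinetic energy controls the translates of `√ρ`, averaged over the heat kernel. -/
theorem lintegral_heatKernelE_mul_sqrtDensity_sub_sq_le {N : ℕ} {ψ : WaveFun N} (hψ : ‖ψ‖ = 1)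
    (hH1 : MemH1 ψ) {t : ℝ} (ht : 0 < t) :
    ∫⁻ h, heatKernelE t h *
      ∫⁻ x, ENNReal.ofReal ((sqrtDensity ψ (x + h) - sqrtDensity ψ x) ^ 2) ≤
      ENNReal.ofReal (2 * t) * kinetic ψ := by
  have hm : ∀ i k, Measurable fun X => weakPartial ψ i k X := fun i k =>
    (Lp.stronglyMeasurable (weakPartial ψ i k)).measurable
  have hm2 : ∀ i, Measurable fun q : Space × Config N =>
      heatKernelE t q.1 * ‖∑ k, q.1 k • weakPartial ψ i k q.2‖ₑ ^ 2 := by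
    intro i
    refine Measurable.mul (by fun_prop) (Measurable.pow_const (Measurable.enorm ?_) 2)
    refine Finset.measurable_fun_sum _ fun k _ => ?_
    have h1 : Measurable fun q : Space × Config N => q.1 k := by fun_prop
    exact h1.smul ((hm i k).comp measurable_snd)
  calc _ ≤ ∫⁻ h, ∑ i : Fin N, ∫⁻ X, heatKernelE t h * ‖∑ k, h k • weakPartial ψ i k X‖ₑ ^ 2 := by
        refine lintegral_mono fun h => ?_
        simp only
        refine (mul_le_mul_right (lintegral_sqrtDensity_sub_sq_le hψ hH1 h) _).trans (le_of_eq ?_)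
        rw [Finset.mul_sum]
        refine Finset.sum_congr rfl fun i _ => ?_
        rw [lintegral_const_mul' _ _ (by rw [heatKernelE]; exact ENNReal.ofReal_ne_top)]
    _ = ∑ i : Fin N, ∫⁻ X, ∫⁻ h : Space, heatKernelE t h * ‖∑ k, h k • weakPartial ψ i k X‖ₑ ^ 2 := by
        rw [lintegral_finsetSum _ fun i _ => (hm2 i).lintegral_prod_right']
        refine Finset.sum_congr rfl fun i _ => ?_
        rw [lintegral_lintegral_swap (hm2 i).aemeasurable]
    _ ≤ ∑ i : Fin N, ∫⁻ X, ENNReal.ofReal (2 * t) * ∑ k, ‖weakPartial ψ i k X‖ₑ ^ 2 :=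
        Finset.sum_le_sum fun i _ => lintegral_mono fun X =>
          lintegral_heatKernelE_mul_norm_sum_sq_le ht _
    _ = _ := by
        rw [kinetic, Finset.mul_sum]
        refine Finset.sum_congr rfl fun i _ => ?_
        rw [lintegral_const_mul' _ _ ENNReal.ofReal_ne_top,
          lintegral_finsetSum _ fun k _ => (hm i k).enorm.pow_const 2]

theorem lintegral_sqrtDensity_sub_sq_single_le {N : ℕ} {ψ : WaveFun N} (hψ : ‖ψ‖ = 1)
    (hH1 : MemH1 ψ) (k : Fin 3) (s : ℝ) :
    ∫⁻ x, ENNReal.ofReal ((sqrtDensity ψ (x + EuclideanSpace.single k s) - sqrtDensity ψ x) ^ 2) ≤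
      ENNReal.ofReal (s ^ 2) * kinetic ψ := by
  refine (lintegral_sqrtDensity_sub_sq_le hψ hH1 _).trans ?_
  rw [kinetic, Finset.mul_sum]
  refine Finset.sum_le_sum fun i _ => ?_
  refine le_trans (le_of_eq ?_) (mul_le_mul_right (Finset.single_le_sum
    (f := fun k => ∫⁻ X, ‖weakPartial ψ i k X‖ₑ ^ 2) (fun _ _ => zero_le) (Finset.mem_univ k)) _)
  rw [← lintegral_const_mul' _ _ ENNReal.ofReal_ne_top]
  refine lintegral_congr fun X => ?_
  have : ∑ j, (EuclideanSpace.single k s : Space) j • weakPartial ψ i j X = s • weakPartial ψ i k X := by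
    simp
  rw [this, enorm_smul, mul_pow, ← ofReal_norm, ← ENNReal.ofReal_pow (norm_nonneg _), norm_eq_abs,
    sq_abs]

/-- No Sobolev assumption is needed: `weakPartial` is an element of `L²` by construction, with
default value `0`. -/
theorem kinetic_lt_top {N : ℕ} (ψ : WaveFun N) : kinetic ψ < ⊤ := by
  refine ENNReal.sum_lt_top.2 fun i _ => ENNReal.sum_lt_top.2 fun k _ => ?_
  rw [lintegral_enorm_sq]
  simp [enorm_lt_top]

/-! ### The quadratic form of the heat semigroup -/

/-- The form `∬ f(x) p_t(x - y) g(y) dx dy` of the heat semigroup. -/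
def heatForm (t : ℝ) (f g : Space → ℝ) : ℝ :=
  ∫ q : Space × Space, f q.1 * heatKernel t (q.1 - q.2) * g q.2

/-- The heat flow. -/
def heatFlow (t : ℝ) (f : Space → ℝ) (z : Space) : ℝ := ∫ x, heatKernel t (x - z) * f x

theorem integrable_heatForm {t : ℝ} (ht : 0 < t) {f g : Space → ℝ} (hf : Integrable f)
    (hg : Integrable g) :
    Integrable fun q : Space × Space => f q.1 * heatKernel t (q.1 - q.2) * g q.2 := by
  have h := (hf.mul_prod hg).bdd_mul (f := fun q : Space × Space => heatKernel t (q.1 - q.2))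
    (c := (4 * π * t) ^ (-(3 / 2) : ℝ)) (Measurable.aestronglyMeasurable (by fun_prop))
    (Eventually.of_forall fun q => by
      rw [norm_eq_abs, abs_of_nonneg (heatKernel_nonneg ht.le _)]
      exact heatKernel_le ht.le _)
  refine h.congr (Eventually.of_forall fun q => ?_)
  simp only
  ring

theorem heatForm_nonneg {t : ℝ} (ht : 0 < t) {f g : Space → ℝ} (hf : ∀ x, 0 ≤ f x)
    (hg : ∀ x, 0 ≤ g x) : 0 ≤ heatForm t f g :=
  integral_nonneg fun _ => mul_nonneg (mul_nonneg (hf _) (heatKernel_nonneg ht.le _)) (hg _)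

theorem heatForm_le {t : ℝ} (ht : 0 < t) {f g : Space → ℝ} (hf : Integrable f)
    (hg : Integrable g) (hf0 : ∀ x, 0 ≤ f x) (hg0 : ∀ x, 0 ≤ g x) :
    heatForm t f g ≤ (4 * π * t) ^ (-(3 / 2) : ℝ) * ((∫ x, f x) * ∫ x, g x) := by
  rw [← integral_prod_mul, ← integral_const_mul]
  refine integral_mono (integrable_heatForm ht hf hg) ((hf.mul_prod hg).const_mul _) fun q => ?_
  have := mul_le_mul_of_nonneg_right (heatKernel_le ht.le (q.1 - q.2)) (mul_nonneg (hf0 q.1) (hg0 q.2))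
  simp only
  linarith

/-- This turns pointwise inequalities between squares of heat flows into inequalities between heat
forms. -/
theorem heatFlow_mul_heatFlow {s t : ℝ} (hs : 0 < s) (ht : 0 < t) {f g : Space → ℝ}
    (hf : Integrable f) (hg : Integrable g) :
    Integrable (fun z => heatFlow s f z * heatFlow t g z) ∧
      ∫ z, heatFlow s f z * heatFlow t g z = heatForm (s + t) f g := by
  let F : Space × (Space × Space) → ℝ := fun w =>
    (heatKernel s (w.2.1 - w.1) * f w.2.1) * (heatKernel t (w.2.2 - w.1) * g w.2.2)
  have hFm : AEStronglyMeasurable F (volume.prod (volume.prod volume)) := by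
    have h1 : AEStronglyMeasurable (fun w : Space × (Space × Space) => f w.2.1)
        (volume.prod (volume.prod volume)) := hf.1.comp_fst.comp_snd
    have h2 : AEStronglyMeasurable (fun w : Space × (Space × Space) => g w.2.2)
        (volume.prod (volume.prod volume)) := hg.1.comp_snd.comp_snd
    exact ((Measurable.aestronglyMeasurable (by fun_prop)).mul h1).mul
      ((Measurable.aestronglyMeasurable (by fun_prop)).mul h2)
  have hz : ∀ q : Space × Space, Integrable (fun z => F (z, q)) ∧
      ∫ z, F (z, q) = f q.1 * heatKernel (s + t) (q.1 - q.2) * g q.2 := by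
    intro q
    obtain ⟨h1, h2⟩ := integral_heatKernel_mul_heatKernel hs ht q.1 q.2
    have e : (fun z => F (z, q)) = fun z =>
        (f q.1 * g q.2) * (heatKernel s (q.1 - z) * heatKernel t (z - q.2)) := by
      ext z
      simp only [F, heatKernel_sub_comm t q.2 z]
      ring
    rw [e, integral_const_mul, h2]
    exact ⟨h1.const_mul _, by ring⟩
  have hn : ∀ q : Space × Space, ∫ z, ‖F (z, q)‖ = ‖f q.1 * heatKernel (s + t) (q.1 - q.2) * g q.2‖ := by
    intro q
    obtain ⟨h1, h2⟩ := integral_heatKernel_mul_heatKernel hs ht q.1 q.2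
    have e : (fun z => ‖F (z, q)‖) = fun z =>
        (|f q.1| * |g q.2|) * (heatKernel s (q.1 - z) * heatKernel t (z - q.2)) := by
      ext z
      simp only [F, heatKernel_sub_comm t q.2 z, norm_eq_abs, abs_mul,
        abs_of_nonneg (heatKernel_nonneg hs.le _), abs_of_nonneg (heatKernel_nonneg ht.le _)]
      ring
    rw [e, integral_const_mul, h2, norm_eq_abs, abs_mul, abs_mul,
      abs_of_nonneg (heatKernel_nonneg (add_pos hs ht).le _)]
    ring
  have hF : Integrable F (volume.prod (volume.prod volume)) := by
    rw [integrable_prod_iff' hFm]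
    refine ⟨Eventually.of_forall fun q => (hz q).1, ?_⟩
    simp_rw [hn]
    exact (integrable_heatForm (add_pos hs ht) hf hg).norm
  have e : ∀ z, ∫ q, F (z, q) ∂(volume.prod volume) = heatFlow s f z * heatFlow t g z := fun z =>
    integral_prod_mul (fun x => heatKernel s (x - z) * f x) (fun x => heatKernel t (x - z) * g x)
  constructor
  · have := hF.integral_prod_left
    simpa only [e] using this
  · simp_rw [← e]
    rw [integral_integral_swap hF, heatForm, Measure.volume_eq_prod]
    exact integral_congr_ae (Eventually.of_forall fun q => (hz q).2)

theorem mul_heatFlow {t : ℝ} (ht : 0 < t) {f g : Space → ℝ} (hf : Integrable f)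
    (hg : Integrable g) :
    Integrable (fun z => f z * heatFlow t g z) ∧ ∫ z, f z * heatFlow t g z = heatForm t f g := by
  have h := integrable_heatForm ht hf hg
  have e : ∀ z, ∫ y, f z * heatKernel t (z - y) * g y = f z * heatFlow t g z := by
    intro z
    rw [heatFlow, ← integral_const_mul]
    refine integral_congr_ae (Eventually.of_forall fun y => ?_)
    simp only [heatKernel_sub_comm t z y]
    ring
  rw [Measure.volume_eq_prod] at h
  constructor
  · have := h.integral_prod_left
    simpa only [e] using this
  · rw [heatForm, Measure.volume_eq_prod, integral_prod _ h]
    simp_rw [e]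

/-- Midpoint convexity in time of the quadratic form: integrate `(P_a f - P_b f)² ≥ 0`, where `P`
denotes the heat flow. -/
theorem two_mul_heatForm_add_le {a b : ℝ} (ha : 0 < a) (hb : 0 < b) {f : Space → ℝ}
    (hf : Integrable f) :
    2 * heatForm (a + b) f f ≤ heatForm (a + a) f f + heatForm (b + b) f f := by
  obtain ⟨i1, e1⟩ := heatFlow_mul_heatFlow ha ha hf hf
  obtain ⟨i2, e2⟩ := heatFlow_mul_heatFlow ha hb hf hf
  obtain ⟨i3, e3⟩ := heatFlow_mul_heatFlow hb hb hf hf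
  rw [← e1, ← e2, ← e3, ← integral_const_mul, ← integral_add i1 i3]
  refine integral_mono (i2.const_mul 2) (i1.add i3) fun z => ?_
  simp only
  nlinarith [sq_nonneg (heatFlow a f z - heatFlow b f z)]

/-- Integrate `(c P_a g - (P_a f - P_{a+h} f))² ≥ 0`. The terms in `f` alone form a second
difference in time, which telescopes when summed. -/
theorem two_mul_heatForm_sub_le {a h c : ℝ} (ha : 0 < a) (hh : 0 < h)
    {f g : Space → ℝ} (hf : Integrable f) (hg : Integrable g) :
    2 * c * (heatForm (a + a) g f - heatForm (a + (a + h)) g f) ≤ c ^ 2 * heatForm (a + a) g g +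
      (heatForm (a + a) f f - 2 * heatForm (a + (a + h)) f f +
        heatForm ((a + h) + (a + h)) f f) := by
  have hah := add_pos ha hh
  obtain ⟨i1, e1⟩ := heatFlow_mul_heatFlow ha ha hg hf
  obtain ⟨i2, e2⟩ := heatFlow_mul_heatFlow ha hah hg hf
  obtain ⟨i3, e3⟩ := heatFlow_mul_heatFlow ha ha hg hg
  obtain ⟨i4, e4⟩ := heatFlow_mul_heatFlow ha ha hf hf
  obtain ⟨i5, e5⟩ := heatFlow_mul_heatFlow ha hah hf hf
  obtain ⟨i6, e6⟩ := heatFlow_mul_heatFlow hah hah hf hf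
  have j1 := (i1.sub i2).const_mul (2 * c)
  have j2 := (i3.const_mul (c ^ 2)).add ((i4.sub (i5.const_mul 2)).add i6)
  have hm := integral_mono j1 j2 fun z => by
    simp only [Pi.add_apply, Pi.sub_apply]
    nlinarith [sq_nonneg (c * heatFlow a g z - (heatFlow a f z - heatFlow (a + h) f z))]
  rw [integral_const_mul, integral_sub' i1 i2, integral_add' (i3.const_mul (c ^ 2)) ((i4.sub (i5.const_mul 2)).add i6),
    integral_add' (i4.sub (i5.const_mul 2)) i6, integral_sub' i4 (i5.const_mul 2), integral_const_mul,
    integral_const_mul, e1, e2, e3, e4, e5, e6] at hm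
  linarith

/-- The analogue at initial time `0`, from `(η g - (f - P_t f))² ≥ 0`. It measures the cost of
replacing `∫ g f` by its smoothed version. -/
theorem two_mul_integral_sub_heatForm_le {t η : ℝ} (ht : 0 < t)
    {f g : Space → ℝ} (hf : Integrable f) (hg : Integrable g) (hf2 : Integrable fun x => f x ^ 2)
    (hg2 : Integrable fun x => g x ^ 2) (hfg : Integrable fun x => g x * f x) :
    2 * η * ((∫ x, g x * f x) - heatForm t g f) ≤ η ^ 2 * (∫ x, g x ^ 2) +
      ((∫ x, f x ^ 2) - 2 * heatForm t f f + heatForm (t + t) f f) := by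
  obtain ⟨i1, e1⟩ := mul_heatFlow ht hg hf
  obtain ⟨i2, e2⟩ := mul_heatFlow ht hf hf
  obtain ⟨i3, e3⟩ := heatFlow_mul_heatFlow ht ht hf hf
  have j1 := (hfg.sub i1).const_mul (2 * η)
  have j2 := (hg2.const_mul (η ^ 2)).add ((hf2.sub (i2.const_mul 2)).add i3)
  have hm := integral_mono j1 j2 fun z => by
    simp only [Pi.add_apply, Pi.sub_apply]
    nlinarith [sq_nonneg (η * g z - (f z - heatFlow t f z))]
  rw [integral_const_mul, integral_sub' hfg i1, integral_add' (hg2.const_mul (η ^ 2)) ((hf2.sub (i2.const_mul 2)).add i3),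
    integral_add' (hf2.sub (i2.const_mul 2)) i3, integral_sub' hf2 (i2.const_mul 2), integral_const_mul,
    integral_const_mul, e1, e2, e3] at hm
  linarith

theorem tendsto_heatForm_atTop {f g : Space → ℝ} (hf : Integrable f)
    (hg : Integrable g) (hf0 : ∀ x, 0 ≤ f x) (hg0 : ∀ x, 0 ≤ g x) {a h : ℝ} (ha : 0 < a)
    (hh : 0 < h) :
    Tendsto (fun n : ℕ => heatForm (a + n * h) f g) atTop (𝓝 0) := by
  have hpos : ∀ n : ℕ, 0 < a + n * h := fun n => by positivity
  refine squeeze_zero (fun n => heatForm_nonneg (hpos n) hf0 hg0)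
    (fun n => heatForm_le (hpos n) hf hg hf0 hg0) ?_
  rw [← zero_mul ((∫ x, f x) * ∫ x, g x)]
  refine Tendsto.mul_const _ ?_
  refine (tendsto_rpow_neg_atTop (by norm_num : (0 : ℝ) < 3 / 2)).comp ?_
  refine Tendsto.const_mul_atTop (by positivity) ?_
  exact tendsto_atTop_add_const_left _ _ (tendsto_natCast_atTop_atTop.atTop_mul_const hh)

/-- The quadratic form of the heat semigroup decreases in time. -/
theorem heatForm_self_anti {f : Space → ℝ} (hf : Integrable f) (hf0 : ∀ x, 0 ≤ f x) {a b : ℝ}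
    (ha : 0 < a) (hab : a ≤ b) : heatForm b f f ≤ heatForm a f f := by
  rcases hab.eq_or_lt with rfl | hab
  · exact le_rfl
  set d := b - a with hd
  have hdpos : 0 < d := sub_pos.2 hab
  let u : ℕ → ℝ := fun n => heatForm (a + n * d) f f
  have hconv : ∀ n, u (n + 1) - u (n + 2) ≤ u n - u (n + 1) := by
    intro n
    have h := two_mul_heatForm_add_le (a := (a + n * d) / 2) (b := (a + (n + 2) * d) / 2)
      (by positivity) (by positivity) hf
    have e1 : (a + n * d) / 2 + (a + (n + 2) * d) / 2 = a + (n + 1 : ℕ) * d := by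
      push_cast
      ring
    have e2 : (a + (n + 2) * d) / 2 + (a + (n + 2) * d) / 2 = a + (n + 2 : ℕ) * d := by
      push_cast
      ring
    rw [e1, e2, add_halves] at h
    simp only [u]
    linarith
  -- By convexity the decrements decrease; since they tend to `0`, they are all non-negative.
  have hanti : Antitone fun n => u n - u (n + 1) := antitone_nat_of_succ_le hconv
  have hlim := tendsto_heatForm_atTop hf hf hf0 hf0 ha hdpos
  have hlim2 : Tendsto (fun n => u n - u (n + 1)) atTop (𝓝 0) := by
    have := hlim.sub (hlim.comp (tendsto_add_atTop_nat 1))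
    simpa [u] using this
  have h0 := hanti.le_of_tendsto hlim2 0
  simp only [u] at h0
  norm_num at h0
  rw [hd] at h0
  simpa using h0

/-- The Coulomb energy bounds the Riemann sums of the heat form. -/
theorem sum_heatForm_le {g : Space → ℝ} (hgm : Measurable g) (hg : Integrable g)
    (hg0 : ∀ x, 0 ≤ g x) {D : ℝ}
    (hD0 : 0 ≤ D) (hD : coulomb (fun x => ENNReal.ofReal (g x)) ≤ ENNReal.ofReal D) {h : ℝ}
    (hh : 0 < h) (M : ℕ) :
    ∑ n ∈ Finset.range M, h * heatForm (h + n * h) g g ≤ D / (4 * π) := by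
  have hpos : ∀ n : ℕ, 0 < h + n * h := fun n => by positivity
  have h1 : ENNReal.ofReal (4 * π) * ∫⁻ τ in Ioi 0, ENNReal.ofReal (heatForm τ g g) ≤
      ENNReal.ofReal D := by
    refine le_trans ?_ hD
    have e : ∀ τ ∈ Ioi (0 : ℝ), ENNReal.ofReal (heatForm τ g g) =
        ∫⁻ x, ∫⁻ y, ENNReal.ofReal (g x) * ENNReal.ofReal (g y) * heatKernelE τ (x - y) := by
      intro τ hτ
      have hτ0 : 0 < τ := hτ
      rw [heatForm, ofReal_integral_eq_lintegral_ofReal (integrable_heatForm hτ0 hg hg)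
        (Eventually.of_forall fun q => mul_nonneg (mul_nonneg (hg0 _)
          (heatKernel_nonneg hτ0.le _)) (hg0 _)), Measure.volume_eq_prod,
        lintegral_prod _ (Measurable.aemeasurable (by fun_prop))]
      refine lintegral_congr fun x => lintegral_congr fun y => ?_
      simp only
      rw [ENNReal.ofReal_mul (mul_nonneg (hg0 _) (heatKernel_nonneg hτ0.le _)),
        ENNReal.ofReal_mul (hg0 _), heatKernelE]
      ring
    rw [setLIntegral_congr_fun measurableSet_Ioi e, lintegral_lintegral_swap]
    · rw [coulomb, ← lintegral_const_mul' _ _ ENNReal.ofReal_ne_top]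
      refine lintegral_mono fun x => ?_
      simp only
      rw [lintegral_lintegral_swap, ← lintegral_const_mul' _ _ ENNReal.ofReal_ne_top]
      · refine lintegral_mono fun y => ?_
        simp only
        rw [lintegral_const_mul _ (by fun_prop), mul_left_comm, div_eq_mul_inv, ← one_div]
        gcongr
        exact lintegral_heatKernelE_time_le _
      · exact Measurable.aemeasurable (by simp only [Function.uncurry_def]; fun_prop)
    · refine Measurable.aemeasurable ?_
      simp only [Function.uncurry_def]
      refine Measurable.lintegral_prod_right' (f := fun q : (ℝ × Space) × Space =>
        ENNReal.ofReal (g q.1.2) * ENNReal.ofReal (g q.2) * heatKernelE q.1.1 (q.1.2 - q.2)) ?_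
      fun_prop
  -- The form decreases in time, so its value at the right endpoint `h + n * h` of a cell, times the
  -- cell length, is at most the integral over the cell.
  have h2 : ∑ n ∈ Finset.range M, ENNReal.ofReal (h * heatForm (h + n * h) g g) ≤
      ∫⁻ τ in Ioi 0, ENNReal.ofReal (heatForm τ g g) := by
    have hdisj : Pairwise (Function.onFun Disjoint fun n : ℕ => Ioc (n * h) ((n + 1 : ℕ) * h)) := by
      have hmono : Monotone fun n : ℕ => (n : ℝ) * h := fun a b hab => by
        simp only
        gcongr
      simpa using hmono.pairwise_disjoint_on_Ioc_succ
    calc _ ≤ ∑ n ∈ Finset.range M, ∫⁻ τ in Ioc (n * h) ((n + 1 : ℕ) * h), ENNReal.ofReal (heatForm τ g g) := by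
          refine Finset.sum_le_sum fun n _ => ?_
          calc _ = ∫⁻ τ in Ioc (n * h) ((n + 1 : ℕ) * h), ENNReal.ofReal (heatForm (h + n * h) g g) := by
                rw [setLIntegral_const, Real.volume_Ioc, mul_comm h, ENNReal.ofReal_mul
                  (heatForm_nonneg (hpos n) hg0 hg0)]
                congr 2
                push_cast
                ring
            _ ≤ _ := by
                refine setLIntegral_mono_ae' measurableSet_Ioc (Eventually.of_forall fun τ hτ => ?_)
                apply ENNReal.ofReal_le_ofReal
                refine heatForm_self_anti hg hg0 (lt_of_le_of_lt (by positivity) hτ.1) ?_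
                have := hτ.2
                push_cast at this
                linarith
      _ = ∫⁻ τ in ⋃ n ∈ Finset.range M, Ioc (n * h) ((n + 1 : ℕ) * h), ENNReal.ofReal (heatForm τ g g) := by
          rw [lintegral_biUnion_finset (fun a _ b _ hab => hdisj hab) fun _ _ => measurableSet_Ioc]
      _ ≤ _ := by
          refine lintegral_mono_set ?_
          intro τ hτ
          simp only [mem_iUnion] at hτ
          obtain ⟨n, _, hn⟩ := hτ
          exact lt_of_le_of_lt (by positivity) hn.1
  have h3 : ENNReal.ofReal (4 * π * ∑ n ∈ Finset.range M, h * heatForm (h + n * h) g g) ≤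
      ENNReal.ofReal D := by
    rw [ENNReal.ofReal_mul (by positivity), ENNReal.ofReal_sum_of_nonneg fun n _ =>
      mul_nonneg hh.le (heatForm_nonneg (hpos n) hg0 hg0)]
    exact (mul_le_mul_right h2 _).trans h1
  rw [ENNReal.ofReal_le_ofReal_iff hD0] at h3
  rw [le_div_iff₀ (by positivity)]
  linarith

/-! ### The kinetic energy and the Coulomb energy control `∫ ρ^{3/2}` -/

section HeatFormBound

variable {f g : Space → ℝ} {T D c : ℝ}

/-- A discrete form of the Cauchy–Schwarz argument between `∇Φ` and `∇f`. Write `heatForm t g f` as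
the sum of its decrements over time steps `t` and estimate each decrement by a square. The `g`-terms
form a Riemann sum for `D / (4π)`; the `f`-terms telescope down to a first decrement, bounded by `t
* T`. The choice `k = t c / 2` gives the stated constants after division by `t`. -/
theorem mul_heatForm_le (hgm : Measurable g) (hf : Integrable f)
    (hg : Integrable g) (hf2 : Integrable fun x => f x ^ 2)
    (hf0 : ∀ x, 0 ≤ f x) (hg0 : ∀ x, 0 ≤ g x)
    (hfT : ∀ t, 0 < t → (∫ x, f x ^ 2) - heatForm t f f ≤ t * T)
    (hD0 : 0 ≤ D) (hD : coulomb (fun x => ENNReal.ofReal (g x)) ≤ ENNReal.ofReal D)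
    {t : ℝ} (ht : 0 < t) :
    c * heatForm t g f ≤ c ^ 2 * D / (16 * π) + T := by
  let u : ℕ → ℝ := fun n => heatForm (t + n * t) f f
  let w : ℕ → ℝ := fun n => heatForm (t + n * t) g f
  let k : ℝ := t * (c / 2)
  have hstep : ∀ n : ℕ, 2 * k * (w n - w (n + 1)) ≤ k ^ 2 * heatForm (t + n * t) g g +
      ((u n - u (n + 1)) - (u (n + 1) - u (n + 2))) := by
    intro n
    have h := two_mul_heatForm_sub_le (c := k) (a := (t + n * t) / 2) (h := t) (by positivity) ht hf hg
    have e1 : (t + n * t) / 2 + ((t + n * t) / 2 + t) = t + (n + 1 : ℕ) * t := by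
      push_cast
      ring
    have e2 : ((t + n * t) / 2 + t) + ((t + n * t) / 2 + t) = t + (n + 2 : ℕ) * t := by
      push_cast
      ring
    rw [e1, e2, add_halves] at h
    simp only [u, w]
    linarith
  -- With `η = 0` the inequality reads `∫ f² - 2 u 0 + u 1 ≥ 0`, hence `u 0 - u 1 ≤ ∫ f² - u 0`.
  have h01 : u 0 - u 1 ≤ t * T := by
    have h := two_mul_integral_sub_heatForm_le (η := 0) ht hf hf hf2 hf2
      (by simpa only [sq] using hf2)
    have h' := hfT t ht
    simp only [u]
    norm_num at h ⊢
    linarith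
  have hM : ∀ M : ℕ, 2 * k * (w 0 - w M) ≤ k ^ 2 * (D / (4 * π) / t) + t * T := by
    intro M
    have hs := Finset.sum_le_sum fun n (_ : n ∈ Finset.range M) => hstep n
    rw [← Finset.mul_sum, Finset.sum_range_sub', Finset.sum_add_distrib, ← Finset.mul_sum,
      Finset.sum_range_sub' fun n => u n - u (n + 1)] at hs
    have h1 : 0 ≤ u M - u (M + 1) := by
      refine sub_nonneg.2 (heatForm_self_anti hf hf0 (by positivity) ?_)
      push_cast
      linarith
    have h2 := sum_heatForm_le hgm hg hg0 hD0 hD ht M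
    rw [← Finset.mul_sum, mul_comm, ← le_div_iff₀ ht] at h2
    have h3 := mul_le_mul_of_nonneg_left h2 (sq_nonneg k)
    norm_num at hs
    linarith
  have hlim : Tendsto (fun M => 2 * k * (w 0 - w M)) atTop (𝓝 (2 * k * (w 0 - 0))) :=
    ((tendsto_heatForm_atTop hg hf hg0 hf0 ht ht).const_sub (w 0)).const_mul (2 * k)
  have h := le_of_tendsto hlim (Eventually.of_forall hM)
  have e : w 0 = heatForm t g f := by simp [w]
  rw [sub_zero, e] at h
  simp only [k] at h
  have h4 : (t * (c / 2)) ^ 2 * (D / (4 * π) / t) = t * (c ^ 2 * D / (16 * π)) := by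
    field_simp
    ring
  rw [h4] at h
  have h5 : t * (c * heatForm t g f) ≤ t * (c ^ 2 * D / (16 * π) + T) := by linarith
  exact le_of_mul_le_mul_left h5 ht

theorem mul_integral_mul_le (hgm : Measurable g) (hf : Integrable f)
    (hg : Integrable g) (hf2 : Integrable fun x => f x ^ 2) (hg2 : Integrable fun x => g x ^ 2)
    (hfg : Integrable fun x => g x * f x)
    (hf0 : ∀ x, 0 ≤ f x) (hg0 : ∀ x, 0 ≤ g x)
    (hfT : ∀ t, 0 < t → (∫ x, f x ^ 2) - heatForm t f f ≤ t * T)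
    (hD0 : 0 ≤ D) (hD : coulomb (fun x => ENNReal.ofReal (g x)) ≤ ENNReal.ofReal D) (hc : 0 ≤ c) :
    c * ∫ x, g x * f x ≤ c ^ 2 * D / (16 * π) + T := by
  set G := ∫ x, g x ^ 2 with hG
  -- Smoothing for time `s²` with weight `η = s` makes both error terms of order `s²`; after
  -- division by `2s` the error vanishes as `s → 0`.
  have key : ∀ s : ℝ, 0 < s → c * ∫ x, g x * f x ≤
      c ^ 2 * D / (16 * π) + T + c * (s * (G + T) / 2) := by
    intro s hs
    have hs2 : 0 < s ^ 2 := by positivity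
    have h1 := mul_heatForm_le (c := c) hgm hf hg hf2 hf0 hg0 hfT hD0 hD hs2
    have h2 := two_mul_integral_sub_heatForm_le (η := s) hs2 hf hg hf2 hg2 hfg
    have h3 := hfT (s ^ 2) hs2
    have h4 : heatForm (s ^ 2 + s ^ 2) f f ≤ heatForm (s ^ 2) f f :=
      heatForm_self_anti hf hf0 hs2 (by linarith)
    have h5 : s * (2 * ((∫ x, g x * f x) - heatForm (s ^ 2) g f)) ≤ s * (s * (G + T)) := by linarith
    have h6 := le_of_mul_le_mul_left h5 hs
    nlinarith [mul_le_mul_of_nonneg_left h6 hc]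
  have hlim : Tendsto (fun s : ℝ => c ^ 2 * D / (16 * π) + T + c * (s * (G + T) / 2)) (𝓝[>] 0)
      (𝓝 (c ^ 2 * D / (16 * π) + T + c * (0 * (G + T) / 2))) := by
    refine Tendsto.mono_left (Continuous.tendsto ?_ 0) nhdsWithin_le_nhds
    fun_prop
  have h := ge_of_tendsto hlim (eventually_mem_nhdsWithin.mono key)
  simpa using h

/-- Because the heat kernel has integral `1`, expanding the square gives `∬ p_t(x - y) (f y - f x)²
= 2 (∫ f² - heatForm t f f)`. -/
theorem integral_sq_sub_heatForm_le (hfm : Measurable f) (hf : Integrable f)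
    (hf2 : Integrable fun x => f x ^ 2) (hT : 0 ≤ T) {t : ℝ} (ht : 0 < t)
    (h : ∫⁻ h, heatKernelE t h * ∫⁻ x, ENNReal.ofReal ((f (x + h) - f x) ^ 2) ≤
      ENNReal.ofReal (2 * t * T)) :
    (∫ x, f x ^ 2) - heatForm t f f ≤ t * T := by
  have hk := integrable_heatKernel ht
  have i0 := integrable_heatForm ht hf hf
  -- the two diagonal terms
  have m1 : Integrable (fun q : Space × Space => heatKernel t (q.1 - q.2) * f q.1 ^ 2)
      (volume.prod volume) := by
    rw [integrable_prod_iff (Measurable.aestronglyMeasurable (by fun_prop))]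
    refine ⟨Eventually.of_forall fun x => (hk.comp_sub_left x).mul_const (f x ^ 2), ?_⟩
    have : ∀ x, ∫ y, ‖heatKernel t (x - y) * f x ^ 2‖ = f x ^ 2 := by
      intro x
      simp_rw [norm_eq_abs, abs_mul, abs_of_nonneg (heatKernel_nonneg ht.le _), abs_sq]
      rw [integral_mul_const, integral_sub_left_eq_self (heatKernel t), integral_heatKernel ht, one_mul]
    simpa only [this] using hf2
  have e1 : ∫ q : Space × Space, heatKernel t (q.1 - q.2) * f q.1 ^ 2 ∂(volume.prod volume) =
      ∫ x, f x ^ 2 := by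
    rw [integral_prod _ m1]
    refine integral_congr_ae (Eventually.of_forall fun x => ?_)
    simp only
    rw [integral_mul_const, integral_sub_left_eq_self (heatKernel t), integral_heatKernel ht, one_mul]
  have m2 : Integrable (fun q : Space × Space => heatKernel t (q.1 - q.2) * f q.2 ^ 2)
      (volume.prod volume) := by
    refine m1.swap.congr (Eventually.of_forall fun q => ?_)
    simp [heatKernel_sub_comm t q.2 q.1]
  have e2 : ∫ q : Space × Space, heatKernel t (q.1 - q.2) * f q.2 ^ 2 ∂(volume.prod volume) =
      ∫ x, f x ^ 2 := by
    rw [← e1, ← integral_prod_swap]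
    refine integral_congr_ae (Eventually.of_forall fun q => ?_)
    simp [heatKernel_sub_comm t q.2 q.1]
  rw [Measure.volume_eq_prod] at i0
  have m12 : Integrable (fun q : Space × Space => heatKernel t (q.1 - q.2) * f q.1 ^ 2 +
      heatKernel t (q.1 - q.2) * f q.2 ^ 2) (volume.prod volume) := m1.add m2
  have m3 : Integrable (fun q : Space × Space => heatKernel t (q.1 - q.2) * (f q.2 - f q.1) ^ 2)
      (volume.prod volume) := by
    refine (m12.sub (i0.const_mul 2)).congr (Eventually.of_forall fun q => ?_)
    simp only [Pi.sub_apply]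
    ring
  have e3 : ∫ q : Space × Space, heatKernel t (q.1 - q.2) * (f q.2 - f q.1) ^ 2 ∂(volume.prod volume) =
      2 * ((∫ x, f x ^ 2) - heatForm t f f) := by
    have : ∫ q : Space × Space, heatKernel t (q.1 - q.2) * (f q.2 - f q.1) ^ 2 ∂(volume.prod volume) =
        (∫ q : Space × Space, heatKernel t (q.1 - q.2) * f q.1 ^ 2 ∂(volume.prod volume)) +
        (∫ q : Space × Space, heatKernel t (q.1 - q.2) * f q.2 ^ 2 ∂(volume.prod volume)) -
        2 * ∫ q : Space × Space, f q.1 * heatKernel t (q.1 - q.2) * f q.2 ∂(volume.prod volume) := by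
      rw [← integral_const_mul, ← integral_add m1 m2, ← integral_sub m12 (i0.const_mul 2)]
      refine integral_congr_ae (Eventually.of_forall fun q => ?_)
      ring
    rw [this, e1, e2, heatForm, Measure.volume_eq_prod]
    ring
  have h1 : ENNReal.ofReal (2 * ((∫ x, f x ^ 2) - heatForm t f f)) ≤ ENNReal.ofReal (2 * t * T) := by
    refine le_trans (le_of_eq ?_) h
    rw [← e3, ofReal_integral_eq_lintegral_ofReal m3 (Eventually.of_forall fun q =>
      mul_nonneg (heatKernel_nonneg ht.le _) (sq_nonneg _)),
      lintegral_prod _ (Measurable.aemeasurable (by fun_prop))]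
    have e4 : ∀ x, ∫⁻ y, ENNReal.ofReal (heatKernel t (x - y) * (f y - f x) ^ 2) =
        ∫⁻ h, heatKernelE t h * ENNReal.ofReal ((f (x + h) - f x) ^ 2) := by
      intro x
      rw [← lintegral_add_left_eq_self _ x]
      refine lintegral_congr fun h => ?_
      rw [heatKernel_sub_comm, add_sub_cancel_left, ENNReal.ofReal_mul (heatKernel_nonneg ht.le _),
        heatKernelE]
    simp only [e4]
    rw [lintegral_lintegral_swap (Measurable.aemeasurable (by
      simp only [Function.uncurry_def]
      fun_prop))]
    refine lintegral_congr fun h => ?_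
    rw [lintegral_const_mul _ (by fun_prop)]
  rw [ENNReal.ofReal_le_ofReal_iff (by positivity)] at h1
  linarith

end HeatFormBound

/-! ### From truncations to `√ρ`: the bound on `∫ ρ^{3/2}`. -/

theorem coulomb_mono {ρ σ : Space → ℝ≥0∞} (h : ∀ᵐ x, ρ x ≤ σ x) : coulomb ρ ≤ coulomb σ := by
  refine lintegral_mono_ae (h.mono fun x hx => lintegral_mono_ae (h.mono fun y hy => ?_))
  gcongr

theorem lintegral_ofReal_sqrtDensity_sq {N : ℕ} {ψ : WaveFun N} (hψ : ‖ψ‖ = 1) :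
    ∫⁻ x, ENNReal.ofReal (sqrtDensity ψ x ^ 2) = N := by
  rw [← lintegral_density hψ]
  exact lintegral_congr_ae ((density_lt_top_ae hψ).mono fun x hx => ofReal_sqrtDensity_sq hx)

theorem integrable_sqrtDensity_sq {N : ℕ} {ψ : WaveFun N} (hψ : ‖ψ‖ = 1) :
    Integrable fun x => sqrtDensity ψ x ^ 2 := by
  refine ⟨((measurable_sqrtDensity ψ).pow_const 2).aestronglyMeasurable, ?_⟩
  rw [hasFiniteIntegral_iff_ofReal (Eventually.of_forall fun x => sq_nonneg _),
    lintegral_ofReal_sqrtDensity_sq hψ]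
  exact ENNReal.natCast_lt_top N

/-- The kinetic energy and the Coulomb energy control `∫ ρ^{3/2}`. -/
theorem lintegral_sqrtDensity_pow_three_le {N : ℕ} {ψ : WaveFun N} (hψ : ‖ψ‖ = 1) (hH1 : MemH1 ψ)
    (hfin : coulomb (density ψ) ≠ ⊤) {c : ℝ} (hc : 0 < c) :
    ENNReal.ofReal c * ∫⁻ x, ENNReal.ofReal (sqrtDensity ψ x ^ 3) ≤
      ENNReal.ofReal (c ^ 2 / (16 * π)) * coulomb (density ψ) + kinetic ψ := by
  set φ := sqrtDensity ψ with hφ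
  have hφm : Measurable φ := measurable_sqrtDensity ψ
  have hφ0 : ∀ x, 0 ≤ φ x := sqrtDensity_nonneg ψ
  have hφ2 : Integrable fun x => φ x ^ 2 := integrable_sqrtDensity_sq hψ
  set D := (coulomb (density ψ)).toReal with hD
  set T := (kinetic ψ).toReal with hT
  have hD0 : 0 ≤ D := ENNReal.toReal_nonneg
  have hT0 : 0 ≤ T := ENNReal.toReal_nonneg
  have hDe : coulomb (density ψ) = ENNReal.ofReal D := (ENNReal.ofReal_toReal hfin).symm
  have hTe : kinetic ψ = ENNReal.ofReal T := (ENNReal.ofReal_toReal (kinetic_lt_top ψ).ne).symm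
  -- `√ρ` need not be integrable and `ρ` need not be square integrable. Lowering `√ρ` by `1/(n+1)`
  -- leaves a function supported where `√ρ` is bounded below, hence integrable, without increasing
  -- translation differences. Capping `ρ` at `n` makes it square integrable without increasing `D`.
  -- Fatou's lemma removes both truncations.
  let f : ℕ → Space → ℝ := fun n x => max (φ x - 1 / (n + 1)) 0
  let g : ℕ → Space → ℝ := fun n x => min (φ x ^ 2) n
  have hfm : ∀ n, Measurable (f n) := fun n => (hφm.sub_const _).max measurable_const
  have hgm : ∀ n, Measurable (g n) := fun n => (hφm.pow_const 2).min measurable_const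
  have hf0 : ∀ n x, 0 ≤ f n x := fun n x => le_max_right _ _
  have hg0 : ∀ n x, 0 ≤ g n x := fun n x => le_min (sq_nonneg _) (Nat.cast_nonneg n)
  have hfφ : ∀ n x, f n x ≤ φ x := fun n x => max_le (by
    have : (0 : ℝ) ≤ 1 / (n + 1) := by positivity
    linarith) (hφ0 x)
  have hgφ : ∀ n x, g n x ≤ φ x ^ 2 := fun n x => min_le_left _ _
  have hf : ∀ n, Integrable (f n) := by
    intro n
    refine (hφ2.const_mul (n + 1 : ℝ)).mono' (hfm n).aestronglyMeasurable
      (Eventually.of_forall fun x => ?_)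
    rw [norm_eq_abs, abs_of_nonneg (hf0 n x)]
    refine max_le ?_ (by positivity)
    have hn : (0 : ℝ) < n + 1 := by positivity
    have h1 : (1 : ℝ) / (n + 1) * (n + 1) = 1 := by field_simp
    nlinarith [sq_nonneg ((n + 1) * φ x - 1), sq_nonneg (φ x), hφ0 x, one_div_pos.2 hn,
      mul_pos (one_div_pos.2 hn) (one_div_pos.2 hn)]
  have hg : ∀ n, Integrable (g n) := fun n =>
    hφ2.mono' (hgm n).aestronglyMeasurable (Eventually.of_forall fun x => by
      rw [norm_eq_abs, abs_of_nonneg (hg0 n x)]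
      exact hgφ n x)
  have hf2 : ∀ n, Integrable fun x => f n x ^ 2 := fun n =>
    hφ2.mono' ((hfm n).pow_const 2).aestronglyMeasurable (Eventually.of_forall fun x => by
      rw [norm_eq_abs, abs_sq]
      exact pow_le_pow_left₀ (hf0 n x) (hfφ n x) 2)
  have hg2 : ∀ n, Integrable fun x => g n x ^ 2 := fun n =>
    (hφ2.const_mul (n : ℝ)).mono' ((hgm n).pow_const 2).aestronglyMeasurable
      (Eventually.of_forall fun x => by
        rw [norm_eq_abs, abs_sq, sq]
        exact mul_le_mul (min_le_right _ _) (hgφ n x) (hg0 n x) (Nat.cast_nonneg n))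
  have hfg : ∀ n, Integrable fun x => g n x * f n x := fun n =>
    ((hf n).const_mul (n : ℝ)).mono' ((hgm n).mul (hfm n)).aestronglyMeasurable
      (Eventually.of_forall fun x => by
        rw [norm_eq_abs, abs_of_nonneg (mul_nonneg (hg0 n x) (hf0 n x))]
        exact mul_le_mul_of_nonneg_right (min_le_right _ _) (hf0 n x))
  have hfT : ∀ n t, 0 < t → (∫ x, f n x ^ 2) - heatForm t (f n) (f n) ≤ t * T := by
    intro n t ht
    refine integral_sq_sub_heatForm_le (hfm n) (hf n) (hf2 n) hT0 ht ?_
    have h := lintegral_heatKernelE_mul_sqrtDensity_sub_sq_le hψ hH1 ht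
    rw [hTe, ← ENNReal.ofReal_mul (by positivity)] at h
    refine le_trans ?_ h
    refine lintegral_mono fun h => mul_le_mul_right
      (lintegral_mono fun x => ENNReal.ofReal_le_ofReal ?_) _
    rw [sq_le_sq]
    refine (abs_max_sub_max_le_max _ _ _ _).trans ?_
    simp [hφ]
  have hDn : ∀ n, coulomb (fun x => ENNReal.ofReal (g n x)) ≤ ENNReal.ofReal D := by
    intro n
    rw [← hDe]
    refine coulomb_mono ((density_lt_top_ae hψ).mono fun x hx => ?_)
    rw [← ofReal_sqrtDensity_sq hx]
    exact ENNReal.ofReal_le_ofReal (hgφ n x)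
  have hmain : ∀ n, ENNReal.ofReal c * ∫⁻ x, ENNReal.ofReal (g n x * f n x) ≤
      ENNReal.ofReal (c ^ 2 / (16 * π)) * coulomb (density ψ) + kinetic ψ := by
    intro n
    have h := mul_integral_mul_le (hgm n) (hf n) (hg n) (hf2 n) (hg2 n) (hfg n) (hf0 n) (hg0 n)
      (hfT n) hD0 (hDn n) hc.le
    rw [hDe, hTe, ← ENNReal.ofReal_mul (by positivity), ← ENNReal.ofReal_add (by positivity) hT0,
      ← ofReal_integral_eq_lintegral_ofReal (hfg n) (Eventually.of_forall fun x =>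
        mul_nonneg (hg0 n x) (hf0 n x)), ← ENNReal.ofReal_mul hc.le]
    apply ENNReal.ofReal_le_ofReal
    refine h.trans (le_of_eq ?_)
    ring
  have hpt : ∀ x, Tendsto (fun n => ENNReal.ofReal c * ENNReal.ofReal (g n x * f n x)) atTop
      (𝓝 (ENNReal.ofReal c * ENNReal.ofReal (φ x ^ 3))) := by
    intro x
    refine ENNReal.Tendsto.const_mul (ENNReal.tendsto_ofReal ?_) (Or.inr ENNReal.ofReal_ne_top)
    have h1 : Tendsto (fun n => g n x) atTop (𝓝 (φ x ^ 2)) := by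
      refine tendsto_const_nhds.congr' ?_
      obtain ⟨m, hm⟩ := exists_nat_ge (φ x ^ 2)
      filter_upwards [eventually_ge_atTop m] with n hn
      exact (min_eq_left (hm.trans (by exact_mod_cast hn))).symm
    have h2 : Tendsto (fun n => f n x) atTop (𝓝 (φ x)) := by
      have h3 := (tendsto_one_div_add_atTop_nhds_zero_nat (𝕜 := ℝ)).const_sub (φ x)
      have h4 := h3.max (tendsto_const_nhds (x := (0 : ℝ)))
      rwa [sub_zero, max_eq_left (hφ0 x)] at h4
    rw [pow_succ]
    exact h1.mul h2
  rw [← lintegral_const_mul' _ _ ENNReal.ofReal_ne_top]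
  calc _ = ∫⁻ x, liminf (fun n => ENNReal.ofReal c * ENNReal.ofReal (g n x * f n x)) atTop :=
        lintegral_congr fun x => (hpt x).liminf_eq.symm
    _ ≤ liminf (fun n => ∫⁻ x, ENNReal.ofReal c * ENNReal.ofReal (g n x * f n x)) atTop :=
        lintegral_liminf_le fun n => (((hgm n).mul (hfm n)).ennreal_ofReal).const_mul _
    _ ≤ _ := by
        refine liminf_le_of_frequently_le' (Frequently.of_forall fun n => ?_)
        rw [lintegral_const_mul' _ _ ENNReal.ofReal_ne_top]
        exact hmain n

/-! ### Finiteness of the Coulomb energy -/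

section UnitField

variable {k : Fin 3}

/-- The components of `x / ‖x‖`. -/
def unitField (k : Fin 3) (x : Space) : ℝ := x k / ‖x‖

theorem measurable_unitField (k : Fin 3) : Measurable (unitField k) := by
  unfold unitField
  fun_prop

theorem abs_unitField_le (k : Fin 3) (x : Space) : |unitField k x| ≤ 1 := by
  rw [unitField, abs_div, abs_norm]
  refine div_le_one_of_le₀ ?_ (norm_nonneg _)
  simpa using PiLp.norm_apply_le x k

/-- `x / ‖x‖` is a subgradient of the convex function `‖·‖`, also at the origin where its value is
`0`. Subgradients are monotone, so each component increases along its own axis. -/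
theorem unitField_le_add (k : Fin 3) (x : Space) {s : ℝ} (hs : 0 < s) :
    unitField k x ≤ unitField k (x + EuclideanSpace.single k s) := by
  set y := x + EuclideanSpace.single k s with hy
  have h1 : 0 ≤ inner ℝ (‖y‖⁻¹ • y - ‖x‖⁻¹ • x) (y - x) := by
    have e : ∀ z : Space, ‖z‖⁻¹ * (‖z‖ * ‖z‖) = ‖z‖ := fun z => by
      rcases eq_or_ne ‖z‖ 0 with h | h
      · simp [h]
      · field_simp
    simp only [inner_sub_left, inner_sub_right, real_inner_smul_left, real_inner_self_eq_norm_mul_norm,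
      e]
    have h2 := real_inner_le_norm y x
    have h3 : ‖y‖⁻¹ * inner ℝ y x ≤ ‖x‖ := by
      refine (mul_le_mul_of_nonneg_left h2 (by positivity)).trans ?_
      rw [← mul_assoc]
      exact mul_le_of_le_one_left (norm_nonneg _) inv_mul_le_one
    have h4 : ‖x‖⁻¹ * inner ℝ x y ≤ ‖y‖ := by
      rw [real_inner_comm]
      refine (mul_le_mul_of_nonneg_left h2 (by positivity)).trans ?_
      rw [mul_comm ‖y‖, ← mul_assoc]
      exact mul_le_of_le_one_left (norm_nonneg _) inv_mul_le_one
    linarith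
  have h2 : y - x = EuclideanSpace.single k s := by simp [hy]
  rw [h2, EuclideanSpace.inner_single_right] at h1
  simp only [conj_trivial, PiLp.sub_apply, PiLp.smul_apply, smul_eq_mul] at h1
  have h3 := nonneg_of_mul_nonneg_right h1 hs
  rw [unitField, unitField, div_eq_inv_mul, div_eq_inv_mul]
  linarith

theorem hasDerivAt_unitField (k : Fin 3) {x : Space} (hx : x ≠ 0) :
    HasDerivAt (fun s : ℝ => unitField k (x + EuclideanSpace.single k s))
      (1 / ‖x‖ - x k ^ 2 / ‖x‖ ^ 3) 0 := by
  have hn : ‖x‖ ≠ 0 := norm_ne_zero_iff.2 hx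
  have h1 : HasDerivAt (fun s : ℝ => x + EuclideanSpace.single k s)
      (EuclideanSpace.single k (1 : ℝ)) 0 := by
    have : (fun s : ℝ => x + EuclideanSpace.single k s) =
        fun s : ℝ => x + s • EuclideanSpace.single k (1 : ℝ) := by
      ext s j
      simp
    rw [this]
    simpa using ((hasDerivAt_id (0 : ℝ)).smul_const (EuclideanSpace.single k (1 : ℝ))).const_add x
  have h2 := h1.norm_sq
  have e0 : x + EuclideanSpace.single k (0 : ℝ) = x := by simp
  rw [e0, EuclideanSpace.inner_single_right] at h2
  have h3 := h2.sqrt (by rw [e0]; positivity)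
  simp only [sqrt_sq (norm_nonneg _), e0] at h3
  have h4 : HasDerivAt (fun s : ℝ => (x + EuclideanSpace.single k s) k) 1 0 := by
    simpa using (hasDerivAt_id (0 : ℝ)).const_add (x k)
  have h5 := h4.div h3 (by rwa [e0])
  refine h5.congr_deriv ?_
  simp only [e0, conj_trivial]
  field_simp

theorem sum_deriv_unitField {x : Space} (hx : x ≠ 0) :
    ∑ k, (1 / ‖x‖ - x k ^ 2 / ‖x‖ ^ 3) = 2 / ‖x‖ := by
  have hn : ‖x‖ ≠ 0 := norm_ne_zero_iff.2 hx
  have h : ∑ k, x k ^ 2 = ‖x‖ ^ 2 := by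
    rw [EuclideanSpace.norm_sq_eq]
    simp
  rw [Finset.sum_sub_distrib, ← Finset.sum_div _ (fun k => x k ^ 2), h]
  simp only [Finset.sum_const, Finset.card_univ, Fintype.card_fin, nsmul_eq_mul]
  push_cast
  field_simp
  norm_num

end UnitField

/-! ### A Hardy-type bound for `∫ φ² / |x|`. -/

section Hardy

variable {φ : Space → ℝ} {T M : ℝ}

/-- Discrete integration by parts: a translation moves the difference from the bounded field to
`φ²`, which factors as a difference times a sum. Young's inequality with weight `s` leaves a bound
of order `s`. -/
theorem integral_unitField_sub_mul_sq_le (hφm : Measurable φ)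
    (hφ : Integrable fun x => φ x ^ 2) (hM : ∫ x, φ x ^ 2 ≤ M) (hT : 0 ≤ T) {k : Fin 3} {s : ℝ}
    (hs : 0 < s)
    (h : ∫⁻ x, ENNReal.ofReal ((φ (x + EuclideanSpace.single k s) - φ x) ^ 2) ≤
      ENNReal.ofReal (s ^ 2 * T)) :
    ∫ x, (unitField k (x + EuclideanSpace.single k s) - unitField k x) * φ x ^ 2 ≤
      s * (T / 2 + 2 * M) := by
  set v : Space := EuclideanSpace.single k s
  have hφv : Integrable fun x => φ (x + v) ^ 2 := hφ.comp_add_right v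
  have hFm := measurable_unitField k
  have i1 : Integrable fun x => unitField k (x + v) * φ x ^ 2 :=
    hφ.bdd_mul (c := 1) (hFm.comp (measurable_add_const v)).aestronglyMeasurable (Eventually.of_forall fun x => abs_unitField_le k _)
  have i2 : Integrable fun x => unitField k x * φ x ^ 2 :=
    hφ.bdd_mul (c := 1) (by fun_prop) (Eventually.of_forall fun x => abs_unitField_le k _)
  have i3 : Integrable fun x => unitField k (x + v) * φ (x + v) ^ 2 := i2.comp_add_right v
  have i4 : Integrable fun x => (φ (x + v) - φ x) ^ 2 := by
    refine ((hφ.add hφv).const_mul 2).mono' (by fun_prop) (Eventually.of_forall fun x => ?_)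
    rw [norm_eq_abs, abs_sq]
    simp only [Pi.add_apply]
    nlinarith [sq_nonneg (φ (x + v) + φ x)]
  have h4 : ∫ x, (φ (x + v) - φ x) ^ 2 ≤ s ^ 2 * T := by
    rw [← ofReal_integral_eq_lintegral_ofReal i4 (Eventually.of_forall fun x => sq_nonneg _),
      ENNReal.ofReal_le_ofReal_iff (by positivity)] at h
    exact h
  have e1 : ∫ x, (unitField k (x + v) - unitField k x) * φ x ^ 2 =
      ∫ x, unitField k (x + v) * (φ x ^ 2 - φ (x + v) ^ 2) := by
    simp_rw [sub_mul, mul_sub]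
    rw [integral_sub i1 i2, integral_sub i1 i3,
      integral_add_right_eq_self (fun x => unitField k x * φ x ^ 2) v]
  have e2 : ∫ x, φ (x + v) ^ 2 = ∫ x, φ x ^ 2 := integral_add_right_eq_self (fun x => φ x ^ 2) v
  have i5 : Integrable fun x => φ x ^ 2 + φ (x + v) ^ 2 := hφ.add hφv
  rw [e1]
  calc _ ≤ ∫ x, ((1 / (2 * s)) * (φ (x + v) - φ x) ^ 2 + s * (φ x ^ 2 + φ (x + v) ^ 2)) := by
        refine integral_mono ?_ ((i4.const_mul _).add (i5.const_mul s)) fun x => ?_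
        · simp_rw [mul_sub]
          exact i1.sub i3
        · simp only
          have h1 := abs_unitField_le k (x + v)
          set F := unitField k (x + v)
          set p := φ x
          set q := φ (x + v)
          have h2 : F * (p ^ 2 - q ^ 2) ≤ |q - p| * |p + q| := by
            refine (le_abs_self _).trans ?_
            have : p ^ 2 - q ^ 2 = -((q - p) * (p + q)) := by ring
            rw [abs_mul, this, abs_neg, abs_mul (q - p)]
            exact mul_le_of_le_one_left (by positivity) h1
          refine h2.trans ?_
          rw [← sq_abs (q - p)]
          have h3 : (p + q) ^ 2 ≤ 2 * (p ^ 2 + q ^ 2) := by nlinarith [sq_nonneg (p - q)]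
          rw [← sq_abs (p + q)] at h3
          have h5 : (1 / (2 * s)) * (2 * s) = 1 := by field_simp
          have h6 : 0 ≤ (1 / (2 * s)) * (|q - p| - s * |p + q|) ^ 2 := by positivity
          have h7 : (1 / (2 * s)) * (|q - p| - s * |p + q|) ^ 2 =
              (1 / (2 * s)) * |q - p| ^ 2 - |q - p| * |p + q| + s * |p + q| ^ 2 / 2 := by
            field_simp
            ring
          have h8 := mul_le_mul_of_nonneg_left h3 hs.le
          linarith
    _ = (1 / (2 * s)) * (∫ x, (φ (x + v) - φ x) ^ 2) + s * (2 * ∫ x, φ x ^ 2) := by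
        rw [integral_add (i4.const_mul _) (i5.const_mul s), integral_const_mul, integral_const_mul,
          integral_add hφ hφv, e2, two_mul (∫ x, φ x ^ 2)]
    _ ≤ (1 / (2 * s)) * (s ^ 2 * T) + s * (2 * M) := by gcongr
    _ = _ := by
        field_simp

/-- Divide the finite-difference bound by `s` and let `s → 0`. Monotonicity of the field makes the
quotients non-negative, so Fatou's lemma applies. -/
theorem lintegral_deriv_unitField_mul_sq_le (hφm : Measurable φ)
    (hφ : Integrable fun x => φ x ^ 2) (hM : ∫ x, φ x ^ 2 ≤ M) (hT : 0 ≤ T) {k : Fin 3}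
    (h : ∀ s, 0 < s → ∫⁻ x, ENNReal.ofReal ((φ (x + EuclideanSpace.single k s) - φ x) ^ 2) ≤
      ENNReal.ofReal (s ^ 2 * T)) :
    ∫⁻ x, ENNReal.ofReal ((1 / ‖x‖ - x k ^ 2 / ‖x‖ ^ 3) * φ x ^ 2) ≤
      ENNReal.ofReal (T / 2 + 2 * M) := by
  let s : ℕ → ℝ := fun n => 1 / ((n : ℝ) + 1)
  have hs : ∀ n, 0 < s n := fun n => by positivity
  let q : ℕ → Space → ℝ := fun n x => (s n)⁻¹ *
    ((unitField k (x + EuclideanSpace.single k (s n)) - unitField k x) * φ x ^ 2)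
  have hFm := measurable_unitField k
  have hq : ∀ n, ∫⁻ x, ENNReal.ofReal (q n x) ≤ ENNReal.ofReal (T / 2 + 2 * M) := by
    intro n
    have hi : Integrable fun x => (unitField k (x + EuclideanSpace.single k (s n)) - unitField k x) *
        φ x ^ 2 := by
      refine hφ.bdd_mul (c := 2) (by fun_prop) (Eventually.of_forall fun x => ?_)
      refine (abs_sub _ _).trans ?_
      linarith [abs_unitField_le k x, abs_unitField_le k (x + EuclideanSpace.single k (s n))]
    have h0 : ∀ x, 0 ≤ q n x := fun x => mul_nonneg (inv_nonneg.2 (hs n).le)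
      (mul_nonneg (sub_nonneg.2 (unitField_le_add k x (hs n))) (sq_nonneg _))
    rw [← ofReal_integral_eq_lintegral_ofReal (hi.const_mul _) (Eventually.of_forall h0),
      integral_const_mul]
    apply ENNReal.ofReal_le_ofReal
    rw [inv_mul_le_iff₀ (hs n)]
    exact integral_unitField_sub_mul_sq_le hφm hφ hM hT (hs n) (h _ (hs n))
  have hpt : ∀ᵐ x : Space, Tendsto (fun n => ENNReal.ofReal (q n x)) atTop
      (𝓝 (ENNReal.ofReal ((1 / ‖x‖ - x k ^ 2 / ‖x‖ ^ 3) * φ x ^ 2))) := by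
    filter_upwards [Measure.ae_ne volume (0 : Space)] with x hx
    refine ENNReal.tendsto_ofReal ?_
    have h1 := (hasDerivAt_unitField k hx).tendsto_slope_zero_right
    have h2 : Tendsto s atTop (𝓝[>] 0) :=
      tendsto_nhdsWithin_iff.2 ⟨tendsto_one_div_add_atTop_nhds_zero_nat,
        Eventually.of_forall hs⟩
    have h3 := (h1.comp h2).mul_const (φ x ^ 2)
    refine h3.congr fun n => ?_
    have e0 : x + EuclideanSpace.single k (0 : ℝ) = x := by simp
    simp only [Function.comp, zero_add, smul_eq_mul, q, e0, mul_assoc]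
  calc _ = ∫⁻ x, liminf (fun n => ENNReal.ofReal (q n x)) atTop :=
        lintegral_congr_ae (hpt.mono fun x hx => hx.liminf_eq.symm)
    _ ≤ liminf (fun n => ∫⁻ x, ENNReal.ofReal (q n x)) atTop :=
        lintegral_liminf_le fun n => by fun_prop
    _ ≤ _ := liminf_le_of_frequently_le' (Frequently.of_forall hq)

/-- Sum over the axes: the divergence of `x / ‖x‖` in dimension three is `2 / ‖x‖`. Only finiteness
is needed later, so the factor `2` is given away. -/
theorem lintegral_sq_div_norm_le (hφm : Measurable φ)
    (hφ : Integrable fun x => φ x ^ 2) (hM : ∫ x, φ x ^ 2 ≤ M) (hT : 0 ≤ T)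
    (h : ∀ k s, 0 < s → ∫⁻ x, ENNReal.ofReal ((φ (x + EuclideanSpace.single k s) - φ x) ^ 2) ≤
      ENNReal.ofReal (s ^ 2 * T)) :
    ∫⁻ x, ENNReal.ofReal (φ x ^ 2) / ‖x‖ₑ ≤ 3 * ENNReal.ofReal (T / 2 + 2 * M) := by
  have hle : ∀ᵐ x : Space, ENNReal.ofReal (φ x ^ 2) / ‖x‖ₑ ≤
      ∑ k, ENNReal.ofReal ((1 / ‖x‖ - x k ^ 2 / ‖x‖ ^ 3) * φ x ^ 2) := by
    filter_upwards [Measure.ae_ne volume (0 : Space)] with x hx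
    have hn : 0 < ‖x‖ := norm_pos_iff.2 hx
    have h0 : ∀ k, 0 ≤ 1 / ‖x‖ - x k ^ 2 / ‖x‖ ^ 3 := by
      intro k
      have h1 : x k ^ 2 ≤ ‖x‖ ^ 2 := by
        rw [← sq_abs]
        exact pow_le_pow_left₀ (abs_nonneg _) (by simpa using PiLp.norm_apply_le x k) 2
      have h2 : 1 / ‖x‖ = ‖x‖ ^ 2 / ‖x‖ ^ 3 := by field_simp
      rw [h2, sub_nonneg]
      gcongr
    rw [← ENNReal.ofReal_sum_of_nonneg fun k _ => mul_nonneg (h0 k) (sq_nonneg _), ← Finset.sum_mul,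
      sum_deriv_unitField hx, ← ofReal_norm, ← ENNReal.ofReal_div_of_pos hn]
    apply ENNReal.ofReal_le_ofReal
    have : 0 ≤ φ x ^ 2 / ‖x‖ := by positivity
    have e : 2 / ‖x‖ * φ x ^ 2 = 2 * (φ x ^ 2 / ‖x‖) := by ring
    linarith
  refine (lintegral_mono_ae hle).trans ?_
  rw [lintegral_finsetSum _ fun k _ => by fun_prop]
  refine (Finset.sum_le_sum fun k _ =>
    lintegral_deriv_unitField_mul_sq_le hφm hφ hM hT (h k)).trans (le_of_eq ?_)
  simp

end Hardy

theorem lintegral_density_div_norm_sub_le {N : ℕ} {ψ : WaveFun N} (hψ : ‖ψ‖ = 1) (hH1 : MemH1 ψ)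
    (a : Space) :
    ∫⁻ x, density ψ x / ‖a - x‖ₑ ≤ 3 * ENNReal.ofReal ((kinetic ψ).toReal / 2 + 2 * N) := by
  have hm := measurable_sqrtDensity ψ
  have hi := integrable_sqrtDensity_sq hψ
  have hM : ∫ x, sqrtDensity ψ (x + a) ^ 2 ≤ N := by
    rw [integral_add_right_eq_self (fun x => sqrtDensity ψ x ^ 2) a]
    have h := lintegral_ofReal_sqrtDensity_sq hψ
    rw [← ofReal_integral_eq_lintegral_ofReal hi (Eventually.of_forall fun x => sq_nonneg _),
      ← ENNReal.ofReal_natCast] at h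
    exact (ENNReal.ofReal_le_ofReal_iff (Nat.cast_nonneg N)).1 h.le
  have hT : ∀ (k : Fin 3) (s : ℝ), 0 < s → ∫⁻ x, ENNReal.ofReal
      ((sqrtDensity ψ (x + EuclideanSpace.single k s + a) - sqrtDensity ψ (x + a)) ^ 2) ≤
      ENNReal.ofReal (s ^ 2 * (kinetic ψ).toReal) := by
    intro k s _
    have h := lintegral_sqrtDensity_sub_sq_single_le hψ hH1 k s
    rw [← ENNReal.ofReal_toReal (kinetic_lt_top ψ).ne, ← ENNReal.ofReal_mul (sq_nonneg s)] at h
    refine le_trans (le_of_eq ?_) h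
    rw [← lintegral_add_right_eq_self (fun x => ENNReal.ofReal
      ((sqrtDensity ψ (x + EuclideanSpace.single k s) - sqrtDensity ψ x) ^ 2)) a]
    simp only [add_right_comm]
  have key := lintegral_sq_div_norm_le (φ := fun x => sqrtDensity ψ (x + a)) (by fun_prop)
    (hi.comp_add_right a) hM ENNReal.toReal_nonneg hT
  refine le_trans (le_of_eq ?_) key
  rw [← lintegral_add_right_eq_self (fun x => density ψ x / ‖a - x‖ₑ) a]
  have hfin := (measurePreserving_add_right volume a).quasiMeasurePreserving.ae (density_lt_top_ae hψ)
  refine lintegral_congr_ae (hfin.mono fun x hx => ?_)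
  simp only
  rw [ofReal_sqrtDensity_sq hx]
  congr 1
  rw [← enorm_neg]
  simp

/-- The potential of the density is bounded uniformly in the base point, and the density has mass
`N`. Finiteness is what permits cancelling `D` in the Lieb–Oxford argument and computing with real
numbers afterwards. -/
theorem coulomb_density_lt_top {N : ℕ} {ψ : WaveFun N} (hψ : ‖ψ‖ = 1) (hH1 : MemH1 ψ) :
    coulomb (density ψ) < ⊤ := by
  have hm := measurable_density ψ
  calc coulomb (density ψ) ≤ ∫⁻ x, density ψ x *
        (3 * ENNReal.ofReal ((kinetic ψ).toReal / 2 + 2 * N)) := by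
        refine lintegral_mono fun x => ?_
        simp_rw [mul_div_assoc]
        rw [lintegral_const_mul _ (by fun_prop)]
        exact mul_le_mul_right (lintegral_density_div_norm_sub_le hψ hH1 x) _
    _ = N * (3 * ENNReal.ofReal ((kinetic ψ).toReal / 2 + 2 * N)) := by
        rw [lintegral_mul_const _ hm, lintegral_density hψ]
    _ < ⊤ := ENNReal.mul_lt_top (ENNReal.natCast_lt_top N)
        (ENNReal.mul_lt_top (by simp) ENNReal.ofReal_lt_top)

/-! ### The lower bound -/

/-- Young's inequality interpolating `∫ ρ^{4/3}` between `∫ ρ` and `∫ ρ^{3/2}`. -/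
theorem rpow_four_thirds_le {y ε : ℝ} (hy : 0 ≤ y) (hε : 0 < ε) :
    y ^ (4 / 3 : ℝ) ≤ 2 * ε / 3 * √y ^ 3 + y / (3 * ε ^ 2) := by
  -- A sixth root makes every exponent an integer; the inequality becomes `(ε z - 1)² (2 ε z + 1) ≥
  -- 0`.
  obtain ⟨z, hz, rfl⟩ : ∃ z : ℝ, 0 ≤ z ∧ y = z ^ 6 :=
    ⟨y ^ (1 / 6 : ℝ), by positivity, by rw [← rpow_natCast, ← rpow_mul hy]; norm_num⟩
  have e1 : (z ^ 6) ^ (4 / 3 : ℝ) = z ^ 8 := by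
    rw [← rpow_natCast, ← rpow_mul hz, ← rpow_natCast]
    norm_num
  have e2 : √(z ^ 6) = z ^ 3 := by
    rw [show z ^ 6 = (z ^ 3) ^ 2 by ring, sqrt_sq (by positivity)]
  rw [e1, e2]
  have h : 0 ≤ (ε * z - 1) ^ 2 * (2 * (ε * z) + 1) := by positivity
  have e3 : 2 * ε / 3 * (z ^ 3) ^ 3 + z ^ 6 / (3 * ε ^ 2) - z ^ 8 =
      z ^ 6 / (3 * ε ^ 2) * ((ε * z - 1) ^ 2 * (2 * (ε * z) + 1)) := by
    field_simp
    ring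
  have h2 : 0 ≤ z ^ 6 / (3 * ε ^ 2) * ((ε * z - 1) ^ 2 * (2 * (ε * z) + 1)) := by positivity
  linarith

theorem lintegral_density_rpow_le {N : ℕ} {ψ : WaveFun N} (hψ : ‖ψ‖ = 1) {ε : ℝ} (hε : 0 < ε) :
    ∫⁻ x, ENNReal.ofReal ((density ψ x).toReal ^ (4 / 3 : ℝ)) ≤
      ENNReal.ofReal (2 * ε / 3) * (∫⁻ x, ENNReal.ofReal (sqrtDensity ψ x ^ 3)) +
        ENNReal.ofReal (1 / (3 * ε ^ 2)) * N := by
  have hm := measurable_sqrtDensity ψ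
  rw [← lintegral_density hψ, ← lintegral_const_mul' _ _ ENNReal.ofReal_ne_top,
    ← lintegral_const_mul' _ _ ENNReal.ofReal_ne_top, ← lintegral_add_left (by fun_prop)]
  refine lintegral_mono_ae ((density_lt_top_ae hψ).mono fun x hx => ?_)
  conv_rhs => rw [← ENNReal.ofReal_toReal hx.ne]
  rw [← ENNReal.ofReal_mul (by positivity), ← ENNReal.ofReal_mul (by positivity),
    ← ENNReal.ofReal_add (mul_nonneg (by positivity) (pow_nonneg (sqrtDensity_nonneg ψ x) 3))
      (by positivity)]
  apply ENNReal.ofReal_le_ofReal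
  refine (rpow_four_thirds_le ENNReal.toReal_nonneg hε).trans (le_of_eq ?_)
  rw [sqrtDensity]
  ring

/-- The lower bound for the energy of a single state, with the repulsion strength `V ≤ U` left
as a parameter. -/
theorem le_functional {N : ℕ} {ψ : WaveFun N} (hψ : ‖ψ‖ = 1) (hH1 : MemH1 ψ) {U V α : ℝ}
    (hα : 0 < α) (hV : 2 * α < V) (hVU : V ≤ U) :
    ((-(1.68 ^ 3 * V ^ 3 * N / (54 * π * (V - 2 * α))) : ℝ) : EReal) ≤ functional U α ψ := by
  have hDfin := (coulomb_density_lt_top hψ hH1).ne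
  have hTfin := (kinetic_lt_top ψ).ne
  have hU : 0 < U := by linarith
  -- With `T` and `D` finite, infinite repulsion makes the functional `⊤`, and nothing is left to
  -- prove.
  by_cases hR : repulsion ψ = ⊤
  · have hTop : functional U α ψ = ⊤ := by
      rw [functional, hR, EReal.coe_ennreal_top, EReal.coe_mul_top_of_pos hU,
        ← ENNReal.ofReal_toReal hDfin, ← ENNReal.ofReal_toReal hTfin, EReal.coe_ennreal_ofReal,
        EReal.coe_ennreal_ofReal, EReal.coe_add_top, ← EReal.coe_mul, EReal.top_sub_coe]
    rw [hTop]
    exact le_top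
  -- The coefficient of `D` that survives once Lieb–Oxford has replaced `V R` by `V D / 2`.
  set a := V / 2 - α with ha
  have ha0 : 0 < a := by rw [ha]; linarith
  have hV0 : 0 < V := by linarith
  set r := √(π * a) with hr
  have hr2 : r ^ 2 = π * a := sq_sqrt (by positivity)
  have hr0 : 0 < r := sqrt_pos.2 (by positivity)
  have h1 := coulomb_le_two_mul_repulsion_add hψ hDfin
  -- With `c = 4r` and `r² = π a`, the coefficient `c² / (16π)` equals `a`, so `a D + T ≥ 4 r ∫
  -- ρ^{3/2}`.
  have h2 := lintegral_sqrtDensity_pow_three_le hψ hH1 hDfin (c := 4 * r) (by positivity)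
  -- This `ε` makes `1.68 V · 2ε/3 = 4r`, so that the `∫ ρ^{3/2}` terms cancel exactly.
  have h3 := lintegral_density_rpow_le hψ (ε := 6 * r / (1.68 * V)) (by positivity)
  set Y := ∫⁻ x, ENNReal.ofReal (sqrtDensity ψ x ^ 3)
  set Z := ∫⁻ x, ENNReal.ofReal ((density ψ x).toReal ^ (4 / 3 : ℝ))
  have hY : Y ≠ ⊤ := by
    intro hY
    rw [hY, ENNReal.mul_top (by simp; positivity), top_le_iff] at h2
    exact ENNReal.add_ne_top.2 ⟨ENNReal.mul_ne_top ENNReal.ofReal_ne_top hDfin, hTfin⟩ h2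
  have hZ : Z ≠ ⊤ := ne_top_of_le_ne_top (ENNReal.add_ne_top.2
    ⟨ENNReal.mul_ne_top ENNReal.ofReal_ne_top hY,
      ENNReal.mul_ne_top ENNReal.ofReal_ne_top (ENNReal.natCast_ne_top N)⟩) h3
  rw [functional]
  generalize kinetic ψ = T at *
  generalize coulomb (density ψ) = D at *
  generalize repulsion ψ = R at *
  generalize Y = Y at *
  generalize Z = Z at *
  lift T to NNReal using hTfin
  lift D to NNReal using hDfin
  lift R to NNReal using hR
  lift Y to NNReal using hY
  lift Z to NNReal using hZ
  have g1 := ENNReal.toReal_mono (by finiteness) h1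
  have g2 := ENNReal.toReal_mono (by finiteness) h2
  have g3 := ENNReal.toReal_mono (by finiteness) h3
  rw [ENNReal.toReal_add (by finiteness) (by finiteness), ENNReal.toReal_mul, ENNReal.toReal_mul,
    ENNReal.toReal_ofReal (by positivity)] at g1
  rw [ENNReal.toReal_add (by finiteness) (by finiteness), ENNReal.toReal_mul, ENNReal.toReal_mul,
    ENNReal.toReal_ofReal (by positivity), ENNReal.toReal_ofReal (by positivity)] at g2
  rw [ENNReal.toReal_add (by finiteness) (by finiteness), ENNReal.toReal_mul, ENNReal.toReal_mul,
    ENNReal.toReal_ofReal (by positivity), ENNReal.toReal_ofReal (by positivity)] at g3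
  simp only [ENNReal.coe_toReal, ENNReal.toReal_ofNat, ENNReal.toReal_natCast] at g1 g2 g3
  simp only [EReal.coe_nnreal_eq_coe_real]
  rw [← EReal.coe_mul, ← EReal.coe_mul, ← EReal.coe_add, ← EReal.coe_sub, EReal.coe_le_coe_iff]
  have k2 : (4 * r) ^ 2 / (16 * π) = a := by
    rw [mul_pow, hr2]
    field_simp
    norm_num
  have k3 : 2 * (6 * r / (1.68 * V)) / 3 = 4 * r / (1.68 * V) := by ring
  have k4 : 1 / (3 * (6 * r / (1.68 * V)) ^ 2) * N * (1.68 * V) =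
      1.68 ^ 3 * V ^ 3 * N / (54 * π * (V - 2 * α)) := by
    have : V - 2 * α = 2 * a := by rw [ha]; ring
    rw [this, div_pow, mul_pow, hr2]
    field_simp
    ring
  rw [k2] at g2
  rw [k3] at g3
  have g4 := mul_le_mul_of_nonneg_right g3 (show (0 : ℝ) ≤ 1.68 * V by positivity)
  have k5 : (4 * r / (1.68 * V) * (Y : ℝ) + 1 / (3 * (6 * r / (1.68 * V)) ^ 2) * N) * (1.68 * V) =
      4 * r * Y + 1.68 ^ 3 * V ^ 3 * N / (54 * π * (V - 2 * α)) := by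
    rw [add_mul, k4]
    field_simp
  rw [k5] at g4
  have g5 := mul_le_mul_of_nonneg_left g1 (show (0 : ℝ) ≤ V / 2 by positivity)
  have g6 := mul_le_mul_of_nonneg_right hVU (NNReal.coe_nonneg R)
  have k6 : a * (D : ℝ) = V / 2 * D - α * D := by rw [ha]; ring
  linarith

theorem le_energy (N : ℕ) {U V α : ℝ} (hα : 0 < α) (hV : 2 * α < V) (hVU : V ≤ U) :
    ((-(1.68 ^ 3 * V ^ 3 * N / (54 * π * (V - 2 * α))) : ℝ) : EReal) ≤ energy N U α :=
  le_iInf fun _ => le_iInf fun hH1 => le_iInf fun hψ => le_functional hψ hH1 hα hV hVU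

end

end Pekar

/-! ### The choice of `V` and the final numerical constants. -/

theorem proposition1 (N : ℕ) (hN : 1 ≤ N) (U α : ℝ) (hα : 0 < α) (hU : 2 * α < U) :
    (U < 3 * α →
      ((-(0.0280 * N * (U ^ 3 / (U - 2 * α))) : ℝ) : EReal) ≤ Pekar.energy N U α) ∧
    (3 * α ≤ U → ((-(0.755 * N * α ^ 2) : ℝ) : EReal) ≤ Pekar.energy N U α) := by
  have hπ := Real.pi_gt_d6
  constructor
  · intro _
    refine le_trans ?_ (Pekar.le_energy N hα hU le_rfl)
    rw [EReal.coe_le_coe_iff, neg_le_neg_iff]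
    have h0 : 0 < U - 2 * α := by linarith
    have hU0 : 0 < U := by linarith
    -- The left side is about `0.02795`.
    have h1 : 1.68 ^ 3 / (54 * Real.pi) ≤ 0.0280 := by
      rw [div_le_iff₀ (by positivity)]
      linarith
    have h2 := mul_le_mul_of_nonneg_right h1 (show 0 ≤ N * (U ^ 3 / (U - 2 * α)) by positivity)
    calc _ = 1.68 ^ 3 / (54 * Real.pi) * (N * (U ^ 3 / (U - 2 * α))) := by field_simp
      _ ≤ _ := h2
      _ = _ := by ring
  · intro h
    -- On `V > 2α` the function `V³ / (V - 2α)` attains its minimum at `V = 3α`, with value `27 α²`.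
    refine le_trans ?_ (Pekar.le_energy N hα (V := 3 * α) (by linarith) h)
    rw [EReal.coe_le_coe_iff, neg_le_neg_iff]
    have h1 : 1.68 ^ 3 * 27 / (54 * Real.pi) ≤ 0.755 := by
      rw [div_le_iff₀ (by positivity)]
      linarith
    have h2 := mul_le_mul_of_nonneg_right h1 (show 0 ≤ N * α ^ 2 by positivity)
    have e : 3 * α - 2 * α = α := by ring
    calc _ = 1.68 ^ 3 * 27 / (54 * Real.pi) * (N * α ^ 2) := by
          rw [e]
          field_simp
          norm_num
      _ ≤ _ := h2
      _ = _ := by ring
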